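/- Let $k$ be an infinite field, $n\ge 0$, $S=k[\![x_1,\dots,x_n,z]\!]$, let $f\in S$ be nonzero of order at least $4$, and set $R=S/(f)$. Terminology. A finitely generated $R$-module $M$ is MCM if $\operatorname{depth}M=\dim R$ or $M=0$; $\operatorname{MCM}(R)$ is the full subcategory of MCM modules. A *representation embedding* between full subcategories of module categories is an exact functor (additive and preserving short exact sequences of modules) that preserves non-isomorphism and indecomposability. A local $k$-algebra $R$ has *wild Cohen–Macaulay type* if for every finite-dimensional, not necessarily commutative, $k$-algebra $\Lambda$ there is a representation embedding $\operatorname{mod}\Lambda\to\operatorname{MCM}(R)$, where $\operatorname{mod}\Lambda$ is the category of finitely generated left $\Lambda$-modules. (1) With parameters $a_1,\dots,a_n$, the series $f$ can be written as $$f=z^2h+\sum_{i=1}^n(x_i-a_iz)\,g_i,\qquad h,g_1,\dots,g_n\in k[a_1,\dots,a_n][\![x_1,\dots,x_n,z]\!],\tag{$*$}$$ where $h$ has order at least $2$ and each $g_i$ has order at least $3$ in $x_1,\dots,x_n,z$. (2) Fix any expression $(*)$. Put $\varphi_0=[z^2]$, $\psi_0=[h]$, and for $1\le i\le n$ $$\varphi_i=\begin{bmatrix}\varphi_{i-1}&-g_i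 I\\ (x_i-a_iz)I&\psi_{i-1}\end{bmatrix},\qquad \psi_i=\begin{bmatrix}\psi_{i-1}&g_i I\\ -(x_i-a_iz)I&\varphi_{i-1}\end{bmatrix}.$$ For pairwise commuting $m\times m$ matrices $A_1,\dots,A_n$ over $k$, let $\Phi(A_1,\dots,A_n)$ and $\Psi(A_1,\dots,A_n)$ be the $m2^n\times m2^n$ matrices over $S$ obtained from $\varphi_n,\psi_n$ by replacing each entry by the $m\times m$ block in which each $a_i$ is replaced by $A_i$, and each scalar and each variable $x_i$, $z$ by its product with the $m \times m$ identity matrix. Then $\Phi\Psi=\Psi\Phi=f\cdot I$, i.e. $(\Phi,\Psi)$ is a matrix factorization of $f$. Choose a $k$-basis of every finite-length $k[a_1,\dots,a_n]$-module, and let $F$ be the functor sending a module on which $a_1,\dots,a_n$ act by the matrices $A_1,\dots,A_n$ to the $R$-module $\operatorname{cok}\Phi(A_1,\dots,A_n)$ corresponding to this matrix factorization, and a homomorphism with matrix $U$ to the map induced by the block-diagonal matrix $\operatorname{diag}(U,\dots,U)$. Then, for every choice of bases, $F$ takes values in $\operatorname{MCM}(R)$ and is a representation embedding of the category of finite-length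 $k[a_1,\dots,a_n]$-modules into $\operatorname{MCM}(R)$. (3) In particular, if $n\ge 2$, then $R$ has wild Cohen–Macaulay type. -/

import Mathlib

open CategoryTheory

namespace WildHypersurface

universe u v

noncomputable section

/-! ### Maximal Cohen–Macaulay modules -/

/-- The depth of a module over a local ring: the supremum of the lengths of the `M`-regular
sequences in the maximal ideal. -/
def depth (R : Type u) [CommRing R] [IsLocalRing R] (M : Type v) [AddCommGroup M] [Module R M] :
    ℕ∞ :=
  ⨆ (rs : List R) (_ : (∀ r ∈ rs, r ∈ IsLocalRing.maximalIdeal R) ∧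
    RingTheory.Sequence.IsRegular M rs), (rs.length : ℕ∞)

/-- Maximal Cohen–Macaulay modules over a local ring. As usual, the zero module (whose depth is
infinite by convention) is admitted as an object of the category of MCM modules. -/
def IsMCM (R : Type u) [CommRing R] [IsLocalRing R] (M : Type v) [AddCommGroup M] [Module R M] :
    Prop :=
  Module.Finite R M ∧ (Subsingleton M ∨ ((depth R M : ℕ∞) : WithBot ℕ∞) = ringKrullDim R)

/-- The objects of `MCM(R)`. -/
def mcm (R : Type u) [CommRing R] [IsLocalRing R] : ObjectProperty (ModuleCat.{u} R) :=
  fun M => IsMCM R M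

/-! ### Representation embeddings and wildness -/

/-- The objects of `mod Λ`: finitely generated left modules. -/
def finGen (Λ : Type v) [Ring Λ] : ObjectProperty (ModuleCat.{u} Λ) :=
  fun M => Module.Finite Λ M

/-- Modules of finite length. -/
def finLength (Q : Type v) [Ring Q] : ObjectProperty (ModuleCat.{u} Q) :=
  fun M => IsFiniteLength Q M

/-- A representation embedding between full subcategories `P`, `C` of module categories:
an exact functor which preserves non-isomorphism and indecomposability.  Exact means additive and
preserving short exact sequences, where a sequence in a full subcategory of a
module category is short exact when it is so as a sequence of modules. -/
structure IsRepresentationEmbedding {Λ R : Type*} [Ring Λ] [Ring R]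
    {P : ObjectProperty (ModuleCat.{u} Λ)} {C : ObjectProperty (ModuleCat.{u} R)}
    (G : P.FullSubcategory ⥤ C.FullSubcategory) : Prop where
  additive : G.Additive
  exact : ∀ E : ShortComplex P.FullSubcategory,
    (E.map P.ι).ShortExact → ((E.map G).map C.ι).ShortExact
  nonIso : ∀ X Y : P.FullSubcategory, Nonempty (G.obj X ≅ G.obj Y) → Nonempty (X ≅ Y)
  indecomposable : ∀ X : P.FullSubcategory, Indecomposable X.obj → Indecomposable (G.obj X).obj

/-- A full subcategory `C` of `R`-modules is wild if for every finite-dimensional (associative,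
unital, not necessarily commutative) `k`-algebra `Λ` there is a representation embedding
`mod Λ → C`. -/
def IsWild (k : Type u) [Field k] {R : Type u} [Ring R] (C : ObjectProperty (ModuleCat.{u} R)) :
    Prop :=
  ∀ (Λ : Type u) [Ring Λ] [Algebra k Λ] [Module.Finite k Λ],
    ∃ G : (finGen.{u} Λ).FullSubcategory ⥤ C.FullSubcategory, IsRepresentationEmbedding G

/-- The local `k`-algebra `R` has wild Cohen–Macaulay type. -/
def HasWildCMType (k : Type u) [Field k] (R : Type u) [CommRing R] [IsLocalRing R] [Algebra k R] :
    Prop :=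
  IsWild k (mcm R)

/-! ### The hypersurface ring and the expressions of `f` -/

/-- Power series in `x_1, …, x_n, z` over `A`; the last variable is `z`. -/
abbrev PS (A : Type u) [CommRing A] (n : ℕ) : Type u := MvPowerSeries (Fin (n + 1)) A

/-- The variable `x_i`. -/
def xVar (A : Type u) [CommRing A] {n : ℕ} (i : Fin n) : PS A n := MvPowerSeries.X i.castSucc

/-- The variable `z`. -/
def zVar (A : Type u) [CommRing A] (n : ℕ) : PS A n := MvPowerSeries.X (Fin.last n)

/-- The hypersurface ring `S / (f)`. -/
abbrev Hypersurface {k : Type u} [Field k] {n : ℕ} (f : PS k n) : Type u :=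
  PS k n ⧸ Ideal.span {f}

theorem isLocalRing_hypersurface {k : Type u} [Field k] {n : ℕ} {f : PS k n} (hf : 4 ≤ f.order) :
    IsLocalRing (Hypersurface f) := by
  have hnu : ¬ IsUnit f := by
    intro h
    have h0 : MvPowerSeries.constantCoeff f = 0 := by
      rw [← MvPowerSeries.coeff_zero_eq_constantCoeff_apply]
      apply MvPowerSeries.coeff_of_lt_order
      rw [map_zero]
      exact lt_of_lt_of_le (by norm_num) hf
    have := h.map (MvPowerSeries.constantCoeff (σ := Fin (n + 1)) (R := k))
    rw [h0] at this
    exact not_isUnit_zero this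
  have : Nontrivial (Hypersurface f) :=
    Ideal.Quotient.nontrivial_iff.mpr (fun h => hnu (Ideal.span_singleton_eq_top.mp h))
  exact IsLocalRing.of_surjective' (Ideal.Quotient.mk (Ideal.span {f})) Ideal.Quotient.mk_surjective

/-- `f = z² h + ∑ (x_i - a_i z) g_i`, where `h` and the `g_i` are power series in `x_1, …, x_n, z`
whose coefficients are polynomials in the parameters `a_1, …, a_n`, of order at least `2` and `3`
respectively (in `x_1, …, x_n, z`). -/
structure IsExpression {k : Type u} [Field k] {n : ℕ} (f : PS k n)
    (h : PS (MvPolynomial (Fin n) k) n) (g : Fin n → PS (MvPolynomial (Fin n) k) n) : Prop where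
  eq : MvPowerSeries.map MvPolynomial.C f =
    zVar _ n ^ 2 * h +
      ∑ i, (xVar _ i - MvPowerSeries.C (MvPolynomial.X i) * zVar _ n) * g i
  two_le_order : 2 ≤ h.order
  three_le_order : ∀ i, 3 ≤ (g i).order

/-! ### The matrix factorizations -/

/-- Matrix factorizations `(φ, ψ)` of `f`. -/
def IsMatrixFactorization {B : Type*} [CommRing B] {κ : Type*} [Fintype κ] [DecidableEq κ] (f : B)
    (φ ψ : Matrix κ κ B) : Prop :=
  φ * ψ = f • (1 : Matrix κ κ B) ∧ ψ * φ = f • (1 : Matrix κ κ B)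

/-- An index set with `2 ^ i` elements, split into halves recursively. -/
def Idx : ℕ → Type
  | 0 => Unit
  | i + 1 => Idx i ⊕ Idx i

instance Idx.fintype : (i : ℕ) → Fintype (Idx i)
  | 0 => inferInstanceAs (Fintype Unit)
  | i + 1 =>
    haveI := Idx.fintype i
    inferInstanceAs (Fintype (Idx i ⊕ Idx i))

instance Idx.decidableEq : (i : ℕ) → DecidableEq (Idx i)
  | 0 => inferInstanceAs (DecidableEq Unit)
  | i + 1 =>
    haveI := Idx.decidableEq i
    inferInstanceAs (DecidableEq (Idx i ⊕ Idx i))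

/-- The pair `(φ_i, ψ_i)` built from `p q + u_1 v_1 + ⋯ + u_i v_i` by
`(φ_0, ψ_0) = ([p], [q])` and
`φ_i = [φ_{i-1}, -v_i; u_i, ψ_{i-1}]`, `ψ_i = [ψ_{i-1}, v_i; -u_i, φ_{i-1}]`. -/
def knorrer {B : Type*} [CommRing B] (p q : B) : (i : ℕ) → (Fin i → B) → (Fin i → B) →
    Matrix (Idx i) (Idx i) B × Matrix (Idx i) (Idx i) B
  | 0, _, _ => (Matrix.of fun _ _ => p, Matrix.of fun _ _ => q)
  | i + 1, u, v =>
    (Matrix.fromBlocks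
      (knorrer p q i (Fin.init u) (Fin.init v)).1
      (-(v (Fin.last i)) • (1 : Matrix (Idx i) (Idx i) B))
      (u (Fin.last i) • (1 : Matrix (Idx i) (Idx i) B))
      (knorrer p q i (Fin.init u) (Fin.init v)).2,
     Matrix.fromBlocks
      (knorrer p q i (Fin.init u) (Fin.init v)).2
      (v (Fin.last i) • (1 : Matrix (Idx i) (Idx i) B))
      (-(u (Fin.last i)) • (1 : Matrix (Idx i) (Idx i) B))
      (knorrer p q i (Fin.init u) (Fin.init v)).1)

/-- The pair `(φ_n, ψ_n)`, with entries in the power series over `k[a_1, …, a_n]`, attached to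
`z² h + ∑ (x_i - a_i z) g_i`. -/
def paramFactorization {k : Type u} [Field k] {n : ℕ}
    (h : PS (MvPolynomial (Fin n) k) n) (g : Fin n → PS (MvPolynomial (Fin n) k) n) :
    Matrix (Idx n) (Idx n) (PS (MvPolynomial (Fin n) k) n) ×
      Matrix (Idx n) (Idx n) (PS (MvPolynomial (Fin n) k) n) :=
  knorrer (zVar _ n ^ 2) h n
    (fun i => xVar _ i - MvPowerSeries.C (MvPolynomial.X i) * zVar _ n) g

section Inflation

variable {k : Type u} [Field k] {n : ℕ} {ι ι' : Type*} [Fintype ι] [DecidableEq ι]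
  [Fintype ι'] [DecidableEq ι']

/-- The matrix `p(A_1, …, A_n)`, for a polynomial `p` in `a_1, …, a_n` and (commuting) matrices
`A_1, …, A_n`. -/
def evalMatrix (A : Fin n → Matrix ι ι k) (p : MvPolynomial (Fin n) k) : Matrix ι ι k :=
  ∑ s ∈ p.support, p.coeff s • (List.ofFn fun i => A i ^ s i).prod

/-- Inflation of a matrix `E` of power series whose coefficients are polynomials in `a_1, …, a_n`:
each entry is replaced by the block obtained by evaluating all its coefficients at
`A_1, …, A_n` (constants becoming scalar matrices). -/
def inflate {ρ : Type*} (E : Matrix ρ ρ (PS (MvPolynomial (Fin n) k) n))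
    (A : Fin n → Matrix ι ι k) : Matrix (ρ × ι) (ρ × ι) (PS k n) :=
  Matrix.of fun r s w => evalMatrix A (MvPowerSeries.coeff w (E r.1 s.1)) r.2 s.2

/-- `Φ(A_1, …, A_n)`. -/
def inflatedPhi (h : PS (MvPolynomial (Fin n) k) n) (g : Fin n → PS (MvPolynomial (Fin n) k) n)
    (A : Fin n → Matrix ι ι k) : Matrix (Idx n × ι) (Idx n × ι) (PS k n) :=
  inflate (paramFactorization h g).1 A

/-- `Ψ(A_1, …, A_n)`. -/
def inflatedPsi (h : PS (MvPolynomial (Fin n) k) n) (g : Fin n → PS (MvPolynomial (Fin n) k) n)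
    (A : Fin n → Matrix ι ι k) : Matrix (Idx n × ι) (Idx n × ι) (PS k n) :=
  inflate (paramFactorization h g).2 A

/-- The block-diagonal matrix with the constant matrix `U` down the diagonal. -/
def blockDiag (n : ℕ) (ρ : Type*) [DecidableEq ρ] (U : Matrix ι' ι k) :
    Matrix (ρ × ι') (ρ × ι) (PS k n) :=
  Matrix.of fun r s => if r.1 = s.1 then MvPowerSeries.C (U r.2 s.2) else 0


theorem evalMatrix_intertwine {A : Fin n → Matrix ι ι k} {A' : Fin n → Matrix ι' ι' k}
    {U : Matrix ι' ι k} (hU : ∀ i, U * A i = A' i * U) (p : MvPolynomial (Fin n) k) :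
    U * evalMatrix A p = evalMatrix A' p * U := by
  have hpow : ∀ i (e : ℕ), U * A i ^ e = A' i ^ e * U := by
    intro i e
    induction e with
    | zero => simp
    | succ e ih => rw [pow_succ, ← Matrix.mul_assoc, ih, Matrix.mul_assoc, hU, ← Matrix.mul_assoc,
        ← pow_succ]
  have hprod : ∀ (L : List (Fin n)) (s : Fin n → ℕ),
      U * (L.map fun i => A i ^ s i).prod = (L.map fun i => A' i ^ s i).prod * U := by
    intro L s
    induction L with
    | nil => simp
    | cons i L ih => rw [List.map_cons, List.map_cons, List.prod_cons, List.prod_cons,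
        ← Matrix.mul_assoc, hpow, Matrix.mul_assoc, ih, ← Matrix.mul_assoc]
  simp only [evalMatrix, Matrix.mul_sum, Matrix.sum_mul, Matrix.mul_smul, Matrix.smul_mul,
    List.ofFn_eq_map, hprod]

theorem blockDiag_mul_inflate {ρ : Type*} [Fintype ρ] [DecidableEq ρ]
    (E : Matrix ρ ρ (PS (MvPolynomial (Fin n) k) n))
    {A : Fin n → Matrix ι ι k} {A' : Fin n → Matrix ι' ι' k}
    {U : Matrix ι' ι k} (hU : ∀ i, U * A i = A' i * U) :
    blockDiag n ρ U * inflate E A = inflate E A' * blockDiag n ρ U := by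
  refine Matrix.ext fun ⟨r, i⟩ ⟨s, j⟩ => MvPowerSeries.ext fun w => ?_
  have h := congrFun (congrFun (evalMatrix_intertwine hU (MvPowerSeries.coeff w (E r s))) i) j
  simp only [Matrix.mul_apply] at h
  simp only [Matrix.mul_apply, Fintype.sum_prod_type, blockDiag, Matrix.of_apply, ite_mul, mul_ite,
    zero_mul, mul_zero, map_sum]
  rw [Finset.sum_eq_single r (by intro t _ ht; simp [Ne.symm ht]) (by simp),
    Finset.sum_eq_single s (by intro t _ ht; simp [ht]) (by simp)]
  simp only [if_true, MvPowerSeries.coeff_C_mul, MvPowerSeries.coeff_mul_C]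
  exact h

theorem blockDiag_mul_inflatedPhi (h : PS (MvPolynomial (Fin n) k) n)
    (g : Fin n → PS (MvPolynomial (Fin n) k) n)
    {A : Fin n → Matrix ι ι k} {A' : Fin n → Matrix ι' ι' k}
    {U : Matrix ι' ι k} (hU : ∀ i, U * A i = A' i * U) :
    blockDiag n (Idx n) U * inflatedPhi h g A = inflatedPhi h g A' * blockDiag n (Idx n) U :=
  blockDiag_mul_inflate _ hU

/-- The cokernel of a square matrix `Φ` over `S`, as a module over `R = S / (f)`: the quotient of
`R^κ` by the image of `Φ`.  (When `Φ` is part of a matrix factorization of `f`, the cokernel of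
`Φ` over `S` is already killed by `f`, so it is this module.) -/
abbrev Cok (f : PS k n) {κ : Type*} [Fintype κ] (Φ : Matrix κ κ (PS k n)) :=
  (κ → Hypersurface f) ⧸
    LinearMap.range (Φ.map (Ideal.Quotient.mk (Ideal.span {f}))).mulVecLin

/-- The map on cokernels induced by a homomorphism `(T, T')` of matrix factorizations,
`T Φ = Φ' T'`; it is the one induced by `T`. -/
def cokMap (f : PS k n) {κ κ' : Type*} [Fintype κ] [Fintype κ'] {Φ : Matrix κ κ (PS k n)}
    {Φ' : Matrix κ' κ' (PS k n)} (T T' : Matrix κ' κ (PS k n)) (h : T * Φ = Φ' * T') :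
    Cok f Φ →ₗ[Hypersurface f] Cok f Φ' :=
  Submodule.mapQ _ _ (T.map (Ideal.Quotient.mk (Ideal.span {f}))).mulVecLin (by
    rintro _ ⟨x, rfl⟩
    refine ⟨(T'.map (Ideal.Quotient.mk (Ideal.span {f}))).mulVecLin x, ?_⟩
    simp only [Matrix.mulVecLin_apply, Matrix.mulVec_mulVec, ← Matrix.map_mul, h])

theorem blockDiag_one (ρ : Type*) [DecidableEq ρ] :
    blockDiag n ρ (1 : Matrix ι ι k) = 1 := by
  refine Matrix.ext fun r s => ?_
  by_cases h : r.1 = s.1 <;> by_cases h' : r.2 = s.2 <;>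
    simp [blockDiag, Matrix.one_apply, Prod.ext_iff, h, h']

theorem blockDiag_mul {ι'' : Type*} (ρ : Type*) [Fintype ρ] [DecidableEq ρ]
    (V : Matrix ι'' ι' k) (U : Matrix ι' ι k) :
    blockDiag n ρ (V * U) = blockDiag n ρ V * blockDiag n ρ U := by
  refine Matrix.ext fun ⟨r, i⟩ ⟨s, j⟩ => ?_
  simp only [Matrix.mul_apply, Fintype.sum_prod_type, blockDiag, Matrix.of_apply, ite_mul, mul_ite,
    zero_mul, mul_zero, map_sum, map_mul]
  rw [Finset.sum_eq_single r (by intro t _ ht; simp [Ne.symm ht]) (by simp)]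
  by_cases h : r = s <;> simp [h]

theorem cokMap_eq_id (f : PS k n) {κ : Type*} [Fintype κ] [DecidableEq κ] {Φ : Matrix κ κ (PS k n)}
    (T T' : Matrix κ κ (PS k n)) (h : T * Φ = Φ * T') (hT : T = 1) :
    cokMap f T T' h = LinearMap.id := by
  apply Submodule.linearMap_qext
  apply LinearMap.ext
  intro x
  simp [cokMap, hT]

theorem cokMap_eq_comp (f : PS k n) {κ κ' κ'' : Type*} [Fintype κ] [Fintype κ'] [Fintype κ'']
    {Φ : Matrix κ κ (PS k n)} {Φ' : Matrix κ' κ' (PS k n)} {Φ'' : Matrix κ'' κ'' (PS k n)}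
    (T T' : Matrix κ' κ (PS k n)) (h : T * Φ = Φ' * T')
    (V V' : Matrix κ'' κ' (PS k n)) (h' : V * Φ' = Φ'' * V')
    (W W' : Matrix κ'' κ (PS k n)) (h'' : W * Φ = Φ'' * W') (hW : W = V * T) :
    cokMap f W W' h'' = cokMap f V V' h' ∘ₗ cokMap f T T' h := by
  apply Submodule.linearMap_qext
  apply LinearMap.ext
  intro x
  simp [cokMap, hW, Matrix.map_mul]

end Inflation

/-! ### The functor -/

section Functor

variable {k : Type u} [Field k] {n : ℕ}

attribute [local instance] ModuleCat.moduleOfAlgebraModule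
  ModuleCat.isScalarTower_of_algebra_moduleCat

/-- Finite-length `k[a_1, …, a_n]`-modules. -/
abbrev FL (k : Type u) [Field k] (n : ℕ) : ObjectProperty (ModuleCat.{u} (MvPolynomial (Fin n) k)) :=
  finLength (MvPolynomial (Fin n) k)

theorem finite_of_isFiniteLength (M : Type v) [AddCommGroup M] [Module (MvPolynomial (Fin n) k) M]
    (hM : IsFiniteLength (MvPolynomial (Fin n) k) M) [Module k M]
    [IsScalarTower k (MvPolynomial (Fin n) k) M] : Module.Finite k M := by
  rename_i inst1 inst2
  revert inst1 inst2
  induction hM with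
  | of_subsingleton => intros; infer_instance
  | @of_simple_quotient M _ _ N _ _ ih =>
    intro _ _
    have h1 : Module.Finite k N := ih
    have h2 : Module.Finite k (M ⧸ N) := by
      have hs : IsSimpleModule (MvPolynomial (Fin n) k) (M ⧸ N) := inferInstance
      obtain ⟨I, hI, ⟨e⟩⟩ := isSimpleModule_iff_quot_maximal.mp hs
      let _ := Ideal.Quotient.field I
      have := finite_of_finite_type_of_isJacobsonRing k (MvPolynomial (Fin n) k ⧸ I)
      exact Module.Finite.equiv (e.restrictScalars k).symm
    have h3 : Module.Finite k (N.restrictScalars k) := h1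
    have h4 : Module.Finite k (M ⧸ N.restrictScalars k) := h2
    exact Module.Finite.of_submodule_quotient (N.restrictScalars k)

/-- A choice of a `k`-basis of every finite-length `k[a_1, …, a_n]`-module. -/
abbrev BasisChoice (k : Type u) [Field k] (n : ℕ) : Type (u + 1) :=
  ∀ M : (FL k n).FullSubcategory, Module.Basis (Fin (Module.finrank k M.obj)) k M.obj

theorem nonempty_basisChoice (k : Type u) [Field k] (n : ℕ) : Nonempty (BasisChoice k n) :=
  ⟨fun M =>
    haveI := finite_of_isFiniteLength (k := k) M.obj M.property
    Module.finBasis k M.obj⟩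

/-- The matrix `A_i` of the action of `a_i` on `M` in the chosen basis. -/
def actionMatrix (b : BasisChoice k n) (M : (FL k n).FullSubcategory) (i : Fin n) :
    Matrix (Fin (Module.finrank k M.obj)) (Fin (Module.finrank k M.obj)) k :=
  LinearMap.toMatrix (b M) (b M) (Algebra.lsmul k k M.obj (MvPolynomial.X i : MvPolynomial (Fin n) k))

/-- The matrix `U` of a homomorphism in the chosen bases. -/
def homMatrix (b : BasisChoice k n) {M N : (FL k n).FullSubcategory} (φ : M ⟶ N) :
    Matrix (Fin (Module.finrank k N.obj)) (Fin (Module.finrank k M.obj)) k :=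
  LinearMap.toMatrix (b M) (b N) (φ.hom.hom.restrictScalars k)

theorem homMatrix_intertwine (b : BasisChoice k n) {M N : (FL k n).FullSubcategory} (φ : M ⟶ N)
    (i : Fin n) : homMatrix b φ * actionMatrix b M i = actionMatrix b N i * homMatrix b φ := by
  simp only [homMatrix, actionMatrix, ← LinearMap.toMatrix_comp]
  congr 1
  ext x
  simp

theorem homMatrix_id (b : BasisChoice k n) (M : (FL k n).FullSubcategory) :
    homMatrix b (𝟙 M) = 1 :=
  LinearMap.toMatrix_id (b M)

theorem homMatrix_comp (b : BasisChoice k n) {M N P : (FL k n).FullSubcategory} (φ : M ⟶ N)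
    (χ : N ⟶ P) : homMatrix b (φ ≫ χ) = homMatrix b χ * homMatrix b φ := by
  have h1 : (φ ≫ χ).hom.hom.restrictScalars k =
      (χ.hom.hom.restrictScalars k) ∘ₗ (φ.hom.hom.restrictScalars k) :=
    LinearMap.ext fun x => rfl
  rw [homMatrix, h1, LinearMap.toMatrix_comp (b M) (b N) (b P), homMatrix, homMatrix]

/-- The functor sending a finite-length module, with matrices `A_1, …, A_n`, to the cokernel of
the inflated matrix `Φ(A_1, …, A_n)`, and a homomorphism with matrix `U` to the map induced by the
block-diagonal matrix with `U` down the diagonal. -/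
def inflationFunctor (b : BasisChoice k n) (f : PS k n) (h : PS (MvPolynomial (Fin n) k) n)
    (g : Fin n → PS (MvPolynomial (Fin n) k) n) :
    (FL k n).FullSubcategory ⥤ ModuleCat.{u} (Hypersurface f) where
  obj M := ModuleCat.of (Hypersurface f) (Cok f (inflatedPhi h g (actionMatrix b M)))
  map φ := ModuleCat.ofHom (cokMap f (blockDiag n (Idx n) (homMatrix b φ))
    (blockDiag n (Idx n) (homMatrix b φ)) (blockDiag_mul_inflatedPhi h g (homMatrix_intertwine b φ)))
  map_id M :=
    congrArg ModuleCat.ofHom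
      (cokMap_eq_id f _ _ (blockDiag_mul_inflatedPhi h g (homMatrix_intertwine b (𝟙 M)))
        (by rw [homMatrix_id, blockDiag_one]))
  map_comp φ χ :=
    congrArg ModuleCat.ofHom
      (cokMap_eq_comp f _ _ (blockDiag_mul_inflatedPhi h g (homMatrix_intertwine b φ))
        _ _ (blockDiag_mul_inflatedPhi h g (homMatrix_intertwine b χ))
        _ _ (blockDiag_mul_inflatedPhi h g (homMatrix_intertwine b (φ ≫ χ)))
        (by rw [homMatrix_comp, blockDiag_mul]))

end Functor

end

end WildHypersurface

open WildHypersurface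

/-! Part (1) is a double division. Over `k[a_1, …, a_n]` the `x_i - a_i z` and `z` generate the same
ideal as the variables, so `f` can be divided by them, and the coefficient of `z` divided once more;
each division costs one order. The matrix identity in (2) is an induction over blocks, and it
survives inflation because evaluation at commuting matrices is a ring homomorphism.

The heart of (2) is a map backwards on homomorphisms. A homomorphism of cokernels lifts to matrices
with `S Φ(A) = Φ(A') T`, and cancelling `f ≠ 0` gives `T Ψ(A) = Ψ(A') S`. As `Φ(A')` has no constant
term, the constant term of `S` depends only on the homomorphism. The coefficients of the `x_m` in
`Φ` and `Ψ` are Koszul matrices tensored with an identity, so comparing them makes the constant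
terms of `S` and `T` block lower triangular, each diagonal block being the first block of one of the
two (`triangular_of_koszul`). In degree two the first block of `S Φ = Φ' T` reads `(S - T) z² + ∑
w_m (x_m - A_m z) ≡ 0`, because the `g_i` have order at least three; commutativity of the `A_m` then
identifies the two first blocks (`constantCoeff_eq_zero_of_order`, `corner_eq`). The coefficient of
`z` shows that this common block, the corner, intertwines `A` and `A'` (`corner_intertwine`).

Taking corners is thus functorial and additive, and inverts `F` on homomorphisms from the left. If
the corner vanishes, the constant term of `S` is strictly triangular, so for an idempotent it is
zero, and the idempotent is zero because `1 - S` is invertible. Reflection of isomorphisms and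
preservation of indecomposability follow formally (`HomRetraction.isRepresentationEmbedding`).
Exactness is a diagram chase: short exact sequences split over `k`, and `Φ` is injective.

For the MCM property, infinitude of `k` provides `n` linear forms whose initial segments generate
primes, with `f` outside the ideal of all of them. They form a regular sequence on every cokernel
and also bound `dim R` by `n` (`isMCM_cok`).

For (3), `F` is composed with an embedding of `mod Λ` into finite-length modules: a `Λ`-module `M`
goes to the `M`-valued functionals on polynomials which vanish above some degree and satisfy one
linear relation in top degree encoding the action of `Λ`. The same retraction principle applies,
with the functionals supported in degree zero in place of the corner. -/

namespace MvPowerSeries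

/-! ### Division of power series by variables -/

variable {σ A : Type*} [CommRing A]

theorem coeff_X_mul' [DecidableEq σ] (m : σ →₀ ℕ) (j : σ) (q : MvPowerSeries σ A) :
    coeff m (X j * q) = if m j = 0 then 0 else coeff (m - Finsupp.single j 1) q := by
  rw [X, coeff_monomial_mul, one_mul]
  by_cases h : m j = 0
  · rw [if_pos h, if_neg]
    intro h'
    have := h' j
    simp [h] at this
  · rw [if_neg h, if_pos]
    rw [Finsupp.single_le_iff]
    omega

/-- The quotient by `X j` of the sum of those terms of `p` whose first variable in `T` is
`X j`. -/
noncomputable def firstVarQuotient [LinearOrder σ] (T : Finset σ) (p : MvPowerSeries σ A) (j : σ) :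
    MvPowerSeries σ A := fun m =>
  if ∀ i ∈ T, i < j → m i = 0 then coeff (m + Finsupp.single j 1) p else 0

theorem coeff_firstVarQuotient [LinearOrder σ] (T : Finset σ) (p : MvPowerSeries σ A) (j : σ)
    (m : σ →₀ ℕ) : coeff m (firstVarQuotient T p j) =
      if ∀ i ∈ T, i < j → m i = 0 then coeff (m + Finsupp.single j 1) p else 0 := rfl

/-- Each monomial occurring in `p` involves a variable of `T` and is assigned to the smallest such
variable, so the summands have disjoint supports and no coefficient is counted twice. -/
theorem eq_sum_X_mul_firstVarQuotient [LinearOrder σ] (T : Finset σ) (p : MvPowerSeries σ A)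
    (h : ∀ m : σ →₀ ℕ, (∀ j ∈ T, m j = 0) → coeff m p = 0) :
    p = ∑ j ∈ T, X j * firstVarQuotient T p j := by
  ext m
  rw [map_sum]
  have key : ∀ j, coeff m (X j * firstVarQuotient T p j) =
      if m j ≠ 0 ∧ ∀ i ∈ T, i < j → m i = 0 then coeff m p else 0 := by
    intro j
    rw [coeff_X_mul', coeff_firstVarQuotient]
    by_cases h0 : m j = 0
    · simp [h0]
    · have hle : Finsupp.single j 1 ≤ m := by
        rw [Finsupp.single_le_iff]; omega
      rw [if_neg h0, tsub_add_cancel_of_le hle]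
      simp only [ne_eq, h0, not_false_eq_true, true_and]
      refine if_congr (forall₂_congr fun i _ => imp_congr_right fun hi => ?_) rfl rfl
      simp [Finsupp.single_eq_of_ne hi.ne]
  simp only [key]
  by_cases hm : ∀ j ∈ T, m j = 0
  · rw [h m hm]; simp
  · push Not at hm
    have hne : (T.filter fun j => m j ≠ 0).Nonempty := by
      obtain ⟨j, hj, hj'⟩ := hm
      exact ⟨j, by simp [hj, hj']⟩
    have hmem := Finset.min'_mem _ hne
    set a := (T.filter fun j => m j ≠ 0).min' hne with ha
    rw [Finset.mem_filter] at hmem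
    have hlt : ∀ i ∈ T, i < a → m i = 0 := by
      intro i hi hia
      by_contra hc
      exact absurd (Finset.min'_le _ i (Finset.mem_filter.mpr ⟨hi, hc⟩)) (not_le.mpr hia)
    rw [Finset.sum_eq_single a]
    · rw [if_pos ⟨hmem.2, hlt⟩]
    · intro b hb hba
      rw [if_neg]
      rintro ⟨hb1, hb2⟩
      rcases lt_or_gt_of_ne hba with hc | hc
      · exact hb1 (hlt b hb hc)
      · exact hmem.2 (hb2 a hmem.1 hc)
    · intro hc
      exact absurd hmem.1 hc

theorem le_order_firstVarQuotient [LinearOrder σ] (T : Finset σ) (p : MvPowerSeries σ A) (j : σ)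
    {d : ℕ} (hp : ((d + 1 : ℕ) : ℕ∞) ≤ p.order) : (d : ℕ∞) ≤ (firstVarQuotient T p j).order := by
  refine nat_le_order fun m hm => ?_
  rw [coeff_firstVarQuotient]
  split_ifs
  · refine coeff_of_lt_order (lt_of_lt_of_le ?_ hp)
    rw [map_add, Finsupp.degree_single]
    exact_mod_cast Nat.succ_lt_succ hm
  · rfl

theorem exists_eq_sum_X_mul_of_lt_order [LinearOrder σ] [Fintype σ] (p : MvPowerSeries σ A) {d : ℕ}
    (hp : ((d + 1 : ℕ) : ℕ∞) ≤ p.order) :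
    ∃ q : σ → MvPowerSeries σ A, (∀ j, (d : ℕ∞) ≤ (q j).order) ∧ p = ∑ j, X j * q j := by
  refine ⟨firstVarQuotient Finset.univ p, fun j => le_order_firstVarQuotient _ _ _ hp,
    eq_sum_X_mul_firstVarQuotient _ _ fun m hm => ?_⟩
  have : m = 0 := Finsupp.ext fun j => hm j (Finset.mem_univ j)
  subst this
  refine coeff_of_lt_order (lt_of_lt_of_le ?_ hp)
  rw [map_zero]
  exact_mod_cast Nat.succ_pos d

theorem le_order_add {p q : MvPowerSeries σ A} {d : ℕ∞} (hp : d ≤ p.order) (hq : d ≤ q.order) :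
    d ≤ (p + q).order :=
  (le_min hp hq).trans min_order_le_add

theorem le_order_sum {ι : Type*} (s : Finset ι) (p : ι → MvPowerSeries σ A) {d : ℕ∞}
    (h : ∀ i ∈ s, d ≤ (p i).order) : d ≤ (∑ i ∈ s, p i).order := by
  classical
  induction s using Finset.induction_on with
  | empty => simp
  | insert a s ha ih =>
    rw [Finset.sum_insert ha]
    exact le_order_add (h a (Finset.mem_insert_self a s))
      (ih fun i hi => h i (Finset.mem_insert_of_mem hi))

theorem le_order_mul_right {p q : MvPowerSeries σ A} {d : ℕ∞} (hp : d ≤ p.order) :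
    d ≤ (p * q).order :=
  (hp.trans le_self_add).trans le_order_mul

theorem le_order_mul_left {p q : MvPowerSeries σ A} {d : ℕ∞} (hq : d ≤ q.order) :
    d ≤ (p * q).order :=
  mul_comm p q ▸ le_order_mul_right hq

end MvPowerSeries

/-! ### Existence of the expression of `f` -/

namespace WildHypersurface

universe u

/-- A power series of order at least `d + 1` is a combination of the `x_i - a_i z` and `z` with
coefficients of order at least `d`. -/
theorem exists_eq_sum_sub_mul {B : Type u} [CommRing B] {n : ℕ} (a : Fin n → B) (p : PS B n) {d : ℕ}
    (hp : ((d + 1 : ℕ) : ℕ∞) ≤ p.order) :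
    ∃ (q : Fin n → PS B n) (q₀ : PS B n), (∀ i, (d : ℕ∞) ≤ (q i).order) ∧ (d : ℕ∞) ≤ q₀.order ∧
      p = ∑ i, (xVar B i - MvPowerSeries.C (a i) * zVar B n) * q i + zVar B n * q₀ := by
  obtain ⟨q, hq, e⟩ := MvPowerSeries.exists_eq_sum_X_mul_of_lt_order p hp
  -- Writing `x_i = (x_i - a_i z) + a_i z` moves `a_i q_i` into the coefficient of `z`.
  refine ⟨fun i => q i.castSucc, q (Fin.last n) + ∑ i, MvPowerSeries.C (a i) * q i.castSucc,
    fun i => hq _, MvPowerSeries.le_order_add (hq _) (MvPowerSeries.le_order_sum _ _ fun i _ =>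
      MvPowerSeries.le_order_mul_left (hq _)), ?_⟩
  conv_lhs => rw [e, Fin.sum_univ_castSucc]
  simp only [xVar, zVar, mul_add, sub_mul, Finset.sum_sub_distrib, Finset.mul_sum]
  have : ∀ i : Fin n, MvPowerSeries.X (Fin.last n) * (MvPowerSeries.C (a i) * q i.castSucc) =
      MvPowerSeries.C (a i) * MvPowerSeries.X (Fin.last n) * q i.castSucc := fun i => by ring
  simp only [this]
  ring

/-- Two divisions give `f = ∑ (x_i - a_i z) (p_i + z q_i) + z² q₀`; the first leaves `p_i` of order
at least three, the second leaves `q_i` and `q₀` of order at least two. -/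
theorem exists_isExpression {k : Type u} [Field k] {n : ℕ} (f : PS k n) (hf : 4 ≤ f.order) :
    ∃ h g, IsExpression f h g := by
  have hF : ((3 + 1 : ℕ) : ℕ∞) ≤
      (MvPowerSeries.map (MvPolynomial.C : k →+* MvPolynomial (Fin n) k) f).order :=
    le_trans (by exact_mod_cast hf) (MvPowerSeries.le_order_map _)
  obtain ⟨p, p₀, hp, hp₀, e⟩ := exists_eq_sum_sub_mul (fun i => MvPolynomial.X i) _ hF
  obtain ⟨q, q₀, hq, hq₀, e'⟩ := exists_eq_sum_sub_mul (d := 2) (fun i => MvPolynomial.X i) p₀ hp₀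
  refine ⟨q₀, fun i => p i + zVar _ n * q i, ?_, by exact_mod_cast hq₀, fun i => ?_⟩
  · rw [e, e']
    simp only [mul_add, Finset.sum_add_distrib, Finset.mul_sum]
    have : ∀ i : Fin n, zVar (MvPolynomial (Fin n) k) n * ((xVar (MvPolynomial (Fin n) k) i -
        MvPowerSeries.C (MvPolynomial.X i) * zVar (MvPolynomial (Fin n) k) n) * q i) =
        (xVar (MvPolynomial (Fin n) k) i -
        MvPowerSeries.C (MvPolynomial.X i) * zVar (MvPolynomial (Fin n) k) n) *
        (zVar (MvPolynomial (Fin n) k) n * q i) := fun i => by ring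
    simp only [this]
    ring
  · refine MvPowerSeries.le_order_add (by exact_mod_cast hp i) ?_
    refine le_trans ?_ MvPowerSeries.le_order_mul
    have h1 : (1 : ℕ∞) ≤ (zVar (MvPolynomial (Fin n) k) n).order := by
      rw [MvPowerSeries.one_le_order_iff_constCoeff_eq_zero]
      exact MvPowerSeries.constantCoeff_X _
    calc (3 : ℕ∞) = 1 + 2 := by norm_num
      _ ≤ _ := add_le_add h1 (by exact_mod_cast hq i)

end WildHypersurface

/-! ### Evaluation at commuting matrices and the matrix factorizations -/

namespace WildHypersurface

universe u

section

variable {k : Type u} [Field k] {n : ℕ} {ι : Type*} [Fintype ι] [DecidableEq ι]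

open IsMulCommutative in
-- The subalgebra generated by commuting matrices is commutative, so `MvPolynomial.aeval` exists
-- there; followed by the inclusion it agrees with the ordered products in `evalMatrix`.
theorem exists_algHom_eq_evalMatrix {A : Fin n → Matrix ι ι k} (hA : ∀ i j, A i * A j = A j * A i) :
    ∃ φ : MvPolynomial (Fin n) k →ₐ[k] Matrix ι ι k,
      (∀ i, φ (MvPolynomial.X i) = A i) ∧ ∀ p, φ p = evalMatrix A p := by
  have : IsMulCommutative (Algebra.adjoin k (Set.range A)) := Algebra.isMulCommutative_adjoin k (by
    rintro _ ⟨i, rfl⟩ _ ⟨j, rfl⟩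
    exact hA i j)
  let a : Fin n → Algebra.adjoin k (Set.range A) :=
    fun i => ⟨A i, Algebra.subset_adjoin ⟨i, rfl⟩⟩
  refine ⟨(Algebra.adjoin k (Set.range A)).val.comp (MvPolynomial.aeval a), fun i => ?_,
    fun p => ?_⟩
  · rw [AlgHom.comp_apply, MvPolynomial.aeval_X]
    rfl
  rw [AlgHom.comp_apply, MvPolynomial.aeval_def, MvPolynomial.eval₂_eq', map_sum, evalMatrix]
  refine Finset.sum_congr rfl fun s _ => ?_
  rw [map_mul, Algebra.smul_def]
  congr 1
  rw [← List.prod_ofFn, map_list_prod, List.map_ofFn]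
  rfl

variable {A : Fin n → Matrix ι ι k}

theorem evalMatrix_mul (hA : ∀ i j, A i * A j = A j * A i) (p q : MvPolynomial (Fin n) k) :
    evalMatrix A (p * q) = evalMatrix A p * evalMatrix A q := by
  obtain ⟨φ, -, hφ⟩ := exists_algHom_eq_evalMatrix hA
  simp only [← hφ, map_mul]

theorem evalMatrix_sum (hA : ∀ i j, A i * A j = A j * A i) {τ : Type*} (s : Finset τ)
    (p : τ → MvPolynomial (Fin n) k) :
    evalMatrix A (∑ t ∈ s, p t) = ∑ t ∈ s, evalMatrix A (p t) := by
  obtain ⟨φ, -, hφ⟩ := exists_algHom_eq_evalMatrix hA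
  simp only [← hφ, map_sum]

theorem evalMatrix_C (hA : ∀ i j, A i * A j = A j * A i) (c : k) :
    evalMatrix A (MvPolynomial.C c) = c • 1 := by
  obtain ⟨φ, -, hφ⟩ := exists_algHom_eq_evalMatrix hA
  rw [← hφ, ← MvPolynomial.algebraMap_eq, AlgHom.commutes, Algebra.algebraMap_eq_smul_one]

theorem evalMatrix_X (hA : ∀ i j, A i * A j = A j * A i) (i : Fin n) :
    evalMatrix A (MvPolynomial.X i) = A i := by
  obtain ⟨φ, hX, hφ⟩ := exists_algHom_eq_evalMatrix hA
  rw [← hφ, hX]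

theorem evalMatrix_zero : evalMatrix A 0 = 0 := by
  simp [evalMatrix]

theorem evalMatrix_one (hA : ∀ i j, A i * A j = A j * A i) : evalMatrix A 1 = 1 := by
  rw [← MvPolynomial.C_1, evalMatrix_C hA, one_smul]

variable {ρ : Type*} [Fintype ρ] [DecidableEq ρ]

omit [Fintype ρ] [DecidableEq ρ] in
theorem coeff_inflate (E : Matrix ρ ρ (PS (MvPolynomial (Fin n) k) n)) (r s : ρ × ι)
    (w : Fin (n + 1) →₀ ℕ) : MvPowerSeries.coeff w (inflate E A r s) =
      evalMatrix A (MvPowerSeries.coeff w (E r.1 s.1)) r.2 s.2 := rfl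

omit [DecidableEq ρ] in
theorem inflate_mul (hA : ∀ i j, A i * A j = A j * A i)
    (E E' : Matrix ρ ρ (PS (MvPolynomial (Fin n) k) n)) :
    inflate (E * E') A = inflate E A * inflate E' A := by
  refine Matrix.ext fun r s => MvPowerSeries.ext fun w => ?_
  rw [coeff_inflate, Matrix.mul_apply, Matrix.mul_apply, map_sum, map_sum, evalMatrix_sum hA,
    Matrix.sum_apply, Fintype.sum_prod_type]
  refine Finset.sum_congr rfl fun t _ => ?_
  simp only [MvPowerSeries.coeff_mul, evalMatrix_sum hA, evalMatrix_mul hA, Matrix.sum_apply,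
    Matrix.mul_apply, coeff_inflate]
  rw [Finset.sum_comm]

omit [Fintype ρ] in
theorem inflate_smul_one (hA : ∀ i j, A i * A j = A j * A i) (f : PS k n) :
    inflate (MvPowerSeries.map (MvPolynomial.C : k →+* MvPolynomial (Fin n) k) f •
      (1 : Matrix ρ ρ (PS (MvPolynomial (Fin n) k) n))) A = f • (1 : Matrix (ρ × ι) (ρ × ι) _) := by
  refine Matrix.ext fun r s => MvPowerSeries.ext fun w => ?_
  rw [coeff_inflate]
  by_cases h : r.1 = s.1
  · simp only [Matrix.smul_apply, Matrix.one_apply, h, if_true, smul_eq_mul, mul_one,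
      MvPowerSeries.coeff_map, evalMatrix_C hA, Prod.ext_iff, true_and]
    split_ifs <;> simp
  · simp [h, Prod.ext_iff, evalMatrix_zero]

end

/-- In the block product the off-diagonal blocks cancel, scalar matrices being central, and each
diagonal block adds the new product `a_i v_i` to the previous factorization. -/
theorem isMatrixFactorization_knorrer {B : Type*} [CommRing B] (p q : B) :
    ∀ (i : ℕ) (a v : Fin i → B), IsMatrixFactorization (p * q + ∑ j, a j * v j)
      (knorrer p q i a v).1 (knorrer p q i a v).2 := by
  intro i
  induction i with
  | zero =>
    intro a v
    let _ : Unique (Idx 0) := inferInstanceAs (Unique Unit)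
    constructor <;>
    · refine Matrix.ext fun r s => ?_
      rw [Subsingleton.elim r s, Matrix.mul_apply, Fintype.sum_unique]
      simp [knorrer, mul_comm]
  | succ i ih =>
    intro a v
    obtain ⟨h1, h2⟩ := ih (Fin.init a) (Fin.init v)
    have hs : p * q + ∑ j, a j * v j = (p * q + ∑ j, Fin.init a j * Fin.init v j) +
        a (Fin.last i) * v (Fin.last i) := by
      rw [Fin.sum_univ_castSucc, add_assoc]; rfl
    -- `Idx (i + 1)` is a sum type only after unfolding, so the block identities are restated for
    -- it.
    have hone : (1 : Matrix (Idx (i + 1)) (Idx (i + 1)) B) =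
        (Matrix.fromBlocks 1 0 0 1 : Matrix (Idx i ⊕ Idx i) (Idx i ⊕ Idx i) B) :=
      Matrix.fromBlocks_one.symm
    have hmul : ∀ (a₁ b₁ c₁ d₁ a₂ b₂ c₂ d₂ : Matrix (Idx i) (Idx i) B),
        @HMul.hMul (Matrix (Idx (i + 1)) (Idx (i + 1)) B) (Matrix (Idx (i + 1)) (Idx (i + 1)) B)
          (Matrix (Idx (i + 1)) (Idx (i + 1)) B) _ (Matrix.fromBlocks a₁ b₁ c₁ d₁)
          (Matrix.fromBlocks a₂ b₂ c₂ d₂) =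
        Matrix.fromBlocks (a₁ * a₂ + b₁ * c₂) (a₁ * b₂ + b₁ * d₂) (c₁ * a₂ + d₁ * c₂)
          (c₁ * b₂ + d₁ * d₂) := fun a₁ b₁ c₁ d₁ a₂ b₂ c₂ d₂ =>
      Matrix.fromBlocks_multiply a₁ b₁ c₁ d₁ a₂ b₂ c₂ d₂
    have hsmul : ∀ (c : B) (a₁ b₁ c₁ d₁ : Matrix (Idx i) (Idx i) B),
        @HSMul.hSMul B (Matrix (Idx (i + 1)) (Idx (i + 1)) B) (Matrix (Idx (i + 1)) (Idx (i + 1)) B)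
          _ c (Matrix.fromBlocks a₁ b₁ c₁ d₁) =
        Matrix.fromBlocks (c • a₁) (c • b₁) (c • c₁) (c • d₁) := fun c a₁ b₁ c₁ d₁ =>
      Matrix.fromBlocks_smul c a₁ b₁ c₁ d₁
    constructor <;>
    · rw [hs, knorrer, hone, hmul, hsmul, h1, h2]
      congr 1 <;> simp [add_smul, smul_smul, mul_comm, add_comm]

section

variable {k : Type u} [Field k] {n : ℕ} {ι : Type*} [Fintype ι] [DecidableEq ι]
  {A : Fin n → Matrix ι ι k} {f : PS k n}
  {h : PS (MvPolynomial (Fin n) k) n} {g : Fin n → PS (MvPolynomial (Fin n) k) n}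

theorem isMatrixFactorization_inflated (e : IsExpression f h g)
    (hA : ∀ i j, A i * A j = A j * A i) :
    IsMatrixFactorization f (inflatedPhi h g A) (inflatedPsi h g A) := by
  obtain ⟨h1, h2⟩ := isMatrixFactorization_knorrer (zVar _ n ^ 2) h n
    (fun i => xVar _ i - MvPowerSeries.C (MvPolynomial.X i) * zVar _ n) g
  rw [← e.eq] at h1 h2
  constructor
  · rw [inflatedPhi, inflatedPsi, ← inflate_mul hA, paramFactorization, h1, inflate_smul_one hA]
  · rw [inflatedPhi, inflatedPsi, ← inflate_mul hA, paramFactorization, h2, inflate_smul_one hA]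

end

end WildHypersurface

/-! ### Cokernels and lifts of their homomorphisms -/

namespace WildHypersurface

universe u

section

variable {k : Type u} [Field k] {n : ℕ} {f : PS k n} {κ κ' κ'' : Type*}
  [Fintype κ] [Fintype κ'] [Fintype κ'']
  {Φ Ψ : Matrix κ κ (PS k n)} {Φ' Ψ' : Matrix κ' κ' (PS k n)} {Φ'' : Matrix κ'' κ'' (PS k n)}

/-- The projection of `S^κ` onto the cokernel of `Φ`. -/
noncomputable def cokMk (f : PS k n) (Φ : Matrix κ κ (PS k n)) :
    (κ → PS k n) →ₗ[PS k n] Cok f Φ :=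
  ((LinearMap.range (Φ.map (Ideal.Quotient.mk (Ideal.span {f}))).mulVecLin).mkQ.restrictScalars
    (PS k n)).comp ((Algebra.linearMap (PS k n) (Hypersurface f)).compLeft κ)

theorem cokMk_apply (v : κ → PS k n) :
    cokMk f Φ v = Submodule.Quotient.mk (fun i => Ideal.Quotient.mk (Ideal.span {f}) (v i)) := rfl

theorem cokMk_surjective : Function.Surjective (cokMk f Φ) := by
  intro x
  obtain ⟨y, rfl⟩ := Submodule.Quotient.mk_surjective _ x
  choose v hv using fun i => Ideal.Quotient.mk_surjective (I := Ideal.span {f}) (y i)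
  exact ⟨v, by rw [cokMk_apply, funext hv]⟩

omit [Fintype κ'] in
theorem mk_comp_mulVec (M : Matrix κ' κ (PS k n)) (v : κ → PS k n) :
    (M.map (Ideal.Quotient.mk (Ideal.span {f}))).mulVec
      (fun i => Ideal.Quotient.mk (Ideal.span {f}) (v i)) =
      fun i => Ideal.Quotient.mk (Ideal.span {f}) (M.mulVec v i) :=
  funext fun i => (RingHom.map_mulVec (Ideal.Quotient.mk (Ideal.span {f})) M v i).symm

theorem cokMk_mulVec (w : κ → PS k n) : cokMk f Φ (Φ.mulVec w) = 0 := by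
  rw [cokMk_apply, Submodule.Quotient.mk_eq_zero, ← mk_comp_mulVec]
  exact ⟨_, rfl⟩

/-- The cokernel is formed over `S / (f)`, but `f S^κ = Φ Ψ S^κ` already lies in the image of `Φ`,
so the kernel over `S` is no larger than that image. -/
theorem cokMk_eq_zero_iff [DecidableEq κ] (hΦ : IsMatrixFactorization f Φ Ψ) (v : κ → PS k n) :
    cokMk f Φ v = 0 ↔ ∃ w, v = Φ.mulVec w := by
  refine ⟨fun h => ?_, fun ⟨w, hw⟩ => hw ▸ cokMk_mulVec w⟩
  rw [cokMk_apply, Submodule.Quotient.mk_eq_zero] at h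
  obtain ⟨y, hy⟩ := h
  choose w hw using fun i => Ideal.Quotient.mk_surjective (I := Ideal.span {f}) (y i)
  obtain rfl : (fun i => Ideal.Quotient.mk (Ideal.span {f}) (w i)) = y := funext hw
  rw [Matrix.mulVecLin_apply, mk_comp_mulVec] at hy
  have h1 : ∀ i, ∃ c, v i - Φ.mulVec w i = f * c := by
    intro i
    have := congrFun hy i
    rw [eq_comm, Ideal.Quotient.eq, Ideal.mem_span_singleton] at this
    exact this
  choose c hc using h1
  refine ⟨w + Ψ.mulVec c, ?_⟩
  rw [Matrix.mulVec_add, Matrix.mulVec_mulVec, hΦ.1, Matrix.smul_mulVec, Matrix.one_mulVec]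
  ext1 i
  rw [Pi.add_apply, Pi.smul_apply, smul_eq_mul, ← hc]
  ring

theorem cokMap_cokMk {T T' : Matrix κ' κ (PS k n)} (h : T * Φ = Φ' * T') (v : κ → PS k n) :
    cokMap f T T' h (cokMk f Φ v) = cokMk f Φ' (T.mulVec v) := by
  rw [cokMk_apply, cokMk_apply, cokMap, Submodule.mapQ_apply, Matrix.mulVecLin_apply,
    mk_comp_mulVec]

/-- `T` is the matrix of a lift of `θ` to the free modules. -/
def IsLift (T : Matrix κ' κ (PS k n)) (θ : Cok f Φ →ₗ[Hypersurface f] Cok f Φ') : Prop :=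
  ∀ v, θ (cokMk f Φ v) = cokMk f Φ' (T.mulVec v)

theorem exists_isLift [DecidableEq κ] (θ : Cok f Φ →ₗ[Hypersurface f] Cok f Φ') :
    ∃ T : Matrix κ' κ (PS k n), IsLift T θ := by
  choose c hc using fun j : κ => cokMk_surjective (Φ := Φ') (θ (cokMk f Φ (Pi.single j 1)))
  refine ⟨Matrix.of fun i j => c j i, fun v => ?_⟩
  have h : (θ.restrictScalars (PS k n)) ∘ₗ cokMk f Φ =
      cokMk f Φ' ∘ₗ (Matrix.of fun i j => c j i).mulVecLin := by
    refine LinearMap.pi_ext' fun j => LinearMap.ext_ring ?_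
    simp only [LinearMap.comp_apply, LinearMap.single_apply, LinearMap.restrictScalars_apply,
      Matrix.mulVecLin_apply, Matrix.mulVec_single_one]
    rw [← hc]
    rfl
  exact LinearMap.congr_fun h v

/-- The columns of `T * Φ` die in the second cokernel, hence lie in the image of `Φ'`. -/
theorem IsLift.exists_mul_eq [DecidableEq κ] [DecidableEq κ'] (hΦ' : IsMatrixFactorization f Φ' Ψ')
    {T : Matrix κ' κ (PS k n)}
    {θ : Cok f Φ →ₗ[Hypersurface f] Cok f Φ'} (hT : IsLift T θ) :
    ∃ T' : Matrix κ' κ (PS k n), T * Φ = Φ' * T' := by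
  have h : ∀ j, ∃ w, (T * Φ).mulVec (Pi.single j 1) = Φ'.mulVec w := by
    intro j
    rw [← cokMk_eq_zero_iff hΦ', ← Matrix.mulVec_mulVec, ← hT, cokMk_mulVec, map_zero]
  choose w hw using h
  refine ⟨Matrix.of fun i j => w j i, ?_⟩
  ext1 i j
  have := congrFun (hw j) i
  rw [Matrix.mulVec_single_one] at this
  exact this

theorem IsLift.exists_eq_add_mul [DecidableEq κ] [DecidableEq κ'] (hΦ' : IsMatrixFactorization f Φ' Ψ')
    {T T₁ : Matrix κ' κ (PS k n)} {θ : Cok f Φ →ₗ[Hypersurface f] Cok f Φ'}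
    (hT : IsLift T θ) (hT₁ : IsLift T₁ θ) : ∃ Y : Matrix κ' κ (PS k n), T = T₁ + Φ' * Y := by
  have h : ∀ j, ∃ w, (T - T₁).mulVec (Pi.single j 1) = Φ'.mulVec w := by
    intro j
    rw [← cokMk_eq_zero_iff hΦ', Matrix.sub_mulVec, map_sub, ← hT, ← hT₁, sub_self]
  choose w hw using h
  refine ⟨Matrix.of fun i j => w j i, ?_⟩
  ext1 i j
  have := congrFun (hw j) i
  rw [Matrix.mulVec_single_one] at this
  rw [Matrix.add_apply, ← sub_eq_iff_eq_add']
  exact this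

/-- Two lifts differ by a multiple of `Φ'`. The constant term of a lift is therefore an invariant of
`θ`, from which the backward map on homomorphisms is built. -/
theorem IsLift.map_constantCoeff_eq [DecidableEq κ] [DecidableEq κ']
    (hΦ' : IsMatrixFactorization f Φ' Ψ')
    (h0 : Φ'.map (MvPowerSeries.constantCoeff (R := k)) = 0)
    {T T₁ : Matrix κ' κ (PS k n)} {θ : Cok f Φ →ₗ[Hypersurface f] Cok f Φ'}
    (hT : IsLift T θ) (hT₁ : IsLift T₁ θ) :
    T.map (MvPowerSeries.constantCoeff (R := k)) =
      T₁.map (MvPowerSeries.constantCoeff (R := k)) := by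
  obtain ⟨Y, rfl⟩ := hT.exists_eq_add_mul hΦ' hT₁
  rw [Matrix.map_add _ (map_add _), Matrix.map_mul, h0, Matrix.zero_mul, add_zero]

theorem IsLift.add {T T₁ : Matrix κ' κ (PS k n)} {θ θ₁ : Cok f Φ →ₗ[Hypersurface f] Cok f Φ'}
    (hT : IsLift T θ) (hT₁ : IsLift T₁ θ₁) : IsLift (T + T₁) (θ + θ₁) := fun v => by
  rw [LinearMap.add_apply, hT, hT₁, Matrix.add_mulVec, map_add]

theorem IsLift.comp {T : Matrix κ' κ (PS k n)} {T₁ : Matrix κ'' κ' (PS k n)}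
    {θ : Cok f Φ →ₗ[Hypersurface f] Cok f Φ'} {θ₁ : Cok f Φ' →ₗ[Hypersurface f] Cok f Φ''}
    (hT : IsLift T θ) (hT₁ : IsLift T₁ θ₁) : IsLift (T₁ * T) (θ₁ ∘ₗ θ) := fun v => by
  rw [LinearMap.comp_apply, hT, hT₁, Matrix.mulVec_mulVec]

theorem IsLift.id [DecidableEq κ] :
    IsLift (1 : Matrix κ κ (PS k n)) (LinearMap.id : Cok f Φ →ₗ[Hypersurface f] Cok f Φ) :=
  fun v => by rw [LinearMap.id_apply, Matrix.one_mulVec]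

/-- An idempotent endomorphism of a cokernel vanishes if it does so modulo the maximal ideal. -/
theorem IsLift.eq_zero_of_idempotent [DecidableEq κ] {T : Matrix κ κ (PS k n)}
    {θ : Cok f Φ →ₗ[Hypersurface f] Cok f Φ} (hT : IsLift T θ) (hθ : θ ∘ₗ θ = θ)
    (h0 : T.map (MvPowerSeries.constantCoeff (R := k)) = 0) : θ = 0 := by
  -- Invertibility of `1 - T` makes `1 - θ` surjective, while `θ (1 - θ) = 0`.
  have hu : IsUnit (1 - T) := by
    rw [Matrix.isUnit_iff_isUnit_det, MvPowerSeries.isUnit_iff_constantCoeff, RingHom.map_det,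
      RingHom.mapMatrix_apply, Matrix.map_sub _ (map_sub _), h0, sub_zero,
      Matrix.map_one _ (map_zero _) (map_one _), Matrix.det_one]
    exact isUnit_one
  obtain ⟨V, hV⟩ := hu.exists_right_inv
  refine LinearMap.ext fun x => ?_
  obtain ⟨v, rfl⟩ := cokMk_surjective x
  have h1 : cokMk f Φ v = cokMk f Φ (V.mulVec v) - θ (cokMk f Φ (V.mulVec v)) := by
    rw [hT, ← map_sub]
    congr 1
    conv_lhs => rw [← Matrix.one_mulVec v, ← hV, ← Matrix.mulVec_mulVec, Matrix.sub_mulVec,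
      Matrix.one_mulVec]
  rw [h1, map_sub, ← LinearMap.comp_apply, hθ, sub_self, LinearMap.zero_apply]

/-- Multiplication by a nonzero `f` being injective, so is a factor of `f`. -/
theorem IsMatrixFactorization.mulVec_injective [DecidableEq κ] (hΦ : IsMatrixFactorization f Φ Ψ)
    (hf : f ≠ 0) {v : κ → PS k n} (hv : Φ.mulVec v = 0) : v = 0 := by
  have h := congrArg Ψ.mulVec hv
  rw [Matrix.mulVec_mulVec, hΦ.2, Matrix.smul_mulVec, Matrix.one_mulVec, Matrix.mulVec_zero] at h
  exact (smul_eq_zero.mp h).resolve_left hf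

/-- Both sides agree after multiplication by `f`, written as `Ψ' Φ'` on one side and as `Φ Ψ` on the
other, and `f` can be cancelled entrywise. -/
theorem IsMatrixFactorization.intertwine [DecidableEq κ] [DecidableEq κ']
    (hΦ : IsMatrixFactorization f Φ Ψ) (hΦ' : IsMatrixFactorization f Φ' Ψ') (hf : f ≠ 0)
    {T T' : Matrix κ' κ (PS k n)} (h : T * Φ = Φ' * T') : T' * Ψ = Ψ' * T := by
  have h1 : f • (T' * Ψ) = f • (Ψ' * T) := by
    calc f • (T' * Ψ) = (Ψ' * Φ') * (T' * Ψ) := by rw [hΦ'.2, Matrix.smul_mul, Matrix.one_mul]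
      _ = Ψ' * (Φ' * T') * Ψ := by simp only [Matrix.mul_assoc]
      _ = (Ψ' * T) * (Φ * Ψ) := by rw [← h]; simp only [Matrix.mul_assoc]
      _ = f • (Ψ' * T) := by rw [hΦ.1, Matrix.mul_smul, Matrix.mul_one]
  ext1 i j
  have := congrFun (congrFun h1 i) j
  simp only [Matrix.smul_apply, smul_eq_mul] at this
  exact mul_left_cancel₀ hf this

end

end WildHypersurface

/-! ### Koszul matrices and their endomorphisms -/

namespace WildHypersurface

/-- The first element of the index set. -/
def Idx.bot : (i : ℕ) → Idx i
  | 0 => ()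
  | i + 1 => Sum.inl (Idx.bot i)

/-- The index lying in the second half exactly at the splitting number `j`. -/
def Idx.single : {i : ℕ} → Fin i → Idx i
  | 0, j => j.elim0
  | i + 1, j => Fin.lastCases (motive := fun _ => Idx (i + 1)) (Sum.inr (Idx.bot i))
      (fun j => Sum.inl (Idx.single j)) j

theorem Idx.single_last (i : ℕ) : Idx.single (Fin.last i) = Sum.inr (Idx.bot i) :=
  Fin.lastCases_last

theorem Idx.single_castSucc {i : ℕ} (j : Fin i) :
    Idx.single j.castSucc = Sum.inl (Idx.single j) :=
  Fin.lastCases_castSucc _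

/-- The position of an index. -/
def Idx.pos : {i : ℕ} → Idx i → ℕ
  | 0, _ => 0
  | _ + 1, .inl r => Idx.pos r
  | i + 1, .inr r => Idx.pos r + 2 ^ i

theorem Idx.pos_lt : ∀ {i : ℕ} (r : Idx i), r.pos < 2 ^ i
  | 0, _ => by simp [Idx.pos]
  | i + 1, .inl r => by
    have := Idx.pos_lt r
    rw [Idx.pos, pow_succ]; omega
  | i + 1, .inr r => by
    have := Idx.pos_lt r
    rw [Idx.pos, pow_succ]; omega

theorem Idx.pos_bot : ∀ i : ℕ, (Idx.bot i).pos = 0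
  | 0 => rfl
  | i + 1 => Idx.pos_bot i

theorem Idx.pos_injective : ∀ {i : ℕ}, Function.Injective (Idx.pos : Idx i → ℕ)
  | 0, _, _, _ => rfl
  | _ + 1, .inl _, .inl _, h => congrArg Sum.inl (Idx.pos_injective h)
  | _ + 1, .inr _, .inr _, h => congrArg Sum.inr (Idx.pos_injective (Nat.add_right_cancel h))
  | _ + 1, .inl r, .inr s, h => by
    have h1 := Idx.pos_lt r
    simp only [Idx.pos] at h
    omega
  | _ + 1, .inr r, .inl s, h => by
    have h1 := Idx.pos_lt s
    simp only [Idx.pos] at h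
    omega

theorem Idx.pos_bot_lt {i : ℕ} {r : Idx i} (hr : r ≠ Idx.bot i) : (Idx.bot i).pos < r.pos := by
  rw [Idx.pos_bot]
  refine Nat.pos_of_ne_zero fun h => hr (Idx.pos_injective ?_)
  rw [h, Idx.pos_bot]

section

variable {B C : Type*} [CommRing B] [CommRing C]

/-- No entry is a product, so an additive map suffices. This matters because it is applied to
coefficient functionals, which are not multiplicative. -/
theorem knorrer_map (L : B →+ C) (p q : B) : ∀ (i : ℕ) (u v : Fin i → B),
    (knorrer p q i u v).1.map L = (knorrer (L p) (L q) i (L ∘ u) (L ∘ v)).1 ∧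
      (knorrer p q i u v).2.map L = (knorrer (L p) (L q) i (L ∘ u) (L ∘ v)).2
  | 0, u, v => ⟨rfl, rfl⟩
  | i + 1, u, v => by
    obtain ⟨h1, h2⟩ := knorrer_map L p q i (Fin.init u) (Fin.init v)
    have h3 : ∀ c : B, (c • (1 : Matrix (Idx i) (Idx i) B)).map L = L c • 1 := by
      intro c
      ext1 r s
      simp only [Matrix.map_apply, Matrix.smul_apply, Matrix.one_apply, smul_eq_mul, mul_ite,
        mul_one, mul_zero]
      split_ifs <;> simp
    have hu : ∀ w : Fin (i + 1) → B, Fin.init (L ∘ w) = L ∘ Fin.init w := fun w => rfl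
    constructor
    · rw [knorrer]
      refine (Matrix.fromBlocks_map _ _ _ _ _).trans ?_
      rw [h1, h2, h3, h3, map_neg]
      rfl
    · rw [knorrer]
      refine (Matrix.fromBlocks_map _ _ _ _ _).trans ?_
      rw [h1, h2, h3, h3, map_neg]
      rfl

/-- The part of the matrices of `knorrer` which is linear in `u`. -/
abbrev koszul (i : ℕ) (u : Fin i → B) : Matrix (Idx i) (Idx i) B × Matrix (Idx i) (Idx i) B :=
  knorrer 0 0 i u 0

theorem koszul_succ (i : ℕ) (u : Fin (i + 1) → B) : koszul (i + 1) u =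
    (Matrix.fromBlocks (koszul i (Fin.init u)).1 0
      (u (Fin.last i) • (1 : Matrix (Idx i) (Idx i) B)) (koszul i (Fin.init u)).2,
     Matrix.fromBlocks (koszul i (Fin.init u)).2 0
      (-(u (Fin.last i)) • (1 : Matrix (Idx i) (Idx i) B)) (koszul i (Fin.init u)).1) := by
  have h : (Fin.init (0 : Fin (i + 1) → B)) = 0 := rfl
  rw [koszul, knorrer, h, Pi.zero_apply, neg_zero, zero_smul]
  rfl

theorem koszul_add_smul : ∀ (i : ℕ) (c : B) (u v : Fin i → B),
    koszul i (c • u + v) = c • koszul i u + koszul i v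
  | 0, c, u, v => by
    refine Prod.ext ?_ ?_ <;>
    · ext1 r s
      simp [koszul, knorrer]
  | i + 1, c, u, v => by
    have ih := koszul_add_smul i c (Fin.init u) (Fin.init v)
    have h : Fin.init (c • u + v) = c • Fin.init u + Fin.init v := rfl
    rw [koszul_succ, koszul_succ, koszul_succ, h, ih]
    refine Prod.ext ?_ ?_
    · refine Eq.trans ?_ (congrArg (· + _) (Matrix.fromBlocks_smul c _ _ _ _).symm)
      refine Eq.trans ?_ (Matrix.fromBlocks_add _ _ _ _ _ _ _ _).symm
      simp [add_smul, smul_smul]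
    · refine Eq.trans ?_ (congrArg (· + _) (Matrix.fromBlocks_smul c _ _ _ _).symm)
      refine Eq.trans ?_ (Matrix.fromBlocks_add _ _ _ _ _ _ _ _).symm
      simp [add_smul, smul_smul, add_comm]

theorem koszul_zero (i : ℕ) : koszul i (0 : Fin i → B) = 0 := by
  have := koszul_add_smul i (-1 : B) 0 0
  simpa using this

theorem koszul_eq_sum (i : ℕ) (u : Fin i → B) :
    koszul i u = ∑ j, u j • koszul i (Pi.single j 1) := by
  let ℓ : (Fin i → B) →ₗ[B] Matrix (Idx i) (Idx i) B × Matrix (Idx i) (Idx i) B :=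
    { toFun := koszul i
      map_add' := fun u v => by simpa using koszul_add_smul i 1 u v
      map_smul' := fun c u => by simpa [koszul_zero] using koszul_add_smul i c u 0 }
  have h := congrArg ℓ (pi_eq_sum_univ' u)
  rw [map_sum] at h
  exact h.trans (Finset.sum_congr rfl fun j _ => map_smul ℓ _ _)

theorem koszul_bot : ∀ (i : ℕ) (u : Fin i → B) (s : Idx i),
    (koszul i u).1 (Idx.bot i) s = 0 ∧ (koszul i u).2 (Idx.bot i) s = 0
  | 0, _, _ => ⟨rfl, rfl⟩
  | i + 1, u, .inl s => by
    rw [koszul_succ]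
    exact koszul_bot i (Fin.init u) s
  | i + 1, u, .inr s => by
    rw [koszul_succ]
    exact ⟨rfl, rfl⟩

/-- Such a row has a single possibly nonzero entry, which serves to isolate the `j`-th parameter in
`corner_intertwine`. -/
theorem koszul_single : ∀ (i : ℕ) (u : Fin i → B) (j : Fin i) (s : Idx i),
    (koszul i u).1 (Idx.single j) s = if s = Idx.bot i then u j else 0
  | 0, _, j, _ => j.elim0
  | i + 1, u, j, s => by
    rw [koszul_succ]
    induction j using Fin.lastCases with
    | last =>
      rw [Idx.single_last]
      rcases s with s | s
      · refine (Matrix.fromBlocks_apply₂₁ _ _ _ _ _ _).trans ?_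
        rw [Matrix.smul_apply, Matrix.one_apply, smul_eq_mul, mul_ite, mul_one, mul_zero]
        by_cases h : s = Idx.bot i
        · subst h
          exact (if_pos rfl).trans (if_pos rfl).symm
        · exact (if_neg (Ne.symm h)).trans (if_neg fun h' => h (Sum.inl_injective h')).symm
      · refine (Matrix.fromBlocks_apply₂₂ _ _ _ _ _ _).trans ?_
        rw [(koszul_bot i _ s).2, if_neg]
        exact Sum.inr_ne_inl
    | cast j =>
      rw [Idx.single_castSucc]
      rcases s with s | s
      · refine (Matrix.fromBlocks_apply₁₁ _ _ _ _ _ _).trans ?_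
        rw [koszul_single i _ j s]
        by_cases h : s = Idx.bot i
        · subst h
          exact (if_pos rfl).trans (if_pos rfl).symm
        · exact (if_neg h).trans (if_neg fun h' => h (Sum.inl_injective h')).symm
      · refine (Matrix.fromBlocks_apply₁₂ _ _ _ _ _ _).trans ?_
        rw [if_neg]
        · rfl
        · exact Sum.inr_ne_inl

/-- Endomorphisms `(S, T)` of the pair of Koszul matrices are lower triangular, with the diagonal
determined by the first entries. -/
theorem triangular_of_koszul : ∀ (i : ℕ) (S T : Matrix (Idx i) (Idx i) B),
    (∀ u, S * (koszul i u).1 = (koszul i u).1 * T) →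
    (∀ u, T * (koszul i u).2 = (koszul i u).2 * S) →
    (∀ r s, Idx.pos r < Idx.pos s → S r s = 0 ∧ T r s = 0) ∧
    (∀ r, S r r = S (Idx.bot i) (Idx.bot i) ∨ S r r = T (Idx.bot i) (Idx.bot i)) ∧
    (∀ r, T r r = S (Idx.bot i) (Idx.bot i) ∨ T r r = T (Idx.bot i) (Idx.bot i))
  | 0, S, T, _, _ => ⟨fun _ _ h => absurd h (lt_irrefl 0), fun _ => Or.inl rfl,
      fun _ => Or.inr rfl⟩
  | i + 1, S, T, h1, h2 => by
    let S' : Matrix (Idx i ⊕ Idx i) (Idx i ⊕ Idx i) B := S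
    let T' : Matrix (Idx i ⊕ Idx i) (Idx i ⊕ Idx i) B := T
    have hS : S' = Matrix.fromBlocks S'.toBlocks₁₁ S'.toBlocks₁₂ S'.toBlocks₂₁ S'.toBlocks₂₂ :=
      (Matrix.fromBlocks_toBlocks S').symm
    have hT : T' = Matrix.fromBlocks T'.toBlocks₁₁ T'.toBlocks₁₂ T'.toBlocks₂₁ T'.toBlocks₂₂ :=
      (Matrix.fromBlocks_toBlocks T').symm
    set S₁ := S'.toBlocks₁₁
    set S₂ := S'.toBlocks₁₂
    set S₃ := S'.toBlocks₂₁
    set S₄ := S'.toBlocks₂₂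
    set T₁ := T'.toBlocks₁₁
    set T₂ := T'.toBlocks₁₂
    set T₃ := T'.toBlocks₂₁
    set T₄ := T'.toBlocks₂₂
    have e1 : ∀ u : Fin (i + 1) → B, Matrix.fromBlocks S₁ S₂ S₃ S₄ *
        Matrix.fromBlocks (koszul i (Fin.init u)).1 0
          (u (Fin.last i) • (1 : Matrix (Idx i) (Idx i) B)) (koszul i (Fin.init u)).2 =
        Matrix.fromBlocks (koszul i (Fin.init u)).1 0
          (u (Fin.last i) • (1 : Matrix (Idx i) (Idx i) B)) (koszul i (Fin.init u)).2 *
        Matrix.fromBlocks T₁ T₂ T₃ T₄ := by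
      intro u
      have h := h1 u
      rw [koszul_succ] at h
      rw [← hS, ← hT]
      exact h
    have e2 : ∀ u : Fin (i + 1) → B, Matrix.fromBlocks T₁ T₂ T₃ T₄ *
        Matrix.fromBlocks (koszul i (Fin.init u)).2 0
          (-u (Fin.last i) • (1 : Matrix (Idx i) (Idx i) B)) (koszul i (Fin.init u)).1 =
        Matrix.fromBlocks (koszul i (Fin.init u)).2 0
          (-u (Fin.last i) • (1 : Matrix (Idx i) (Idx i) B)) (koszul i (Fin.init u)).1 *
        Matrix.fromBlocks S₁ S₂ S₃ S₄ := by
      intro u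
      have h := h2 u
      rw [koszul_succ] at h
      rw [← hS, ← hT]
      exact h
    simp only [Matrix.fromBlocks_multiply, Matrix.fromBlocks_inj] at e1 e2
    -- For the last unit vector only the lower left identity block survives, up to sign. Comparing
    -- blocks gives `S₂ = T₂ = 0`, `S₄ = T₁` and `T₄ = S₁`.
    have hl1 := e1 (Fin.snoc 0 1)
    have hl2 := e2 (Fin.snoc 0 1)
    simp only [Fin.init_snoc, Fin.snoc_last, koszul_zero, Prod.fst_zero, Prod.snd_zero,
      Matrix.mul_zero, Matrix.zero_mul, zero_add, add_zero, one_smul, mul_one, one_mul,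
      neg_smul, neg_mul, mul_neg, neg_inj] at hl1 hl2
    have hS₂ : S₂ = 0 := hl1.1
    have hT₂ : T₂ = 0 := hl1.2.2.2.symm
    have hS₄ : S₄ = T₁ := hl1.2.2.1
    have hT₄ : T₄ = S₁ := hl2.2.2.1
    -- With last coordinate zero, the upper left blocks satisfy the hypotheses for `(S₁, T₁)`. As
    -- `(S₄, T₄) = (T₁, S₁)`, the lower half uses the same conclusions with the two matrices
    -- exchanged.
    obtain ⟨k1, k2, k3⟩ := triangular_of_koszul i S₁ T₁
      (fun u => by
        have := (e1 (Fin.snoc u 0)).1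
        simpa only [Fin.init_snoc, Fin.snoc_last, zero_smul, Matrix.mul_zero, Matrix.zero_mul,
          add_zero] using this)
      (fun u => by
        have := (e2 (Fin.snoc u 0)).1
        simpa only [Fin.init_snoc, Fin.snoc_last, zero_smul, Matrix.mul_zero, Matrix.zero_mul,
          add_zero, neg_zero] using this)
    refine ⟨?_, ?_, ?_⟩
    · rintro (r | r) (s | s) hrs
      · exact k1 r s hrs
      · exact ⟨congrFun (congrFun hS₂ r) s, congrFun (congrFun hT₂ r) s⟩
      · exact absurd hrs (not_lt.mpr ((Idx.pos_lt s).le.trans (Nat.le_add_left _ _)))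
      · have h := k1 r s (Nat.lt_of_add_lt_add_right hrs)
        exact ⟨(congrFun (congrFun hS₄ r) s).trans h.2, (congrFun (congrFun hT₄ r) s).trans h.1⟩
    · rintro (r | r)
      · exact k2 r
      · exact (k3 r).imp ((congrFun (congrFun hS₄ r) r).trans)
          ((congrFun (congrFun hS₄ r) r).trans)
    · rintro (r | r)
      · exact k3 r
      · exact (k2 r).imp ((congrFun (congrFun hT₄ r) r).trans)
          ((congrFun (congrFun hT₄ r) r).trans)

end

end WildHypersurface

/-! ### Comparison of terms of degree one and two -/

namespace MvPowerSeries

theorem coeff_single_mul {σ A : Type*} [CommRing A] (j : σ) (p q : MvPowerSeries σ A) :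
    coeff (Finsupp.single j 1) (p * q) =
      constantCoeff p * coeff (Finsupp.single j 1) q +
        coeff (Finsupp.single j 1) p * constantCoeff q := by
  classical
  rw [coeff_mul, Finsupp.antidiagonal_single]
  simp [Finset.Nat.antidiagonal_succ]

end MvPowerSeries

namespace WildHypersurface

universe u

open MvPowerSeries (coeff constantCoeff)

section

variable {k : Type u} [Field k] {n : ℕ} {ι : Type*} [Fintype ι] [DecidableEq ι]

omit [DecidableEq ι] in
/-- If `D z² + ∑ w_m (x_m - A_m z)` has no terms of degree two, for commuting matrices `A_m`, then
the constant term of `D` vanishes. -/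
theorem constantCoeff_eq_zero_of_order {A : Fin n → Matrix ι ι k}
    (hA : ∀ i j, A i * A j = A j * A i) (D : ι → PS k n) (w : Fin n → ι → PS k n)
    (hD : ∀ i, 3 ≤ (zVar k n * (zVar k n * D i) + ∑ m, (xVar k m * w m i -
      zVar k n * ∑ l, MvPowerSeries.C (A m l i) * w m l)).order) (i : ι) :
    constantCoeff (D i) = 0 := by
  let e : Fin n → Fin (n + 1) →₀ ℕ := fun a => Finsupp.single a.castSucc 1
  let ez : Fin (n + 1) →₀ ℕ := Finsupp.single (Fin.last n) 1
  -- `P m a` and `Q m` are the row vectors of coefficients of `x_a` and of `z` in `w_m`.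
  let P : Fin n → Fin n → ι → k := fun m a l => coeff (e a) (w m l)
  let Q : Fin n → ι → k := fun m l => coeff ez (w m l)
  have hz : ∀ (μ : Fin (n + 1) →₀ ℕ) (q : PS k n), coeff μ (zVar k n * q) =
      if μ (Fin.last n) = 0 then 0 else coeff (μ - ez) q := fun μ q =>
    MvPowerSeries.coeff_X_mul' μ (Fin.last n) q
  have hx : ∀ (μ : Fin (n + 1) →₀ ℕ) (m : Fin n) (q : PS k n), coeff μ (xVar k m * q) =
      if μ m.castSucc = 0 then 0 else coeff (μ - e m) q := fun μ m q =>
    MvPowerSeries.coeff_X_mul' μ m.castSucc q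
  have hel : ∀ a, e a (Fin.last n) = 0 := fun a =>
    Finsupp.single_eq_of_ne (Fin.castSucc_lt_last a).ne'
  have hee : ∀ a b : Fin n, e a b.castSucc = if a = b then 1 else 0 := fun a b => by
    simp [e, Finsupp.single_apply]
  have hze : ∀ a : Fin n, ez a.castSucc = 0 := fun a =>
    Finsupp.single_eq_of_ne (Fin.castSucc_lt_last a).ne
  have hzz : ez (Fin.last n) = 1 := Finsupp.single_eq_same
  have hde : ∀ a, (e a).degree = 1 := fun a => Finsupp.degree_single _ _
  have hdz : ez.degree = 1 := Finsupp.degree_single _ _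
  have h0 : ∀ μ : Fin (n + 1) →₀ ℕ, μ.degree = 2 → ∀ i, coeff μ (zVar k n * (zVar k n * D i)) +
      ∑ m, (coeff μ (xVar k m * w m i) -
        coeff μ (zVar k n * ∑ l, MvPowerSeries.C (A m l i) * w m l)) = 0 := by
    intro μ hμ i
    have := MvPowerSeries.coeff_of_lt_order (f := zVar k n * (zVar k n * D i) +
      ∑ m, (xVar k m * w m i - zVar k n * ∑ l, MvPowerSeries.C (A m l i) * w m l)) (d := μ)
      (lt_of_lt_of_le (by rw [hμ]; norm_num) (hD i))
    simpa only [map_add, map_sum, map_sub] using this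
  -- The coefficient of `x_a²`. It is treated apart from antisymmetry, which would not yield it in
  -- characteristic two.
  have hPdiag : ∀ a i, P a a i = 0 := by
    intro a i
    have h := h0 (e a + e a) (by rw [map_add, hde]) i
    simp only [hz, hx, Finsupp.add_apply, hel, add_zero, if_true, sub_zero, zero_add, hee] at h
    rw [Finset.sum_eq_single a (fun b _ hb => by simp [Ne.symm hb]) (by simp)] at h
    simpa [P] using h
  have hPanti : ∀ a b i, a ≠ b → P a b i + P b a i = 0 := by
    intro a b i hab
    have h := h0 (e a + e b) (by rw [map_add, hde, hde]) i
    simp only [hz, hx, Finsupp.add_apply, hel, add_zero, if_true, sub_zero, zero_add, hee] at h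
    rw [Finset.sum_eq_add a b hab (fun c _ hc => by simp [Ne.symm hc.1, Ne.symm hc.2]) (by simp)
      (by simp)] at h
    simpa [hab, Ne.symm hab, P] using h
  -- The coefficient of `x_a z`; that of `z²` below then expresses the constant term of `D` through
  -- the `P m a`.
  have hQ : ∀ a, Q a = ∑ m, Matrix.vecMul (P m a) (A m) := by
    intro a
    funext i
    have h := h0 (e a + ez) (by rw [map_add, hde, hdz]) i
    simp only [hz, hx, Finsupp.add_apply, hel, hzz, hee, hze, zero_add, add_zero, one_ne_zero,
      if_false, add_tsub_cancel_right, if_true, Finset.sum_sub_distrib] at h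
    rw [Finset.sum_eq_single a (fun b _ hb => by simp [Ne.symm hb]) (by simp)] at h
    simp only [if_true, one_ne_zero, if_false, add_tsub_cancel_left, map_sum,
      MvPowerSeries.coeff_C_mul] at h
    rw [Finset.sum_apply]
    simp only [Matrix.vecMul, dotProduct]
    rw [sub_eq_zero] at h
    exact h.trans (Finset.sum_congr rfl fun m _ => Finset.sum_congr rfl fun l _ => mul_comm _ _)
  have hD0 : ∀ i, constantCoeff (D i) = ∑ m, Matrix.vecMul (Q m) (A m) i := by
    intro i
    have h := h0 (ez + ez) (by rw [map_add, hdz]) i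
    simp only [hz, hx, Finsupp.add_apply, hzz, hze, add_zero, if_true, add_tsub_cancel_right,
      one_ne_zero, if_false, zero_sub, tsub_self, map_sum, MvPowerSeries.coeff_C_mul,
      Finset.sum_neg_distrib, Nat.reduceAdd, OfNat.ofNat_ne_zero] at h
    rw [← sub_eq_add_neg, sub_eq_zero, MvPowerSeries.coeff_zero_eq_constantCoeff_apply] at h
    simp only [Matrix.vecMul, dotProduct]
    exact h.trans (Finset.sum_congr rfl fun m _ => Finset.sum_congr rfl fun l _ => mul_comm _ _)
  rw [hD0]
  -- This is the sum of all `P_{m a} A_m A_a`: antisymmetric in the first factor and symmetric in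
  -- the product of matrices, with zero diagonal terms, so swapping the indices cancels it.
  have hsum : ∑ m, Matrix.vecMul (Q m) (A m) = 0 := by
    simp only [hQ, Matrix.sum_vecMul, Matrix.vecMul_vecMul]
    rw [← Finset.sum_product']
    refine Finset.sum_involution (fun x _ => x.swap) ?_ ?_ (by simp) (by simp)
    · rintro ⟨a, b⟩ -
      by_cases hab : a = b
      · subst hab
        have : P a a = 0 := funext (hPdiag a)
        simp [this]
      · have : P b a = -P a b := funext fun i => by
          rw [Pi.neg_apply, eq_neg_iff_add_eq_zero]; exact hPanti b a i (Ne.symm hab)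
        simp [this, hA b a, Matrix.neg_vecMul]
    · rintro ⟨a, b⟩ - hne hab
      apply hne
      have : b = a := congrArg Prod.fst hab
      subst this
      have : P b b = 0 := funext (hPdiag b)
      simp [this]
  simpa using congrFun hsum i

end

section

variable {B : Type*} [CommRing B]

/-- At each stage the `v_i` fill the upper right block and never meet the first column. -/
theorem knorrer_apply_bot (p q : B) : ∀ (i : ℕ) (u v : Fin i → B) (s : Idx i),
    (knorrer p q i u v).1 s (Idx.bot i) =
      (if s = Idx.bot i then p else 0) + (koszul i u).1 s (Idx.bot i)
  | 0, _, _, s => by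
    rw [if_pos (show s = Idx.bot 0 from rfl)]
    exact (add_zero p).symm
  | i + 1, u, v, .inl s => by
    rw [koszul_succ]
    refine (knorrer_apply_bot p q i (Fin.init u) (Fin.init v) s).trans (congrArg (· + _) ?_)
    by_cases h : s = Idx.bot i
    · subst h
      exact (if_pos rfl).trans (if_pos rfl).symm
    · exact (if_neg h).trans (if_neg fun h' => h (Sum.inl_injective h')).symm
  | i + 1, u, v, .inr s => by
    rw [koszul_succ, if_neg (by exact Sum.inr_ne_inl), zero_add]
    rfl

/-- At each stage the `u_i` fill the lower left block, so the first row involves only `p` and the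
`v_i`; of the latter just the order is needed. -/
theorem knorrer_bot_apply {σ : Type*} {d : ℕ∞} (p q : MvPowerSeries σ B) :
    ∀ (i : ℕ) (u v : Fin i → MvPowerSeries σ B), (∀ j, d ≤ (v j).order) → ∀ (s : Idx i),
    ∃ t, d ≤ t.order ∧ (knorrer p q i u v).1 (Idx.bot i) s =
      (if s = Idx.bot i then p else 0) + t
  | 0, _, _, _, s => by
    refine ⟨0, by simp, ?_⟩
    rw [if_pos (show s = Idx.bot 0 from rfl)]
    exact (add_zero p).symm
  | i + 1, u, v, hv, .inl s => by
    obtain ⟨t, ht, h⟩ := knorrer_bot_apply p q i (Fin.init u) (Fin.init v) (fun j => hv _) s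
    refine ⟨t, ht, h.trans (congrArg (· + _) ?_)⟩
    by_cases h : s = Idx.bot i
    · subst h
      exact (if_pos rfl).trans (if_pos rfl).symm
    · exact (if_neg h).trans (if_neg fun h' => h (Sum.inl_injective h')).symm
  | i + 1, u, v, hv, .inr s => by
    refine ⟨-v (Fin.last i) * (1 : Matrix (Idx i) (Idx i) _) (Idx.bot i) s,
      MvPowerSeries.le_order_mul_right (by rw [MvPowerSeries.order_neg]; exact hv _), ?_⟩
    rw [if_neg (by exact Sum.inr_ne_inl), zero_add]
    rfl

end

end WildHypersurface

/-! ### Inflated matrices in low degrees -/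

namespace WildHypersurface

universe u

open MvPowerSeries (coeff constantCoeff)

section

variable {k : Type u} [Field k] {n : ℕ} {ι : Type*} [Fintype ι] [DecidableEq ι]
  {A : Fin n → Matrix ι ι k}

/-- Evaluation of the parameters at commuting matrices, as a ring homomorphism. -/
noncomputable def inflateHom (hA : ∀ i j, A i * A j = A j * A i) :
    PS (MvPolynomial (Fin n) k) n →+* Matrix ι ι (PS k n) where
  toFun p := Matrix.of fun i l w => evalMatrix A (coeff w p) i l
  map_one' := by
    refine Matrix.ext fun i l => MvPowerSeries.ext fun w => ?_
    change evalMatrix A (coeff w 1) i l = _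
    rw [Matrix.one_apply, MvPowerSeries.coeff_one]
    split_ifs with h1 h2 h2 <;>
      simp [evalMatrix_one hA, evalMatrix_zero, h2, MvPowerSeries.coeff_one, h1]
  map_zero' := by
    refine Matrix.ext fun i l => MvPowerSeries.ext fun w => ?_
    change evalMatrix A (coeff w 0) i l = _
    simp [evalMatrix_zero]
  map_add' p q := by
    obtain ⟨φ, -, hφ⟩ := exists_algHom_eq_evalMatrix hA
    refine Matrix.ext fun i l => MvPowerSeries.ext fun w => ?_
    change evalMatrix A (coeff w (p + q)) i l = evalMatrix A (coeff w p) i l +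
      evalMatrix A (coeff w q) i l
    rw [← hφ, ← hφ, ← hφ, map_add, map_add, Matrix.add_apply]
  map_mul' p q := by
    have h := inflate_mul hA (Matrix.of fun _ _ : Unit => p) (Matrix.of fun _ _ : Unit => q)
    refine Matrix.ext fun i l => ?_
    have h1 := congrFun (congrFun h ((), i)) ((), l)
    rw [Matrix.mul_apply, Fintype.sum_prod_type, Finset.univ_unique, Finset.sum_singleton] at h1
    rw [Matrix.mul_apply]
    refine Eq.trans ?_ h1
    refine MvPowerSeries.ext fun w => ?_
    rw [coeff_inflate]
    simp only [Matrix.mul_apply, Finset.univ_unique, Finset.sum_singleton]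
    rfl

theorem inflate_apply (hA : ∀ i j, A i * A j = A j * A i) {ρ : Type*}
    (E : Matrix ρ ρ (PS (MvPolynomial (Fin n) k) n)) (r s : ρ × ι) :
    inflate E A r s = inflateHom hA (E r.1 s.1) r.2 s.2 := rfl

theorem coeff_inflateHom (hA : ∀ i j, A i * A j = A j * A i)
    (p : PS (MvPolynomial (Fin n) k) n) (i l : ι) (w : Fin (n + 1) →₀ ℕ) :
    coeff w (inflateHom hA p i l) = evalMatrix A (coeff w p) i l := rfl

theorem inflateHom_map (hA : ∀ i j, A i * A j = A j * A i) (q : PS k n) :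
    inflateHom hA (MvPowerSeries.map MvPolynomial.C q) = q • 1 := by
  refine Matrix.ext fun i l => MvPowerSeries.ext fun w => ?_
  rw [coeff_inflateHom, MvPowerSeries.coeff_map, evalMatrix_C hA, Matrix.smul_apply,
    Matrix.smul_apply, Matrix.one_apply, Matrix.one_apply]
  split_ifs <;> simp

theorem inflateHom_C_X (hA : ∀ i j, A i * A j = A j * A i) (m : Fin n) :
    inflateHom hA (MvPowerSeries.C (MvPolynomial.X m)) = (A m).map MvPowerSeries.C := by
  refine Matrix.ext fun i l => MvPowerSeries.ext fun w => ?_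
  rw [coeff_inflateHom, Matrix.map_apply, MvPowerSeries.coeff_C, MvPowerSeries.coeff_C]
  split_ifs <;> simp [evalMatrix_X hA, evalMatrix_zero]

theorem inflateHom_zVar (hA : ∀ i j, A i * A j = A j * A i) :
    inflateHom hA (zVar _ n) = zVar k n • 1 := by
  rw [← inflateHom_map hA, zVar, zVar, MvPowerSeries.map_X]

theorem inflateHom_xVar (hA : ∀ i j, A i * A j = A j * A i) (m : Fin n) :
    inflateHom hA (xVar _ m) = xVar k m • 1 := by
  rw [← inflateHom_map hA, xVar, xVar, MvPowerSeries.map_X]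

theorem inflateHom_C_C (hA : ∀ i j, A i * A j = A j * A i) (c : k) :
    inflateHom hA (MvPowerSeries.C (MvPolynomial.C c)) =
      (MvPowerSeries.C c : PS k n) • 1 := by
  rw [← inflateHom_map hA, MvPowerSeries.map_C]

theorem le_order_inflateHom (hA : ∀ i j, A i * A j = A j * A i) {d : ℕ∞}
    {p : PS (MvPolynomial (Fin n) k) n} (hp : d ≤ p.order) (i l : ι) :
    d ≤ (inflateHom hA p i l).order := by
  refine MvPowerSeries.le_order fun w hw => ?_
  rw [coeff_inflateHom, MvPowerSeries.coeff_of_lt_order (hw.trans_le hp), evalMatrix_zero]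
  rfl

variable {f : PS k n}
  {h : PS (MvPolynomial (Fin n) k) n} {g : Fin n → PS (MvPolynomial (Fin n) k) n}

/-- Linearity in `u` reduces to the unit vectors, whose Koszul matrices are already defined over
`k`; this separates the parameters from constant matrices. -/
theorem koszul_apply_C {B : Type*} [CommRing B] (C : k →+* B) (u : Fin n → B) (r s : Idx n) :
    (koszul n u).1 r s = ∑ m, u m * C ((koszul n (Pi.single m (1 : k))).1 r s) ∧
    (koszul n u).2 r s = ∑ m, u m * C ((koszul n (Pi.single m (1 : k))).2 r s) := by
  have h1 : ∀ m, (koszul n (Pi.single m (1 : k))).1.map C = (koszul n (Pi.single m (1 : B))).1 ∧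
      (koszul n (Pi.single m (1 : k))).2.map C = (koszul n (Pi.single m (1 : B))).2 := by
    intro m
    have := knorrer_map C.toAddMonoidHom 0 0 n (Pi.single m (1 : k)) 0
    have e1 : C.toAddMonoidHom ∘ (Pi.single m (1 : k)) = Pi.single m (1 : B) := by
      funext j
      by_cases hj : j = m
      · subst hj; simp
      · simp [hj]
    have e2 : C.toAddMonoidHom ∘ (0 : Fin n → k) = 0 := by
      funext j; simp
    rw [e1, e2, map_zero] at this
    exact this
  have h2 := koszul_eq_sum n u
  have h3 := congrFun (congrFun (congrArg Prod.fst h2) r) s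
  have h4 := congrFun (congrFun (congrArg Prod.snd h2) r) s
  rw [Prod.fst_sum, Matrix.sum_apply] at h3
  rw [Prod.snd_sum, Matrix.sum_apply] at h4
  refine ⟨h3.trans (Finset.sum_congr rfl fun m _ => ?_),
    h4.trans (Finset.sum_congr rfl fun m _ => ?_)⟩
  · rw [Prod.smul_fst, Matrix.smul_apply, ← (h1 m).1]; rfl
  · rw [Prod.smul_snd, Matrix.smul_apply, ← (h1 m).2]; rfl

/-- Neither `z²`, nor `h`, nor the `g_i` contribute below degree two, so only the linear forms `x_m
- a_m z` remain. -/
theorem coeff_paramFactorization (e : IsExpression f h g) {w : Fin (n + 1) →₀ ℕ}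
    (hw : w.degree < 2) (r s : Idx n) :
    coeff w ((paramFactorization h g).1 r s) = (koszul n fun m => coeff w (xVar _ m -
      MvPowerSeries.C (MvPolynomial.X m) * zVar (MvPolynomial (Fin n) k) n)).1 r s ∧
    coeff w ((paramFactorization h g).2 r s) = (koszul n fun m => coeff w (xVar _ m -
      MvPowerSeries.C (MvPolynomial.X m) * zVar (MvPolynomial (Fin n) k) n)).2 r s := by
  have h1 := knorrer_map (coeff (R := MvPolynomial (Fin n) k) w).toAddMonoidHom (zVar _ n ^ 2) h n
    (fun i => xVar _ i - MvPowerSeries.C (MvPolynomial.X i) * zVar _ n) g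
  have hw' : ((w.degree : ℕ) : ℕ∞) < 2 := by exact_mod_cast hw
  have e1 : (coeff (R := MvPolynomial (Fin n) k) w).toAddMonoidHom (zVar _ n ^ 2) = 0 := by
    have h1 : (1 : ℕ∞) ≤ (zVar (MvPolynomial (Fin n) k) n).order := by
      rw [MvPowerSeries.one_le_order_iff_constCoeff_eq_zero]
      exact MvPowerSeries.constantCoeff_X _
    have h2 : (2 : ℕ∞) ≤ (zVar (MvPolynomial (Fin n) k) n ^ 2).order := by
      rw [sq]
      refine le_trans ?_ MvPowerSeries.le_order_mul
      exact le_trans (by norm_num) (add_le_add h1 h1)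
    exact MvPowerSeries.coeff_of_lt_order (hw'.trans_le h2)
  have e2 : (coeff (R := MvPolynomial (Fin n) k) w).toAddMonoidHom h = 0 :=
    MvPowerSeries.coeff_of_lt_order (hw'.trans_le e.two_le_order)
  have e3 : (coeff (R := MvPolynomial (Fin n) k) w).toAddMonoidHom ∘ g = 0 := by
    funext j
    have h3 : (2 : ℕ∞) ≤ (g j).order := le_trans (by norm_num) (e.three_le_order j)
    exact MvPowerSeries.coeff_of_lt_order (hw'.trans_le h3)
  rw [e1, e2, e3] at h1
  exact ⟨congrFun (congrFun h1.1 r) s, congrFun (congrFun h1.2 r) s⟩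

theorem constantCoeff_inflated (e : IsExpression f h g) :
    (inflatedPhi h g A).map (constantCoeff (R := k)) = 0 ∧
    (inflatedPsi h g A).map (constantCoeff (R := k)) = 0 := by
  have h0 : (fun m : Fin n => coeff 0 (xVar _ m -
      MvPowerSeries.C (MvPolynomial.X m) * zVar (MvPolynomial (Fin n) k) n)) = 0 := by
    funext m
    simp [xVar, zVar]
  have h1 := coeff_paramFactorization (h := h) (g := g) e (w := 0) (by simp)
  constructor
  · refine Matrix.ext fun r s => ?_
    rw [Matrix.map_apply, ← MvPowerSeries.coeff_zero_eq_constantCoeff_apply, inflatedPhi,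
      coeff_inflate, (h1 r.1 s.1).1, h0, koszul_zero]
    simp [evalMatrix_zero]
  · refine Matrix.ext fun r s => ?_
    rw [Matrix.map_apply, ← MvPowerSeries.coeff_zero_eq_constantCoeff_apply, inflatedPsi,
      coeff_inflate, (h1 r.1 s.1).2, h0, koszul_zero]
    simp [evalMatrix_zero]

/-- In degree one the parameters occur only together with `z`, so the `x_m`-coefficient is a Koszul
matrix tensored with an identity and does not see the matrices `A`. -/
theorem coeff_x_inflated (hA : ∀ i j, A i * A j = A j * A i) (e : IsExpression f h g) (m : Fin n)
    (r s : Idx n × ι) :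
    coeff (Finsupp.single m.castSucc 1) (inflatedPhi h g A r s) =
      (koszul n (Pi.single m (1 : k))).1 r.1 s.1 * (1 : Matrix ι ι k) r.2 s.2 ∧
    coeff (Finsupp.single m.castSucc 1) (inflatedPsi h g A r s) =
      (koszul n (Pi.single m (1 : k))).2 r.1 s.1 * (1 : Matrix ι ι k) r.2 s.2 := by
  have h0 : (fun l : Fin n => coeff (Finsupp.single m.castSucc 1) (xVar _ l -
      MvPowerSeries.C (MvPolynomial.X l) * zVar (MvPolynomial (Fin n) k) n)) = Pi.single m 1 := by
    funext l
    rw [map_sub, MvPowerSeries.coeff_C_mul, xVar, zVar, MvPowerSeries.coeff_index_single_X,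
      MvPowerSeries.coeff_index_single_X, if_neg (Fin.castSucc_lt_last m).ne, mul_zero, sub_zero]
    by_cases hl : l = m
    · subst hl; simp
    · rw [Pi.single_eq_of_ne hl, if_neg]
      simpa [eq_comm] using hl
  have h1 := coeff_paramFactorization e (w := Finsupp.single m.castSucc 1)
    (by rw [Finsupp.degree_single]; norm_num) r.1 s.1
  rw [h0, (koszul_apply_C MvPolynomial.C _ _ _).1, (koszul_apply_C MvPolynomial.C _ _ _).2,
    Finset.sum_eq_single m (fun b _ hb => by simp [hb]) (by simp),
    Finset.sum_eq_single m (fun b _ hb => by simp [hb]) (by simp), Pi.single_eq_same, one_mul,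
    one_mul] at h1
  rw [inflatedPhi, inflatedPsi, coeff_inflate, coeff_inflate, h1.1, h1.2, evalMatrix_C hA,
    evalMatrix_C hA, Matrix.smul_apply, Matrix.smul_apply]
  exact ⟨rfl, rfl⟩

theorem coeff_z_inflatedPhi (hA : ∀ i j, A i * A j = A j * A i) (e : IsExpression f h g)
    (r s : Idx n × ι) :
    coeff (Finsupp.single (Fin.last n) 1) (inflatedPhi h g A r s) =
      -∑ m, (koszul n (Pi.single m (1 : k))).1 r.1 s.1 * A m r.2 s.2 := by
  have h0 : (fun l : Fin n => coeff (Finsupp.single (Fin.last n) 1) (xVar _ l -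
      MvPowerSeries.C (MvPolynomial.X l) * zVar (MvPolynomial (Fin n) k) n)) =
      fun l => -MvPolynomial.X l := by
    funext l
    rw [map_sub, MvPowerSeries.coeff_C_mul, xVar, zVar, MvPowerSeries.coeff_index_single_X,
      MvPowerSeries.coeff_index_single_X, if_neg (Fin.castSucc_lt_last l).ne', if_pos rfl, mul_one,
      zero_sub]
  have h1 := coeff_paramFactorization e (w := Finsupp.single (Fin.last n) 1)
    (by rw [Finsupp.degree_single]; norm_num) r.1 s.1
  rw [h0, (koszul_apply_C MvPolynomial.C _ _ _).1] at h1
  obtain ⟨φ, -, hφ⟩ := exists_algHom_eq_evalMatrix hA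
  rw [inflatedPhi, coeff_inflate, h1.1, ← hφ, map_sum, Matrix.sum_apply, ← Finset.sum_neg_distrib]
  refine Finset.sum_congr rfl fun m _ => ?_
  rw [hφ, neg_mul, ← hφ, map_neg, hφ, evalMatrix_mul hA, evalMatrix_C hA, evalMatrix_X hA]
  simp [mul_comm]

/-- The first block column of `Φ`. -/
theorem inflatedPhi_apply_bot (hA : ∀ i j, A i * A j = A j * A i) (r : Idx n × ι) (i : ι) :
    inflatedPhi h g A r (Idx.bot n, i) =
      (if r.1 = Idx.bot n then zVar k n * (zVar k n * (1 : Matrix ι ι (PS k n)) r.2 i) else 0) +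
      ∑ m, MvPowerSeries.C ((koszul n (Pi.single m (1 : k))).1 r.1 (Idx.bot n)) *
        (xVar k m * (1 : Matrix ι ι (PS k n)) r.2 i - zVar k n * MvPowerSeries.C (A m r.2 i)) := by
  rw [inflatedPhi, inflate_apply hA, paramFactorization, knorrer_apply_bot,
    (koszul_apply_C (MvPowerSeries.C.comp MvPolynomial.C) _ _ _).1, map_add, map_sum,
    Matrix.add_apply, Matrix.sum_apply]
  congr 1
  · split_ifs
    · rw [map_pow, inflateHom_zVar, sq, Matrix.smul_mul, Matrix.one_mul, Matrix.smul_apply,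
        Matrix.smul_apply, smul_eq_mul, smul_eq_mul]
    · rw [map_zero, Matrix.zero_apply]
  · refine Finset.sum_congr rfl fun m _ => ?_
    rw [map_mul, map_sub, map_mul, inflateHom_xVar, inflateHom_zVar, inflateHom_C_X,
      RingHom.comp_apply, inflateHom_C_C, Matrix.mul_smul, Matrix.mul_one, Matrix.smul_apply,
      Matrix.sub_apply, Matrix.smul_apply, Matrix.mul_smul, Matrix.mul_one, Matrix.smul_apply,
      Matrix.map_apply]
    rfl

/-- The first block row of `Φ`. -/
theorem inflatedPhi_bot_apply (hA : ∀ i j, A i * A j = A j * A i) (e : IsExpression f h g)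
    (i : ι) (s : Idx n × ι) : ∃ t : PS k n, 3 ≤ t.order ∧
    inflatedPhi h g A (Idx.bot n, i) s =
      (if s.1 = Idx.bot n then zVar k n * (zVar k n * (1 : Matrix ι ι (PS k n)) i s.2) else 0) +
        t := by
  obtain ⟨t, ht, h1⟩ := knorrer_bot_apply (zVar _ n ^ 2) h n
    (fun i => xVar _ i - MvPowerSeries.C (MvPolynomial.X i) * zVar _ n) g e.three_le_order s.1
  refine ⟨inflateHom hA t i s.2, le_order_inflateHom hA ht _ _, ?_⟩
  rw [inflatedPhi, inflate_apply hA, paramFactorization, h1, map_add, Matrix.add_apply]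
  congr 1
  split_ifs
  · rw [map_pow, inflateHom_zVar, sq, Matrix.smul_mul, Matrix.one_mul, Matrix.smul_apply,
      Matrix.smul_apply, smul_eq_mul, smul_eq_mul]
  · rw [map_zero, Matrix.zero_apply]

end

end WildHypersurface

/-! ### Constant terms of homomorphisms of inflated factorizations -/

namespace WildHypersurface

universe u

open MvPowerSeries (coeff constantCoeff)

section

variable {k : Type u} [Field k] {n : ℕ} {ρ ι ι' ι'' : Type*}

/-- The constant terms of the `(i', i)`-entries of the blocks of a matrix. -/
noncomputable def slice (S : Matrix (ρ × ι') (ρ × ι) (PS k n)) (i' : ι') (i : ι) :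
    Matrix ρ ρ k :=
  Matrix.of fun r s => constantCoeff (S (r, i') (s, i))

theorem slice_apply (S : Matrix (ρ × ι') (ρ × ι) (PS k n)) (i' : ι') (i : ι) (r s : ρ) :
    slice S i' i r s = constantCoeff (S (r, i') (s, i)) := rfl

/-- The constant term of the first block of a matrix. -/
noncomputable def corner (S : Matrix (Idx n × ι') (Idx n × ι) (PS k n)) : Matrix ι' ι k :=
  Matrix.of fun i' i => slice S i' i (Idx.bot n) (Idx.bot n)

theorem corner_apply (S : Matrix (Idx n × ι') (Idx n × ι) (PS k n)) (i' : ι') (i : ι) :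
    corner S i' i = slice S i' i (Idx.bot n) (Idx.bot n) := rfl

variable [Fintype ι] [DecidableEq ι] [Fintype ι'] [DecidableEq ι']

/-- As `Φ` and `Φ'` have no constant terms, a linear coefficient of `S Φ = Φ' T` involves only the
constant terms of `S` and `T`. Since the linear coefficients have the form `E ⊗ 1`, the equation
splits into one for each pair `(i', i)`. -/
theorem slice_mul_eq [Fintype ρ] {Φ : Matrix (ρ × ι) (ρ × ι) (PS k n)}
    {Φ' : Matrix (ρ × ι') (ρ × ι') (PS k n)} (h0 : Φ.map (constantCoeff (R := k)) = 0)
    (h0' : Φ'.map (constantCoeff (R := k)) = 0) {j : Fin (n + 1)} {E : Matrix ρ ρ k}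
    (hE : ∀ r s, coeff (Finsupp.single j 1) (Φ r s) = E r.1 s.1 * (1 : Matrix ι ι k) r.2 s.2)
    (hE' : ∀ r s, coeff (Finsupp.single j 1) (Φ' r s) = E r.1 s.1 * (1 : Matrix ι' ι' k) r.2 s.2)
    {S T : Matrix (ρ × ι') (ρ × ι) (PS k n)} (hST : S * Φ = Φ' * T) (i' : ι') (i : ι) :
    slice S i' i * E = E * slice T i' i := by
  have z : ∀ r s, constantCoeff (Φ r s) = 0 := fun r s => congrFun (congrFun h0 r) s
  have z' : ∀ r s, constantCoeff (Φ' r s) = 0 := fun r s => congrFun (congrFun h0' r) s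
  ext1 r s
  have h := congrArg (coeff (Finsupp.single j 1)) (congrFun (congrFun hST (r, i')) (s, i))
  simp only [Matrix.mul_apply, map_sum, MvPowerSeries.coeff_single_mul, z, z', hE, hE', mul_zero,
    zero_mul, add_zero, zero_add, Fintype.sum_prod_type, Matrix.one_apply, mul_ite, ite_mul, mul_one,
    Finset.sum_ite_eq, Finset.sum_ite_eq', Finset.mem_univ, if_true] at h
  simpa only [Matrix.mul_apply, slice_apply] using h

variable {f : PS k n} {A : Fin n → Matrix ι ι k} {A' : Fin n → Matrix ι' ι' k}
  {h : PS (MvPolynomial (Fin n) k) n} {g : Fin n → PS (MvPolynomial (Fin n) k) n}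

variable (hA : ∀ i j, A i * A j = A j * A i) (hA' : ∀ i j, A' i * A' j = A' j * A' i)
  (e : IsExpression f h g) (hf : f ≠ 0)
  {S T : Matrix (Idx n × ι') (Idx n × ι) (PS k n)}
  (hST : S * inflatedPhi h g A = inflatedPhi h g A' * T)

include hA hA' e hST

theorem slice_mul_koszul_fst (i' : ι') (i : ι) (u : Fin n → k) :
    slice S i' i * (koszul n u).1 = (koszul n u).1 * slice T i' i := by
  rw [koszul_eq_sum, Prod.fst_sum, Matrix.mul_sum, Matrix.sum_mul]
  refine Finset.sum_congr rfl fun m _ => ?_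
  rw [Prod.smul_fst, Matrix.mul_smul, Matrix.smul_mul]
  congr 1
  exact slice_mul_eq (constantCoeff_inflated e).1 (constantCoeff_inflated e).1
    (fun r s => (coeff_x_inflated hA e m r s).1) (fun r s => (coeff_x_inflated hA' e m r s).1)
    hST i' i

include hf

theorem slice_mul_koszul_snd (i' : ι') (i : ι) (u : Fin n → k) :
    slice T i' i * (koszul n u).2 = (koszul n u).2 * slice S i' i := by
  rw [koszul_eq_sum, Prod.snd_sum, Matrix.mul_sum, Matrix.sum_mul]
  refine Finset.sum_congr rfl fun m _ => ?_
  rw [Prod.smul_snd, Matrix.mul_smul, Matrix.smul_mul]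
  congr 1
  exact slice_mul_eq (constantCoeff_inflated e).2 (constantCoeff_inflated e).2
    (fun r s => (coeff_x_inflated hA e m r s).2) (fun r s => (coeff_x_inflated hA' e m r s).2)
    ((isMatrixFactorization_inflated e hA).intertwine (isMatrixFactorization_inflated e hA') hf hST)
    i' i

omit hf

/-- In the first block of `S Φ = Φ' T`, the left side is `S z²` plus multiples of the `x_m - A_m z`,
and the right side is `T z²` up to order three because the `g_i` have order at least three. The
difference is of the shape handled by `constantCoeff_eq_zero_of_order`. -/
theorem corner_eq : corner S = corner T := by
  ext1 i' i
  -- For a fixed `i'`, `w_m` pairs the row of `S` with the first column of the Koszul matrix of the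
  -- `m`-th unit vector.
  have h2 := constantCoeff_eq_zero_of_order hA
    (fun i => S (Idx.bot n, i') (Idx.bot n, i) - T (Idx.bot n, i') (Idx.bot n, i))
    (fun m l => ∑ r, S (Idx.bot n, i') (r, l) *
      MvPowerSeries.C ((koszul n (Pi.single m (1 : k))).1 r (Idx.bot n))) ?_ i
  · rw [map_sub, sub_eq_zero] at h2
    exact h2
  intro i
  have hc := congrFun (congrFun hST (Idx.bot n, i')) (Idx.bot n, i)
  rw [Matrix.mul_apply, Matrix.mul_apply] at hc
  choose t ht hrow using inflatedPhi_bot_apply hA' e i'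
  have hR : ∑ s, inflatedPhi h g A' (Idx.bot n, i') s * T s (Idx.bot n, i) =
      zVar k n * (zVar k n * T (Idx.bot n, i') (Idx.bot n, i)) +
        ∑ s, t s * T s (Idx.bot n, i) := by
    simp only [hrow, add_mul, Finset.sum_add_distrib]
    congr 1
    rw [Finset.sum_eq_single (Idx.bot n, i')]
    · simp [mul_assoc]
    · rintro ⟨s, l⟩ - hs
      by_cases hs1 : s = Idx.bot n
      · have : i' ≠ l := by
          rintro rfl
          exact hs (by rw [hs1])
        simp [this]
      · simp [hs1]
    · simp
  have hL : ∑ s, S (Idx.bot n, i') s * inflatedPhi h g A s (Idx.bot n, i) =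
      zVar k n * (zVar k n * S (Idx.bot n, i') (Idx.bot n, i)) + ∑ m, (xVar k m *
        (∑ r, S (Idx.bot n, i') (r, i) *
          MvPowerSeries.C ((koszul n (Pi.single m (1 : k))).1 r (Idx.bot n))) -
        zVar k n * ∑ l, MvPowerSeries.C (A m l i) * ∑ r, S (Idx.bot n, i') (r, l) *
          MvPowerSeries.C ((koszul n (Pi.single m (1 : k))).1 r (Idx.bot n))) := by
    simp only [inflatedPhi_apply_bot hA, mul_add, Finset.sum_add_distrib]
    congr 1
    · rw [Finset.sum_eq_single (Idx.bot n, i)]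
      · simp only [if_true, Matrix.one_apply_eq]
        ring
      · rintro ⟨s, l⟩ - hs
        by_cases hs1 : s = Idx.bot n
        · have : l ≠ i := by
            rintro rfl
            exact hs (by rw [hs1])
          simp [this]
        · simp [hs1]
      · simp
    · simp only [Finset.mul_sum]
      rw [Finset.sum_comm]
      refine Finset.sum_congr rfl fun m _ => ?_
      simp only [mul_sub, Finset.sum_sub_distrib]
      congr 1
      · rw [Fintype.sum_prod_type]
        refine Finset.sum_congr rfl fun r _ => ?_
        rw [Finset.sum_eq_single i]
        · rw [Matrix.one_apply_eq]; ring
        · intro l _ hl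
          rw [Matrix.one_apply_ne hl]; ring
        · simp
      · rw [Fintype.sum_prod_type_right]
        refine Finset.sum_congr rfl fun l _ => Finset.sum_congr rfl fun r _ => ?_
        ring
  rw [hL, hR] at hc
  have h3 : zVar k n * (zVar k n * (S (Idx.bot n, i') (Idx.bot n, i) -
      T (Idx.bot n, i') (Idx.bot n, i))) + ∑ m, (xVar k m *
        (∑ r, S (Idx.bot n, i') (r, i) *
          MvPowerSeries.C ((koszul n (Pi.single m (1 : k))).1 r (Idx.bot n))) -
        zVar k n * ∑ l, MvPowerSeries.C (A m l i) * ∑ r, S (Idx.bot n, i') (r, l) *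
          MvPowerSeries.C ((koszul n (Pi.single m (1 : k))).1 r (Idx.bot n))) =
      ∑ s, t s * T s (Idx.bot n, i) := by
    linear_combination hc
  rw [h3]
  exact MvPowerSeries.le_order_sum _ _ fun s _ => MvPowerSeries.le_order_mul_right (ht s)

/-- The coefficient of `z` in `Φ` is minus the sum of the Koszul matrices `K_m` tensored with `A_m`.
In row `Idx.single j` and the first column, the right side of `S Φ = Φ' T` contributes only `A'_j`;
on the left, `S₀ K_m = K_m T₀` for the constant terms leaves only `m = j`. -/
theorem corner_intertwine (j : Fin n) : corner S * A j = A' j * corner S := by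
  rw [corner_eq hA hA' e hST]
  ext1 i' i
  have z : ∀ r s, constantCoeff (inflatedPhi h g A r s) = 0 := fun r s =>
    congrFun (congrFun (constantCoeff_inflated e).1 r) s
  have z' : ∀ r s, constantCoeff (inflatedPhi h g A' r s) = 0 := fun r s =>
    congrFun (congrFun (constantCoeff_inflated e).1 r) s
  have h1 := congrArg (coeff (Finsupp.single (Fin.last n) 1))
    (congrFun (congrFun hST (Idx.single j, i')) (Idx.bot n, i))
  simp only [Matrix.mul_apply, map_sum, MvPowerSeries.coeff_single_mul, z, z',
    coeff_z_inflatedPhi hA e, coeff_z_inflatedPhi hA' e, mul_zero, zero_mul, add_zero,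
    zero_add] at h1
  have hR : ∑ x : Idx n × ι', (-∑ m, (koszul n (Pi.single m (1 : k))).1 (Idx.single j) x.1 *
      A' m i' x.2) * constantCoeff (T x (Idx.bot n, i)) = -(A' j * corner T) i' i := by
    rw [Fintype.sum_prod_type_right, Matrix.mul_apply, ← Finset.sum_neg_distrib]
    refine Finset.sum_congr rfl fun l _ => ?_
    rw [Finset.sum_eq_single (Idx.bot n)]
    · rw [Finset.sum_eq_single j]
      · rw [koszul_single, if_pos rfl, Pi.single_eq_same, one_mul, neg_mul]; rfl
      · intro m _ hm
        rw [koszul_single, if_pos rfl, Pi.single_eq_of_ne (Ne.symm hm), zero_mul]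
      · simp
    · intro r _ hr
      simp only [koszul_single, if_neg hr, zero_mul, Finset.sum_const_zero, neg_zero]
    · simp
  have hL : ∑ x : Idx n × ι, constantCoeff (S (Idx.single j, i') x) *
      (-∑ m, (koszul n (Pi.single m (1 : k))).1 x.1 (Idx.bot n) * A m x.2 i) =
      -(corner T * A j) i' i := by
    rw [Fintype.sum_prod_type_right, Matrix.mul_apply, ← Finset.sum_neg_distrib]
    refine Finset.sum_congr rfl fun l _ => ?_
    have h2 : ∀ m, ∑ r, constantCoeff (S (Idx.single j, i') (r, l)) *
        (koszul n (Pi.single m (1 : k))).1 r (Idx.bot n) =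
        if m = j then corner T i' l else 0 := by
      intro m
      have h3 := congrFun (congrFun (slice_mul_koszul_fst hA hA' e hST i' l (Pi.single m 1))
        (Idx.single j)) (Idx.bot n)
      rw [Matrix.mul_apply, Matrix.mul_apply] at h3
      refine Eq.trans h3 ?_
      rw [Finset.sum_eq_single (Idx.bot n)]
      · rw [koszul_single, if_pos rfl]
        split_ifs with hm
        · subst hm
          rw [Pi.single_eq_same, one_mul]; rfl
        · rw [Pi.single_eq_of_ne (Ne.symm hm), zero_mul]
      · intro r _ hr
        rw [koszul_single, if_neg hr, zero_mul]
      · simp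
    have h4 : ∀ r, constantCoeff (S (Idx.single j, i') (r, l)) *
        (-∑ m, (koszul n (Pi.single m (1 : k))).1 r (Idx.bot n) * A m l i) =
        -∑ m, constantCoeff (S (Idx.single j, i') (r, l)) *
          (koszul n (Pi.single m (1 : k))).1 r (Idx.bot n) * A m l i := by
      intro r
      rw [mul_neg, Finset.mul_sum]
      simp only [mul_assoc]
    simp only [h4, Finset.sum_neg_distrib]
    rw [Finset.sum_comm]
    simp only [← Finset.sum_mul, h2, ite_mul, zero_mul, Finset.sum_ite_eq', Finset.mem_univ,
      if_true]
  rw [hL, hR] at h1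
  exact neg_injective h1

include hf

theorem slice_eq_zero_of_lt (i' : ι') (i : ι) {r s : Idx n} (hrs : r.pos < s.pos) :
    slice S i' i r s = 0 :=
  ((triangular_of_koszul n _ _ (slice_mul_koszul_fst hA hA' e hST i' i)
    (slice_mul_koszul_snd hA hA' e hf hST i' i)).1 r s hrs).1

/-- `triangular_of_koszul` offers the first entry of `S` or of `T`; `corner_eq` removes the
alternative. -/
theorem slice_diag (i' : ι') (i : ι) (r : Idx n) : slice S i' i r r = corner S i' i := by
  rcases (triangular_of_koszul n _ _ (slice_mul_koszul_fst hA hA' e hST i' i)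
    (slice_mul_koszul_snd hA hA' e hf hST i' i)).2.1 r with h1 | h1
  · exact h1
  · rw [corner_eq hA hA' e hST]
    exact h1

/-- By triangularity the first block row of the constant term of `S` is zero outside its first
block. -/
theorem corner_mul (S' : Matrix (Idx n × ι) (Idx n × ι'') (PS k n)) :
    corner (S * S') = corner S * corner S' := by
  ext1 i' i
  rw [corner_apply, slice_apply, Matrix.mul_apply, Matrix.mul_apply, map_sum,
    Fintype.sum_prod_type_right]
  refine Finset.sum_congr rfl fun l _ => ?_
  rw [Finset.sum_eq_single (Idx.bot n)]
  · rw [map_mul]; rfl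
  · intro r _ hr
    rw [map_mul]
    have := slice_eq_zero_of_lt hA hA' e hf hST i' l (Idx.pos_bot_lt hr)
    rw [slice_apply] at this
    rw [this, zero_mul]
  · simp

end

section

variable {k : Type u} [Field k] {n : ℕ} {ι : Type*} [Fintype ι] [DecidableEq ι]
  {f : PS k n} {A : Fin n → Matrix ι ι k}
  {h : PS (MvPolynomial (Fin n) k) n} {g : Fin n → PS (MvPolynomial (Fin n) k) n}

omit [Fintype ι] in
theorem corner_one : corner (1 : Matrix (Idx n × ι) (Idx n × ι) (PS k n)) = 1 := by
  ext1 i l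
  rw [corner_apply, slice_apply, Matrix.one_apply, Matrix.one_apply]
  by_cases hil : i = l
  · simp [hil]
  · simp [hil]

/-- With zero corner all diagonal blocks vanish, so the constant term is strictly lower triangular;
being idempotent as well as nilpotent, it is zero. The induction runs over the rows. -/
theorem map_constantCoeff_eq_zero_of_idempotent (hA : ∀ i j, A i * A j = A j * A i)
    (e : IsExpression f h g) (hf : f ≠ 0) {S T : Matrix (Idx n × ι) (Idx n × ι) (PS k n)}
    (hST : S * inflatedPhi h g A = inflatedPhi h g A * T)
    (hS : (S * S).map (constantCoeff (R := k)) = S.map (constantCoeff (R := k)))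
    (hc : corner S = 0) : S.map (constantCoeff (R := k)) = 0 := by
  have key : ∀ (p : ℕ) (r : Idx n), r.pos = p → ∀ i s, constantCoeff (S (r, i) s) = 0 := by
    intro p
    induction p using Nat.strong_induction_on with
    | _ p ih =>
    intro r hr i s
    have h1 := congrFun (congrFun hS (r, i)) s
    rw [Matrix.map_apply, Matrix.map_apply, Matrix.mul_apply, map_sum] at h1
    rw [← h1]
    refine Finset.sum_eq_zero fun ⟨q, l⟩ _ => ?_
    rw [map_mul]
    rcases lt_trichotomy q.pos r.pos with hq | hq | hq
    · rw [ih q.pos (hr ▸ hq) q rfl, mul_zero]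
    · obtain rfl := Idx.pos_injective hq
      have := slice_diag hA hA e hf hST i l q
      rw [hc, slice_apply] at this
      rw [this]
      exact zero_mul _
    · have := slice_eq_zero_of_lt hA hA e hf hST i l hq
      rw [slice_apply] at this
      rw [this, zero_mul]
  exact Matrix.ext fun r s => key _ r.1 rfl r.2 s

end

end WildHypersurface

/-! ### Representation embeddings from retractions on homomorphisms -/

namespace WildHypersurface

universe u

open CategoryTheory.Limits

theorem eq_zero_or_eq_id_of_indecomposable {Λ : Type*} [Ring Λ] {X : ModuleCat.{u} Λ}
    (hX : Indecomposable X) (p : X ⟶ X) (hp : p ≫ p = p) : p = 0 ∨ p = 𝟙 X := by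
  have hp' : IsIdempotentElem p.hom := by
    have := congrArg ModuleCat.Hom.hom hp
    rwa [ModuleCat.hom_comp] at this
  have hc := LinearMap.IsIdempotentElem.isCompl hp'
  let e : X ≅ ModuleCat.of Λ (LinearMap.range p.hom) ⊞ ModuleCat.of Λ (LinearMap.ker p.hom) :=
    (Submodule.prodEquivOfIsCompl _ _ hc).symm.toModuleIso ≪≫ (ModuleCat.biprodIsoProd (ModuleCat.of Λ (LinearMap.range p.hom))
      (ModuleCat.of Λ (LinearMap.ker p.hom))).symm
  rcases hX.2 _ _ e with h | h
  · left
    have hs : Subsingleton (LinearMap.range p.hom) := ModuleCat.subsingleton_of_isZero h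
    ext x
    have := Subsingleton.elim (⟨p.hom x, x, rfl⟩ : LinearMap.range p.hom) 0
    exact congrArg Subtype.val this
  · right
    have hs : Subsingleton (LinearMap.ker p.hom) := ModuleCat.subsingleton_of_isZero h
    ext x
    have hx : x - p.hom x ∈ LinearMap.ker p.hom := by
      rw [LinearMap.mem_ker, map_sub, sub_eq_zero]
      exact (LinearMap.congr_fun hp' x).symm
    have := Subsingleton.elim (⟨_, hx⟩ : LinearMap.ker p.hom) 0
    exact (sub_eq_zero.mp (congrArg Subtype.val this)).symm

section

variable {Λ R : Type*} [Ring Λ] [Ring R]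
    {P : ObjectProperty (ModuleCat.{u} Λ)} {C : ObjectProperty (ModuleCat.{u} R)}

/-- An additive functorial map on homomorphisms, in the direction opposite to a functor `G`, which
kills no nonzero idempotent. -/
structure HomRetraction (G : P.FullSubcategory ⥤ C.FullSubcategory) where
  map : ∀ X Y : P.FullSubcategory, (G.obj X ⟶ G.obj Y) → (X ⟶ Y)
  map_id : ∀ X, map X X (𝟙 _) = 𝟙 X
  map_comp : ∀ X Y Z (a : G.obj X ⟶ G.obj Y) (b : G.obj Y ⟶ G.obj Z),
    map X Z (a ≫ b) = map X Y a ≫ map Y Z b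
  map_add : ∀ X Y (a b : G.obj X ⟶ G.obj Y), map X Y (a + b) = map X Y a + map X Y b
  eq_zero : ∀ X (a : G.obj X ⟶ G.obj X), a ≫ a = a → map X X a = 0 → a = 0

/-- Isomorphisms are carried back by functoriality. A decomposition of `G X` gives an idempotent
`a`, carried back to zero or the identity because `X` is indecomposable; then `a` or `1 - a` is
carried to zero, hence is zero. -/
theorem HomRetraction.isRepresentationEmbedding {G : P.FullSubcategory ⥤ C.FullSubcategory}
    (ρ : HomRetraction G) (hadd : G.Additive)
    (hexact : ∀ E : ShortComplex P.FullSubcategory,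
      (E.map P.ι).ShortExact → ((E.map G).map C.ι).ShortExact) :
    IsRepresentationEmbedding G where
  additive := hadd
  exact := hexact
  nonIso X Y := fun ⟨e⟩ => ⟨⟨ρ.map _ _ e.hom, ρ.map _ _ e.inv,
    by rw [← ρ.map_comp, e.hom_inv_id, ρ.map_id], by rw [← ρ.map_comp, e.inv_hom_id, ρ.map_id]⟩⟩
  indecomposable X hX := by
    have hzero : ∀ X Y, ρ.map X Y 0 = 0 := fun X Y => by
      have := ρ.map_add X Y 0 0
      rw [add_zero] at this
      exact left_eq_add.mp this
    refine ⟨fun hz => hX.1 ?_, fun Y Z iso => ?_⟩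
    · have h1 : 𝟙 (G.obj X) = 0 := ObjectProperty.hom_ext _ (hz.eq_of_src _ _)
      have h2 : 𝟙 X = 0 := by rw [← ρ.map_id, h1, hzero]
      rw [IsZero.iff_id_eq_zero]
      exact congrArg (fun a => a.hom) h2
    · let a : G.obj X ⟶ G.obj X := ObjectProperty.homMk
        (iso.hom ≫ biprod.fst ≫ biprod.inl ≫ iso.inv)
      have ha : a ≫ a = a := by
        apply ObjectProperty.hom_ext
        simp [a]
      have hidem : ρ.map X X a ≫ ρ.map X X a = ρ.map X X a := by rw [← ρ.map_comp, ha]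
      have hX' := eq_zero_or_eq_id_of_indecomposable hX (ρ.map X X a).hom
        (congrArg (fun a => a.hom) hidem)
      rcases hX' with h | h
      · left
        have h1 : a = 0 := ρ.eq_zero X a ha (ObjectProperty.hom_ext _ h)
        have h2 : a.hom = 0 := congrArg (fun a => a.hom) h1
        rw [IsZero.iff_id_eq_zero]
        have h3 : biprod.inl ≫ iso.inv ≫ a.hom ≫ iso.hom ≫ biprod.fst = 𝟙 Y := by simp [a]
        rw [← h3, h2]
        simp
      · right
        have hb : (𝟙 _ - a) ≫ (𝟙 _ - a) = 𝟙 _ - a := by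
          simp [Preadditive.sub_comp, Preadditive.comp_sub, ha]
        have hb' : ρ.map X X (𝟙 _ - a) = 0 := by
          have h4 := ρ.map_add X X (𝟙 _ - a) a
          rw [sub_add_cancel, ρ.map_id] at h4
          have h5 : ρ.map X X a = 𝟙 X := ObjectProperty.hom_ext _ h
          rw [h5] at h4
          exact right_eq_add.mp h4
        have h1 : 𝟙 _ = a := sub_eq_zero.mp (ρ.eq_zero X _ hb hb')
        have h2 : a.hom = 𝟙 _ := congrArg (fun a => a.hom) h1.symm
        rw [IsZero.iff_id_eq_zero]
        -- The composite is zero because `a` projects onto `Y`; once `a` is the identity it is also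
        -- the identity of `Z`.
        have h3 : biprod.inr ≫ iso.inv ≫ a.hom ≫ iso.hom ≫ biprod.snd = (0 : Z ⟶ Z) := by
          simp [a]
        rw [← h3, h2]
        simp

theorem IsRepresentationEmbedding.comp {Γ : Type*} [Ring Γ] {D : ObjectProperty (ModuleCat.{u} Γ)}
    {G : P.FullSubcategory ⥤ C.FullSubcategory} {H : C.FullSubcategory ⥤ D.FullSubcategory}
    (hG : IsRepresentationEmbedding G) (hH : IsRepresentationEmbedding H) :
    IsRepresentationEmbedding (G ⋙ H) where
  additive := by
    have := hG.additive
    have := hH.additive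
    infer_instance
  exact E hE := by
    have := hG.additive
    exact hH.exact (E.map G) (hG.exact E hE)
  nonIso X Y h := hG.nonIso X Y (hH.nonIso _ _ h)
  indecomposable X hX := hH.indecomposable _ (hG.indecomposable X hX)

end

end WildHypersurface

/-! ### Exactness and retraction for the inflation functor -/

namespace WildHypersurface

universe u

open MvPowerSeries (coeff constantCoeff)

section

variable {k : Type u} [Field k] {n : ℕ} {ι ι' : Type*}

theorem blockDiag_add (ρ : Type*) [DecidableEq ρ] (U V : Matrix ι' ι k) :
    blockDiag n ρ (U + V) = blockDiag n ρ U + blockDiag n ρ V := by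
  refine Matrix.ext fun r s => ?_
  by_cases h : r.1 = s.1 <;> simp [blockDiag, h]

theorem blockDiag_zero (ρ : Type*) [DecidableEq ρ] :
    blockDiag n ρ (0 : Matrix ι' ι k) = 0 := by
  refine Matrix.ext fun r s => ?_
  simp [blockDiag]

theorem corner_congr {S S' : Matrix (Idx n × ι') (Idx n × ι) (PS k n)}
    (h : S.map (constantCoeff (R := k)) = S'.map (constantCoeff (R := k))) :
    corner S = corner S' := by
  ext1 i' i
  exact congrFun (congrFun h (Idx.bot n, i')) (Idx.bot n, i)

theorem corner_add (S S' : Matrix (Idx n × ι') (Idx n × ι) (PS k n)) :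
    corner (S + S') = corner S + corner S' := by
  ext1 i' i
  exact map_add (constantCoeff (R := k)) _ _

variable {κ κ' : Type*} [Fintype κ] [Fintype κ'] {f : PS k n} {Φ : Matrix κ κ (PS k n)}
  {Φ' : Matrix κ' κ' (PS k n)}

theorem isLift_cokMap {T T' : Matrix κ' κ (PS k n)} (h : T * Φ = Φ' * T') :
    IsLift T (cokMap f T T' h) :=
  cokMap_cokMk h

theorem IsLift.ext {T : Matrix κ' κ (PS k n)} {θ θ' : Cok f Φ →ₗ[Hypersurface f] Cok f Φ'}
    (h : IsLift T θ) (h' : IsLift T θ') : θ = θ' := by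
  refine LinearMap.ext fun x => ?_
  obtain ⟨v, rfl⟩ := cokMk_surjective x
  rw [h, h']

end

section

variable {k : Type u} [Field k] {n : ℕ} {ι₁ ι₂ ι₃ : Type*} [Fintype ι₁] [Fintype ι₂] [Fintype ι₃]
  [DecidableEq ι₁] [DecidableEq ι₂] [DecidableEq ι₃]
  {A₁ : Fin n → Matrix ι₁ ι₁ k} {A₂ : Fin n → Matrix ι₂ ι₂ k} {A₃ : Fin n → Matrix ι₃ ι₃ k}
  {f : PS k n} {h : PS (MvPolynomial (Fin n) k) n} {g : Fin n → PS (MvPolynomial (Fin n) k) n}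

/-- Cokernels of inflations take split sequences of matrices compatible with the action to short
exact sequences. -/
theorem exact_cokMap (e : IsExpression f h g) (hf : f ≠ 0)
    (hA₁ : ∀ i j, A₁ i * A₁ j = A₁ j * A₁ i) (hA₂ : ∀ i j, A₂ i * A₂ j = A₂ j * A₂ i)
    (hA₃ : ∀ i j, A₃ i * A₃ j = A₃ j * A₃ i)
    {U : Matrix ι₂ ι₁ k} {V : Matrix ι₃ ι₂ k} {U' : Matrix ι₁ ι₂ k} {V' : Matrix ι₂ ι₃ k}
    (hU : ∀ i, U * A₁ i = A₂ i * U) (hV : ∀ i, V * A₂ i = A₃ i * V) (hUU : U' * U = 1)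
    (hVU : V * U = 0) (hVV : V * V' = 1) (hsplit : U * U' + V' * V = 1)
    {θ : Cok f (inflatedPhi h g A₁) →ₗ[Hypersurface f] Cok f (inflatedPhi h g A₂)}
    {χ : Cok f (inflatedPhi h g A₂) →ₗ[Hypersurface f] Cok f (inflatedPhi h g A₃)}
    (hθ : IsLift (blockDiag n (Idx n) U) θ) (hχ : IsLift (blockDiag n (Idx n) V) χ) :
    Function.Injective θ ∧ Function.Surjective χ ∧ Function.Exact θ χ := by
  have mf₁ := isMatrixFactorization_inflated e hA₁
  have mf₂ := isMatrixFactorization_inflated e hA₂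
  have mf₃ := isMatrixFactorization_inflated e hA₃
  have cU := blockDiag_mul_inflatedPhi h g hU
  have cV := blockDiag_mul_inflatedPhi h g hV
  -- `U'` and `V'` need not respect the action: they split only the sequence of free modules.
  have hker : ∀ y, (blockDiag n (Idx n) V).mulVec y = 0 →
      y = (blockDiag n (Idx n) U).mulVec ((blockDiag n (Idx n) U').mulVec y) := by
    intro y hy
    have := congrArg (fun M => (blockDiag n (Idx n) M).mulVec y) hsplit
    simp only [blockDiag_add, blockDiag_mul, blockDiag_one, Matrix.add_mulVec, Matrix.one_mulVec,
      ← Matrix.mulVec_mulVec, hy, Matrix.mulVec_zero, add_zero] at this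
    exact this.symm
  have hleft : ∀ y, (blockDiag n (Idx n) U').mulVec ((blockDiag n (Idx n) U).mulVec y) = y := by
    intro y
    rw [Matrix.mulVec_mulVec, ← blockDiag_mul, hUU, blockDiag_one, Matrix.one_mulVec]
  have hright : ∀ y, (blockDiag n (Idx n) V).mulVec ((blockDiag n (Idx n) V').mulVec y) = y := by
    intro y
    rw [Matrix.mulVec_mulVec, ← blockDiag_mul, hVV, blockDiag_one, Matrix.one_mulVec]
  have hzero : ∀ y, (blockDiag n (Idx n) V).mulVec ((blockDiag n (Idx n) U).mulVec y) = 0 := by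
    intro y
    rw [Matrix.mulVec_mulVec, ← blockDiag_mul, hVU, blockDiag_zero, Matrix.zero_mulVec]
  refine ⟨?_, ?_, ?_⟩
  · rw [injective_iff_map_eq_zero]
    intro x hx
    obtain ⟨v, rfl⟩ := cokMk_surjective x
    rw [hθ, cokMk_eq_zero_iff mf₂] at hx
    obtain ⟨y, hy⟩ := hx
    -- The matrix `Φ` of the third module is injective, as a factor of `f ≠ 0`; so `y` comes from
    -- the first free module.
    have h1 : (blockDiag n (Idx n) V).mulVec y = 0 := by
      refine mf₃.mulVec_injective hf ?_
      rw [Matrix.mulVec_mulVec, ← cV, ← Matrix.mulVec_mulVec, ← hy, hzero]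
    rw [cokMk_eq_zero_iff mf₁]
    refine ⟨(blockDiag n (Idx n) U').mulVec y, ?_⟩
    have h2 : (inflatedPhi h g A₂).mulVec y = (blockDiag n (Idx n) U).mulVec
        ((inflatedPhi h g A₁).mulVec ((blockDiag n (Idx n) U').mulVec y)) := by
      rw [Matrix.mulVec_mulVec, cU, ← Matrix.mulVec_mulVec, ← hker y h1]
    rw [← hleft v, hy, h2, hleft]
  · intro x
    obtain ⟨v, rfl⟩ := cokMk_surjective x
    exact ⟨cokMk f _ ((blockDiag n (Idx n) V').mulVec v), by rw [hχ, hright]⟩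
  · intro x
    constructor
    · intro hx
      obtain ⟨v, rfl⟩ := cokMk_surjective x
      rw [hχ, cokMk_eq_zero_iff mf₃] at hx
      obtain ⟨y, hy⟩ := hx
      -- Subtracting an element of the image of `Φ` keeps the class of `v` and moves it into the
      -- kernel of `V`.
      have h1 : (blockDiag n (Idx n) V).mulVec (v - (inflatedPhi h g A₂).mulVec
          ((blockDiag n (Idx n) V').mulVec y)) = 0 := by
        rw [Matrix.mulVec_sub, Matrix.mulVec_mulVec _ _ (inflatedPhi h g A₂), cV,
          ← Matrix.mulVec_mulVec, hright, hy, sub_self]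
      refine ⟨cokMk f _ ((blockDiag n (Idx n) U').mulVec (v - (inflatedPhi h g A₂).mulVec
          ((blockDiag n (Idx n) V').mulVec y))), ?_⟩
      rw [hθ, ← hker _ h1, map_sub, cokMk_mulVec, sub_zero]
    · rintro ⟨y, rfl⟩
      obtain ⟨v, rfl⟩ := cokMk_surjective y
      rw [hθ, hχ, hzero, map_zero]

end

section

attribute [local instance] ModuleCat.moduleOfAlgebraModule
  ModuleCat.isScalarTower_of_algebra_moduleCat

variable {k : Type u} [Field k] {n : ℕ} (b : BasisChoice k n)

theorem actionMatrix_comm (M : (FL k n).FullSubcategory) (i j : Fin n) :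
    actionMatrix b M i * actionMatrix b M j = actionMatrix b M j * actionMatrix b M i := by
  simp only [actionMatrix, ← LinearMap.toMatrix_comp]
  congr 1
  ext x
  exact smul_comm (MvPolynomial.X i : MvPolynomial (Fin n) k) (MvPolynomial.X j) x

theorem homMatrix_injective {M N : (FL k n).FullSubcategory} :
    Function.Injective (homMatrix b : (M ⟶ N) → _) := by
  intro φ χ h
  have h1 := (LinearMap.toMatrix (b M) (b N)).injective h
  apply ObjectProperty.hom_ext
  ext x
  exact LinearMap.congr_fun h1 x

/-- The `a_i` generate the polynomial algebra, so commuting with their action is linearity. -/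
theorem exists_homMatrix_eq {M N : (FL k n).FullSubcategory}
    (U : Matrix (Fin (Module.finrank k N.obj)) (Fin (Module.finrank k M.obj)) k)
    (hU : ∀ i, U * actionMatrix b M i = actionMatrix b N i * U) :
    ∃ φ : M ⟶ N, homMatrix b φ = U := by
  let ℓ : M.obj →ₗ[k] N.obj := Matrix.toLin (b M) (b N) U
  have hℓU : LinearMap.toMatrix (b M) (b N) ℓ = U := LinearMap.toMatrix_toLin _ _ _
  have hX : ∀ (i : Fin n) (x : M.obj), ℓ ((MvPolynomial.X i : MvPolynomial (Fin n) k) • x) =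
      (MvPolynomial.X i : MvPolynomial (Fin n) k) • ℓ x := by
    intro i x
    have h := hU i
    rw [← hℓU, actionMatrix, actionMatrix, ← LinearMap.toMatrix_comp, ← LinearMap.toMatrix_comp] at h
    exact LinearMap.congr_fun ((LinearMap.toMatrix (b M) (b N)).injective h) x
  have hlin : ∀ (p : MvPolynomial (Fin n) k) (x : M.obj), ℓ (p • x) = p • ℓ x := by
    intro p
    induction p using MvPolynomial.induction_on with
    | C a =>
      intro x
      rw [← MvPolynomial.algebraMap_eq, algebraMap_smul, algebraMap_smul, map_smul]
    | add p q hp hq =>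
      intro x
      rw [add_smul, map_add, hp, hq, add_smul]
    | mul_X p i hp =>
      intro x
      rw [mul_smul, hp, hX, mul_smul]
  let ℓ' : M.obj →ₗ[MvPolynomial (Fin n) k] N.obj :=
    { toFun := ℓ, map_add' := map_add ℓ, map_smul' := hlin }
  exact ⟨ObjectProperty.homMk (ModuleCat.ofHom ℓ'), hℓU⟩

/-- A short exact sequence of finite-length modules splits over the field. -/
theorem exists_splitting {E : ShortComplex (FL k n).FullSubcategory}
    (hE : (E.map (FL k n).ι).ShortExact) : ∃ (U' : Matrix (Fin (Module.finrank k E.X₁.obj))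
      (Fin (Module.finrank k E.X₂.obj)) k) (V' : Matrix (Fin (Module.finrank k E.X₂.obj))
      (Fin (Module.finrank k E.X₃.obj)) k), U' * homMatrix b E.f = 1 ∧
      homMatrix b E.g * homMatrix b E.f = 0 ∧ homMatrix b E.g * V' = 1 ∧
      homMatrix b E.f * U' + V' * homMatrix b E.g = 1 := by
  have hinj := hE.moduleCat_injective_f
  have hsurj := hE.moduleCat_surjective_g
  have hex := (ShortComplex.ShortExact.moduleCat_exact_iff_function_exact _).mp hE.exact
  let φ : E.X₁.obj →ₗ[k] E.X₂.obj := E.f.hom.hom.restrictScalars k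
  let χ : E.X₂.obj →ₗ[k] E.X₃.obj := E.g.hom.hom.restrictScalars k
  obtain ⟨r, hr⟩ := φ.exists_leftInverse_of_injective (LinearMap.ker_eq_bot.mpr hinj)
  obtain ⟨s, hs⟩ := χ.exists_rightInverse_of_surjective (LinearMap.range_eq_top.mpr hsurj)
  have hχφ : χ ∘ₗ φ = 0 := LinearMap.ext fun x => hex.apply_apply_eq_zero x
  -- An arbitrary left inverse `r` is adjusted to `r (1 - s χ)` to match the section `s`.
  have hsplit : φ ∘ₗ (r ∘ₗ (LinearMap.id - s ∘ₗ χ)) + s ∘ₗ χ = LinearMap.id := by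
    refine LinearMap.ext fun x => ?_
    have h1 : χ (x - s (χ x)) = 0 := by
      rw [map_sub, ← LinearMap.comp_apply χ s, hs, LinearMap.id_apply, sub_self]
    obtain ⟨y, hy⟩ : ∃ y : E.X₁.obj, φ y = x - s (χ x) := (hex _).mp h1
    change φ (r (x - s (χ x))) + s (χ x) = x
    rw [← hy, ← LinearMap.comp_apply r φ, hr, LinearMap.id_apply, hy, sub_add_cancel]
  have hleft : (r ∘ₗ (LinearMap.id - s ∘ₗ χ)) ∘ₗ φ = LinearMap.id := by
    rw [LinearMap.comp_assoc, LinearMap.sub_comp, LinearMap.comp_assoc, hχφ, LinearMap.comp_zero,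
      sub_zero, LinearMap.id_comp, hr]
  have hf : homMatrix b E.f = LinearMap.toMatrix (b E.X₁) (b E.X₂) φ := rfl
  have hg : homMatrix b E.g = LinearMap.toMatrix (b E.X₂) (b E.X₃) χ := rfl
  refine ⟨LinearMap.toMatrix (b E.X₂) (b E.X₁) (r ∘ₗ (LinearMap.id - s ∘ₗ χ)),
    LinearMap.toMatrix (b E.X₃) (b E.X₂) s, ?_, ?_, ?_, ?_⟩
  · rw [hf, ← LinearMap.toMatrix_comp, hleft, LinearMap.toMatrix_id]
  · rw [hf, hg, ← LinearMap.toMatrix_comp, hχφ, map_zero]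
  · rw [hg, ← LinearMap.toMatrix_comp, hs, LinearMap.toMatrix_id]
  · rw [hf, hg, ← LinearMap.toMatrix_comp, ← LinearMap.toMatrix_comp, ← map_add, hsplit,
      LinearMap.toMatrix_id]

variable {f : PS k n} {h : PS (MvPolynomial (Fin n) k) n}
  {g : Fin n → PS (MvPolynomial (Fin n) k) n}

theorem isLift_inflationFunctor_map {M N : (FL k n).FullSubcategory} (φ : M ⟶ N) :
    IsLift (blockDiag n (Idx n) (homMatrix b φ)) ((inflationFunctor b f h g).map φ).hom :=
  isLift_cokMap (blockDiag_mul_inflatedPhi h g (homMatrix_intertwine b φ))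

theorem exists_homMatrix_eq_corner (e : IsExpression f h g) {M N : (FL k n).FullSubcategory}
    (θ : Cok f (inflatedPhi h g (actionMatrix b M)) →ₗ[Hypersurface f]
      Cok f (inflatedPhi h g (actionMatrix b N))) :
    ∃ φ : M ⟶ N, ∀ T, IsLift T θ → homMatrix b φ = corner T := by
  obtain ⟨T, hT⟩ := exists_isLift θ
  have mf := isMatrixFactorization_inflated e (actionMatrix_comm b N)
  obtain ⟨T', hT'⟩ := hT.exists_mul_eq mf
  obtain ⟨φ, hφ⟩ := exists_homMatrix_eq b (corner T)
    (corner_intertwine (actionMatrix_comm b M) (actionMatrix_comm b N) e hT')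
  exact ⟨φ, fun T₁ hT₁ => hφ.trans
    (corner_congr (hT.map_constantCoeff_eq mf (constantCoeff_inflated e).1 hT₁))⟩

/-- The homomorphism of modules obtained from a homomorphism of cokernels. -/
noncomputable def cornerHom (e : IsExpression f h g) {M N : (FL k n).FullSubcategory}
    (θ : Cok f (inflatedPhi h g (actionMatrix b M)) →ₗ[Hypersurface f]
      Cok f (inflatedPhi h g (actionMatrix b N))) : M ⟶ N :=
  (exists_homMatrix_eq_corner b e θ).choose

theorem homMatrix_cornerHom (e : IsExpression f h g) {M N : (FL k n).FullSubcategory}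
    {θ : Cok f (inflatedPhi h g (actionMatrix b M)) →ₗ[Hypersurface f]
      Cok f (inflatedPhi h g (actionMatrix b N))}
    {T : Matrix (Idx n × Fin (Module.finrank k N.obj)) (Idx n × Fin (Module.finrank k M.obj))
      (PS k n)} (hT : IsLift T θ) : homMatrix b (cornerHom b e θ) = corner T :=
  (exists_homMatrix_eq_corner b e θ).choose_spec T hT

theorem cornerHom_id (e : IsExpression f h g) (M : (FL k n).FullSubcategory) :
    cornerHom b e (M := M) LinearMap.id = 𝟙 M := by
  apply homMatrix_injective b
  rw [homMatrix_cornerHom b e IsLift.id, corner_one, homMatrix_id]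

theorem cornerHom_comp (e : IsExpression f h g) (hf : f ≠ 0) {M N K : (FL k n).FullSubcategory}
    (θ : Cok f (inflatedPhi h g (actionMatrix b M)) →ₗ[Hypersurface f]
      Cok f (inflatedPhi h g (actionMatrix b N)))
    (χ : Cok f (inflatedPhi h g (actionMatrix b N)) →ₗ[Hypersurface f]
      Cok f (inflatedPhi h g (actionMatrix b K))) :
    cornerHom b e (χ ∘ₗ θ) = cornerHom b e θ ≫ cornerHom b e χ := by
  obtain ⟨T, hT⟩ := exists_isLift θ
  obtain ⟨T₁, hT₁⟩ := exists_isLift χ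
  obtain ⟨T₂, hT₂⟩ := hT₁.exists_mul_eq
    (isMatrixFactorization_inflated e (actionMatrix_comm b K))
  apply homMatrix_injective b
  rw [homMatrix_comp, homMatrix_cornerHom b e hT, homMatrix_cornerHom b e hT₁,
    homMatrix_cornerHom b e (hT.comp hT₁),
    corner_mul (actionMatrix_comm b N) (actionMatrix_comm b K) e hf hT₂]

theorem homMatrix_add {M N : (FL k n).FullSubcategory} (φ ψ : M ⟶ N) :
    homMatrix b (φ + ψ) = homMatrix b φ + homMatrix b ψ :=
  map_add (LinearMap.toMatrix (b M) (b N)) (φ.hom.hom.restrictScalars k)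
    (ψ.hom.hom.restrictScalars k)

theorem cornerHom_add (e : IsExpression f h g) {M N : (FL k n).FullSubcategory}
    (θ χ : Cok f (inflatedPhi h g (actionMatrix b M)) →ₗ[Hypersurface f]
      Cok f (inflatedPhi h g (actionMatrix b N))) :
    cornerHom b e (θ + χ) = cornerHom b e θ + cornerHom b e χ := by
  obtain ⟨T, hT⟩ := exists_isLift θ
  obtain ⟨T₁, hT₁⟩ := exists_isLift χ
  apply homMatrix_injective b
  rw [homMatrix_add, homMatrix_cornerHom b e hT, homMatrix_cornerHom b e hT₁,
    homMatrix_cornerHom b e (hT.add hT₁), corner_add]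

/-- If `T` lifts an idempotent then so does `T * T`; hence the two have equal constant terms,
although `T` itself need not be idempotent. -/
theorem eq_zero_of_cornerHom_eq_zero (e : IsExpression f h g) (hf : f ≠ 0)
    {M : (FL k n).FullSubcategory}
    {θ : Cok f (inflatedPhi h g (actionMatrix b M)) →ₗ[Hypersurface f]
      Cok f (inflatedPhi h g (actionMatrix b M))} (hθ : θ ∘ₗ θ = θ)
    (h0 : cornerHom b e θ = 0) : θ = 0 := by
  obtain ⟨T, hT⟩ := exists_isLift θ
  have mf := isMatrixFactorization_inflated e (actionMatrix_comm b M)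
  obtain ⟨T', hT'⟩ := hT.exists_mul_eq mf
  have hc : corner T = 0 := by
    rw [← homMatrix_cornerHom b e hT, h0]
    exact map_zero (LinearMap.toMatrix (b M) (b M))
  have hT2 : IsLift (T * T) θ := by
    have := hT.comp hT
    rwa [hθ] at this
  exact hT.eq_zero_of_idempotent hθ (map_constantCoeff_eq_zero_of_idempotent
    (actionMatrix_comm b M) e hf hT'
    (hT2.map_constantCoeff_eq mf (constantCoeff_inflated e).1 hT) hc)

/-- The map from homomorphisms of cokernels to homomorphisms of modules. -/
noncomputable def inflationRetraction (e : IsExpression f h g) (hf : f ≠ 0)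
    {C : ObjectProperty (ModuleCat.{u} (Hypersurface f))}
    (hC : ∀ M, C ((inflationFunctor b f h g).obj M)) :
    HomRetraction (C.lift (inflationFunctor b f h g) hC) where
  map _ _ θ := cornerHom b e θ.hom.hom
  map_id M := cornerHom_id b e M
  map_comp _ _ _ θ χ := cornerHom_comp b e hf θ.hom.hom χ.hom.hom
  map_add _ _ θ χ := cornerHom_add b e θ.hom.hom χ.hom.hom
  eq_zero _ _ hθ h0 := ObjectProperty.hom_ext _ (ModuleCat.hom_ext
    (eq_zero_of_cornerHom_eq_zero b e hf (congrArg (fun a => a.hom.hom) hθ) h0))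

theorem isRepresentationEmbedding_inflation (e : IsExpression f h g) (hf : f ≠ 0)
    {C : ObjectProperty (ModuleCat.{u} (Hypersurface f))}
    (hC : ∀ M, C ((inflationFunctor b f h g).obj M)) :
    IsRepresentationEmbedding (C.lift (inflationFunctor b f h g) hC) := by
  refine (inflationRetraction b e hf hC).isRepresentationEmbedding ⟨?_⟩ fun E hE => ?_
  · intro M N φ ψ
    apply ObjectProperty.hom_ext
    refine ModuleCat.hom_ext ?_
    have h1 := isLift_inflationFunctor_map b (f := f) (h := h) (g := g) (φ + ψ)
    rw [homMatrix_add, blockDiag_add] at h1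
    exact h1.ext ((isLift_inflationFunctor_map b φ).add (isLift_inflationFunctor_map b ψ))
  · obtain ⟨U', V', h1, h2, h3, h4⟩ := exists_splitting b hE
    obtain ⟨k1, k2, k3⟩ := exact_cokMap e hf (actionMatrix_comm b E.X₁) (actionMatrix_comm b E.X₂)
      (actionMatrix_comm b E.X₃) (homMatrix_intertwine b E.f) (homMatrix_intertwine b E.g) h1 h2 h3
      h4 (isLift_inflationFunctor_map b E.f) (isLift_inflationFunctor_map b E.g)
    exact ModuleCat.shortComplex_shortExact _ k3 k1 k2

end

end WildHypersurface

/-! ### Wildness of finite-length modules over polynomial rings -/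

namespace WildHypersurface

universe u v

noncomputable section

/-- Linear maps from the polynomial ring to a vector space, with the contragredient action of the
polynomial ring. -/
def PolyDual (k : Type u) [Field k] (n : ℕ) (M : Type v) [AddCommGroup M] [Module k M] :
    Type (max u v) :=
  MvPolynomial (Fin n) k →ₗ[k] M

namespace PolyDual

section

variable {k : Type u} [Field k] {n : ℕ} {M N : Type v} [AddCommGroup M] [Module k M]
  [AddCommGroup N] [Module k N]

instance : AddCommGroup (PolyDual k n M) :=
  inferInstanceAs (AddCommGroup (MvPolynomial (Fin n) k →ₗ[k] M))

instance : Module k (PolyDual k n M) :=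
  inferInstanceAs (Module k (MvPolynomial (Fin n) k →ₗ[k] M))

instance : FunLike (PolyDual k n M) (MvPolynomial (Fin n) k) M :=
  inferInstanceAs (FunLike (MvPolynomial (Fin n) k →ₗ[k] M) _ _)

instance : LinearMapClass (PolyDual k n M) k (MvPolynomial (Fin n) k) M :=
  inferInstanceAs (LinearMapClass (MvPolynomial (Fin n) k →ₗ[k] M) k _ _)

theorem ext {θ χ : PolyDual k n M} (h : ∀ p, θ p = χ p) : θ = χ := LinearMap.ext h

instance : Module (MvPolynomial (Fin n) k) (PolyDual k n M) where
  smul p θ := LinearMap.comp (θ : MvPolynomial (Fin n) k →ₗ[k] M) (LinearMap.mulLeft k p)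
  one_smul θ := ext fun q => congrArg θ (one_mul q)
  mul_smul p q θ := ext fun r => congrArg θ (by
    change p * q * r = q * (p * r)
    ring)
  smul_zero _ := rfl
  smul_add _ _ _ := rfl
  add_smul p q θ := ext fun r => (congrArg θ (add_mul p q r)).trans (map_add θ _ _)
  zero_smul θ := ext fun r => (congrArg θ (zero_mul r)).trans (map_zero θ)

theorem smul_apply (p : MvPolynomial (Fin n) k) (θ : PolyDual k n M) (q : MvPolynomial (Fin n) k) :
    (p • θ) q = θ (p * q) := rfl

theorem scalar_smul_apply (c : k) (θ : PolyDual k n M) (q : MvPolynomial (Fin n) k) :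
    (c • θ) q = c • θ q := rfl

instance : IsScalarTower k (MvPolynomial (Fin n) k) (PolyDual k n M) :=
  IsScalarTower.of_algebraMap_smul fun c θ => ext fun q => by
    rw [smul_apply, scalar_smul_apply, ← Algebra.smul_def, map_smul]

/-- The value on a monomial. -/
def val (θ : PolyDual k n M) (ν : Fin n →₀ ℕ) : M := θ (MvPolynomial.monomial ν 1)

theorem ext_val {θ χ : PolyDual k n M} (h : ∀ ν, θ.val ν = χ.val ν) : θ = χ := by
  refine (MvPolynomial.basisMonomials (Fin n) k).ext fun ν => ?_
  rw [MvPolynomial.coe_basisMonomials]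
  exact h ν

theorem val_add (θ χ : PolyDual k n M) (ν) : (θ + χ).val ν = θ.val ν + χ.val ν := rfl

theorem val_sub (θ χ : PolyDual k n M) (ν) : (θ - χ).val ν = θ.val ν - χ.val ν := rfl

theorem val_zero (ν) : (0 : PolyDual k n M).val ν = 0 := rfl

theorem val_smul (c : k) (θ : PolyDual k n M) (ν) : (c • θ).val ν = c • θ.val ν := rfl

theorem val_monomial_smul (ν : Fin n →₀ ℕ) (θ : PolyDual k n M) (ν' : Fin n →₀ ℕ) :
    ((MvPolynomial.monomial ν (1 : k)) • θ).val ν' = θ.val (ν + ν') := by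
  rw [val, smul_apply, MvPolynomial.monomial_mul, one_mul, val]

theorem val_X_smul (j : Fin n) (θ : PolyDual k n M) (ν' : Fin n →₀ ℕ) :
    ((MvPolynomial.X j : MvPolynomial (Fin n) k) • θ).val ν' =
      θ.val (Finsupp.single j 1 + ν') :=
  val_monomial_smul _ _ _

/-- The functional supported at a monomial. -/
def delta (ν : Fin n →₀ ℕ) (m : M) : PolyDual k n M :=
  (MvPolynomial.lcoeff k ν).smulRight m

theorem val_delta (ν ν' : Fin n →₀ ℕ) (m : M) :
    (delta (k := k) ν m).val ν' = if ν' = ν then m else 0 := by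
  change (MvPolynomial.coeff ν (MvPolynomial.monomial ν' (1 : k))) • m = _
  rw [MvPolynomial.coeff_monomial]
  split_ifs <;> simp

/-- Composition with a linear map. -/
def postcomp (φ : M →ₗ[k] N) : PolyDual k n M →ₗ[MvPolynomial (Fin n) k] PolyDual k n N where
  toFun θ := φ.comp (θ : MvPolynomial (Fin n) k →ₗ[k] M)
  map_add' _ _ := ext fun _ => map_add φ _ _
  map_smul' _ _ := rfl

theorem val_postcomp (φ : M →ₗ[k] N) (θ : PolyDual k n M) (ν) :
    (postcomp φ θ).val ν = φ (θ.val ν) := rfl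

end

end PolyDual

open PolyDual

section

variable (k : Type u) [Field k] {n : ℕ} {Λ : Type u} [Ring Λ] [Algebra k Λ]
  {ι : Type} [Fintype ι] (d : ℕ) (μ : ι → Fin n →₀ ℕ)
  (hμ : ∀ i, (μ i).degree = d) (lam : ι → Λ)
  (M : Type u) [AddCommGroup M] [Module Λ M] [Module k M] [IsScalarTower k Λ M]

/-- The functionals vanishing in degrees larger than `d` and satisfying one linear relation, with
coefficients in `Λ`, between values at monomials of degree `d`. -/
def relationDual : Submodule (MvPolynomial (Fin n) k) (PolyDual k n M) where
  carrier := {θ | (∀ ν : Fin n →₀ ℕ, d < ν.degree → θ.val ν = 0) ∧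
    ∑ i, lam i • θ.val (μ i) = 0}
  zero_mem' := ⟨fun _ _ => val_zero _, by simp [val_zero]⟩
  add_mem' := by
    rintro θ χ ⟨h1, h2⟩ ⟨h3, h4⟩
    refine ⟨fun ν hν => by rw [val_add, h1 ν hν, h3 ν hν, add_zero], ?_⟩
    simp only [val_add, smul_add, Finset.sum_add_distrib, h2, h4, add_zero]
  smul_mem' := by
    intro p
    induction p using MvPolynomial.induction_on with
    | C a =>
      rintro θ ⟨h1, h2⟩
      rw [← MvPolynomial.algebraMap_eq, algebraMap_smul]
      have hc : ∀ i, lam i • a • θ.val (μ i) = a • lam i • θ.val (μ i) := fun i =>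
        smul_algebra_smul_comm a (lam i) _
      refine ⟨fun ν hν => by rw [val_smul, h1 ν hν, smul_zero], ?_⟩
      simp only [val_smul, hc, ← Finset.smul_sum, h2, smul_zero]
    | add p q hp hq =>
      intro θ h
      rw [add_smul]
      obtain ⟨h1, h2⟩ := hp h
      obtain ⟨h3, h4⟩ := hq h
      refine ⟨fun ν hν => by rw [val_add, h1 ν hν, h3 ν hν, add_zero], ?_⟩
      simp only [val_add, smul_add, Finset.sum_add_distrib, h2, h4, add_zero]
    | mul_X p j hp =>
      rintro θ ⟨h1, h2⟩
      rw [mul_smul]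
      -- Multiplication by a variable replaces the values in degree `d` by values in degree `d + 1`,
      -- which vanish, so the relation becomes trivial.
      refine hp ⟨fun ν hν => ?_, Finset.sum_eq_zero fun i _ => ?_⟩
      · rw [val_X_smul, h1]
        rw [map_add]
        omega
      · rw [val_X_smul, h1, smul_zero]
        rw [map_add, hμ, Finsupp.degree_single]
        omega

variable {k d μ hμ lam M} {N : Type u} [AddCommGroup N] [Module Λ N] [Module k N]
  [IsScalarTower k Λ N]

theorem val_eq_zero {θ : PolyDual k n M} (hθ : θ ∈ relationDual k d μ hμ lam M)
    {ν : Fin n →₀ ℕ} (hν : d < ν.degree) : θ.val ν = 0 := hθ.1 ν hν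

theorem delta_zero_mem (hd : 1 ≤ d) (m : M) : delta 0 m ∈ relationDual k d μ hμ lam M := by
  have h : ∀ ν : Fin n →₀ ℕ, d ≤ ν.degree → ν ≠ 0 := by
    rintro _ h rfl
    rw [map_zero] at h
    omega
  refine ⟨fun ν hν => ?_, Finset.sum_eq_zero fun i _ => ?_⟩
  · rw [val_delta, if_neg (h ν hν.le)]
  · rw [val_delta, if_neg (h _ (hμ i).ge), smul_zero]

omit [Fintype ι] in
theorem val_delta_of_degree_ne {i : ι} {m : M} {ν : Fin n →₀ ℕ} (hν : ν.degree ≠ (μ i).degree) :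
    (delta (k := k) (μ i) m).val ν = 0 := by
  rw [val_delta, if_neg]
  rintro rfl
  exact hν rfl

variable (k d μ hμ lam M) in
theorem finite_relationDual [Module.Finite k M] : Module.Finite k (relationDual k d μ hμ lam M) := by
  have hfin : Finite {ν : Fin n →₀ ℕ // ν.degree ≤ d} := Finsupp.finite_of_degree_le d
  let ev : relationDual k d μ hμ lam M →ₗ[k] ({ν : Fin n →₀ ℕ // ν.degree ≤ d} → M) :=
    { toFun := fun θ ν => θ.1.val ν.1
      map_add' := fun _ _ => rfl
      map_smul' := fun _ _ => rfl }
  refine Module.Finite.of_injective ev fun θ χ h => Subtype.ext (ext_val fun ν => ?_)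
  by_cases hν : ν.degree ≤ d
  · exact congrFun h ⟨ν, hν⟩
  · rw [val_eq_zero θ.2 (not_le.mp hν), val_eq_zero χ.2 (not_le.mp hν)]

theorem isFiniteLength_relationDual [Module.Finite k M] :
    IsFiniteLength (MvPolynomial (Fin n) k) (relationDual k d μ hμ lam M) := by
  have := finite_relationDual k d μ hμ lam M
  rw [isFiniteLength_iff_isNoetherian_isArtinian]
  exact ⟨isNoetherian_of_tower k inferInstance, isArtinian_of_tower k inferInstance⟩

/-- The map on functionals induced by a homomorphism of modules. -/
def relationDualMap (φ : M →ₗ[Λ] N) :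
    relationDual k d μ hμ lam M →ₗ[MvPolynomial (Fin n) k] relationDual k d μ hμ lam N :=
  (postcomp (φ.restrictScalars k)).restrict fun θ hθ => by
    refine ⟨fun ν hν => ?_, ?_⟩
    · rw [val_postcomp, hθ.1 ν hν, map_zero]
    · simp only [val_postcomp, LinearMap.restrictScalars_apply, ← map_smul, ← map_sum, hθ.2,
        map_zero]

theorem val_relationDualMap (φ : M →ₗ[Λ] N) (θ : relationDual k d μ hμ lam M) (ν) :
    (relationDualMap φ θ).1.val ν = φ (θ.1.val ν) := rfl

/-- The functional supported in degree zero. -/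
def constDual (hd : 1 ≤ d) (m : M) : relationDual k d μ hμ lam M := ⟨delta 0 m, delta_zero_mem hd m⟩

theorem val_constDual (hd : 1 ≤ d) (m : M) (ν) :
    (constDual hd m : relationDual k d μ hμ lam M).1.val ν = if ν = 0 then m else 0 :=
  val_delta _ _ _

theorem eq_constDual (hd : 1 ≤ d) {θ : relationDual k d μ hμ lam M}
    (h : ∀ ν, ν ≠ 0 → θ.1.val ν = 0) : θ = constDual hd (θ.1.val 0) := by
  refine Subtype.ext (ext_val fun ν => ?_)
  rw [val_constDual]
  split_ifs with h0
  · rw [h0]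
  · exact h ν h0

theorem smul_eq_constDual (hd : 1 ≤ d) {θ : relationDual k d μ hμ lam M} {ν : Fin n →₀ ℕ}
    (h : ∀ ν', ν.degree < ν'.degree → θ.1.val ν' = 0) :
    (MvPolynomial.monomial ν (1 : k)) • θ = constDual hd (θ.1.val ν) := by
  have h1 : ∀ ν', ((MvPolynomial.monomial ν (1 : k)) • θ).1.val ν' = θ.1.val (ν + ν') :=
    val_monomial_smul ν θ.1
  rw [eq_constDual hd (θ := (MvPolynomial.monomial ν (1 : k)) • θ), h1, add_zero]
  intro ν' hν'
  rw [h1]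
  apply h
  rw [map_add]
  have : ν'.degree ≠ 0 := fun h0 => hν' ((Finsupp.degree_eq_zero_iff ν').mp h0)
  omega

/-- A functional is supported in degree zero exactly when all nonconstant monomials kill it, and
homomorphisms preserve this. -/
theorem map_constDual (hd : 1 ≤ d)
    (a : relationDual k d μ hμ lam M →ₗ[MvPolynomial (Fin n) k] relationDual k d μ hμ lam N)
    (m : M) : a (constDual hd m) = constDual hd ((a (constDual hd m)).1.val 0) := by
  refine eq_constDual hd fun ν hν => ?_
  have h1 : (MvPolynomial.monomial ν (1 : k)) • (constDual hd m : relationDual k d μ hμ lam M) = 0 := by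
    refine Subtype.ext (ext_val fun ν' => ?_)
    refine (val_monomial_smul ν _ ν').trans ?_
    rw [val_constDual, if_neg (by simp [hν])]
    rfl
  have h2 := congrArg (fun θ => θ.1.val 0) (map_smul a (MvPolynomial.monomial ν (1 : k))
    (constDual hd m))
  have h3 : ((MvPolynomial.monomial ν (1 : k)) • a (constDual hd m)).1.val 0 =
    (a (constDual hd m)).1.val (ν + 0) := val_monomial_smul ν _ 0
  simp only [h1, map_zero, h3, add_zero] at h2
  exact h2.symm

/-- The linear map induced on values in degree zero. -/
def socleMap (hd : 1 ≤ d)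
    (a : relationDual k d μ hμ lam M →ₗ[MvPolynomial (Fin n) k] relationDual k d μ hμ lam N) :
    M →ₗ[k] N where
  toFun m := (a (constDual hd m)).1.val 0
  map_add' x y := by
    have : (constDual hd (x + y) : relationDual k d μ hμ lam M) = constDual hd x + constDual hd y :=
      Subtype.ext (ext_val fun ν => by
        change _ = (constDual hd x : relationDual k d μ hμ lam M).1.val ν +
          (constDual hd y : relationDual k d μ hμ lam M).1.val ν
        simp only [val_constDual]
        split_ifs <;> simp)
    rw [this, map_add]
    rfl
  map_smul' c x := by
    have : (constDual hd (c • x) : relationDual k d μ hμ lam M) = c • constDual hd x :=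
      Subtype.ext (ext_val fun ν => by
        change _ = c • (constDual hd x : relationDual k d μ hμ lam M).1.val ν
        simp only [val_constDual]
        split_ifs <;> simp)
    rw [this, LinearMap.map_smul_of_tower]
    rfl

theorem socleMap_apply (hd : 1 ≤ d)
    (a : relationDual k d μ hμ lam M →ₗ[MvPolynomial (Fin n) k] relationDual k d μ hμ lam N)
    (m : M) : socleMap hd a m = (a (constDual hd m)).1.val 0 := rfl

/-- Multiplication by the monomial `ν` moves the value at `ν` to degree zero and commutes with `a`;
so `a` acts on the values of highest degree through `socleMap`. -/
theorem socleMap_val (hd : 1 ≤ d)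
    (a : relationDual k d μ hμ lam M →ₗ[MvPolynomial (Fin n) k] relationDual k d μ hμ lam N)
    (θ : relationDual k d μ hμ lam M) {ν : Fin n →₀ ℕ}
    (h : ∀ ν', ν.degree < ν'.degree → θ.1.val ν' = 0) :
    socleMap hd a (θ.1.val ν) = (a θ).1.val ν := by
  rw [socleMap_apply, ← smul_eq_constDual hd h, map_smul]
  exact (val_monomial_smul ν (a θ).1 0).trans (by rw [add_zero])

variable {i₀ : ι}

/-- Because `lam i₀ = 1`, the defect in the relation can be absorbed into the value at `μ i₀`. -/
theorem sub_delta_mem (hinj : Function.Injective μ) {θ : PolyDual k n M}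
    (hθ : ∀ ν : Fin n →₀ ℕ, d < ν.degree → θ.val ν = 0) (hi₀ : lam i₀ = 1) :
    θ - delta (μ i₀) (∑ i, lam i • θ.val (μ i)) ∈ relationDual k d μ hμ lam M := by
  classical
  refine ⟨fun ν hν => ?_, ?_⟩
  · rw [val_sub, hθ ν hν, val_delta_of_degree_ne (by rw [hμ]; omega), sub_zero]
  · simp only [val_sub, val_delta, hinj.eq_iff, smul_sub, Finset.sum_sub_distrib]
    rw [sub_eq_zero]
    simp [hi₀]

/-- The functional `δ_{μ i}(m) - δ_{μ i₀}(lam i • m)` satisfies the relation, and so does its image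
under `a`, whose values in degree `d` are given by `socleMap`. That relation is the claim. -/
theorem socleMap_smul (hd : 1 ≤ d) (hinj : Function.Injective μ) (hi₀ : lam i₀ = 1)
    (a : relationDual k d μ hμ lam M →ₗ[MvPolynomial (Fin n) k] relationDual k d μ hμ lam N)
    (i : ι) (m : M) : socleMap hd a (lam i • m) = lam i • socleMap hd a m := by
  classical
  have hδ : ∀ ν : Fin n →₀ ℕ, d < ν.degree → (delta (k := k) (μ i) m).val ν = 0 := fun ν hν =>
    val_delta_of_degree_ne (by rw [hμ]; omega)
  have hm := sub_delta_mem (hμ := hμ) hinj hδ hi₀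
  have hsum : ∑ j, lam j • (delta (k := k) (μ i) m).val (μ j) = lam i • m := by
    simp [val_delta, hinj.eq_iff]
  rw [hsum] at hm
  have h1 := (a ⟨_, hm⟩).2.2
  have h2 : ∀ j, (a ⟨_, hm⟩).1.val (μ j) = socleMap hd a (if j = i then m else 0) -
      socleMap hd a (if j = i₀ then lam i • m else 0) := by
    intro j
    rw [← socleMap_val hd a ⟨_, hm⟩ fun ν' hν' => hm.1 ν' (by rwa [hμ] at hν'), ← map_sub]
    simp only [val_sub, val_delta, hinj.eq_iff]
  simp only [h2, smul_sub, Finset.sum_sub_distrib, apply_ite (socleMap hd a), map_zero,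
    smul_ite, smul_zero, Finset.sum_ite_eq', Finset.mem_univ, if_true, hi₀, one_smul] at h1
  exact (sub_eq_zero.mp h1).symm

/-- The homomorphism of `Λ`-modules induced on values in degree zero. -/
def socleHom (hd : 1 ≤ d) (hinj : Function.Injective μ) (hi₀ : lam i₀ = 1)
    (hspan : Submodule.span k (Set.range lam) = ⊤)
    (a : relationDual k d μ hμ lam M →ₗ[MvPolynomial (Fin n) k] relationDual k d μ hμ lam N) :
    M →ₗ[Λ] N where
  toFun := socleMap hd a
  map_add' := map_add _
  map_smul' x m := by
    have hx : x ∈ Submodule.span k (Set.range lam) := hspan ▸ Submodule.mem_top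
    induction hx using Submodule.span_induction with
    | mem x hx =>
      obtain ⟨i, rfl⟩ := hx
      exact socleMap_smul hd hinj hi₀ a i m
    | zero => simp
    | add x y _ _ h1 h2 =>
      rw [RingHom.id_apply] at *
      rw [add_smul, map_add, h1, h2, add_smul]
    | smul c x _ h1 =>
      rw [RingHom.id_apply] at *
      rw [smul_assoc, map_smul, h1, smul_assoc]

/-- For `θ` fixed by `a` the values vanish by descending induction on the degree: once all values of
higher degree are zero, the value at `ν` equals its own image under `socleMap`. -/
theorem eq_zero_of_socleMap_eq_zero (hd : 1 ≤ d)
    {a : relationDual k d μ hμ lam M →ₗ[MvPolynomial (Fin n) k] relationDual k d μ hμ lam M}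
    (ha : ∀ θ, a (a θ) = a θ) (h0 : ∀ m, socleMap hd a m = 0) : a = 0 := by
  have key : ∀ j : ℕ, ∀ θ, a θ = θ → ∀ ν : Fin n →₀ ℕ, d < ν.degree + j → θ.1.val ν = 0 := by
    intro j
    induction j with
    | zero => exact fun θ _ ν hν => val_eq_zero θ.2 hν
    | succ j ih =>
      intro θ hθ ν hν
      rw [← hθ, ← socleMap_val hd a θ fun ν' hν' => ih θ hθ ν' (by omega), h0]
  refine LinearMap.ext fun θ => Subtype.ext (ext_val fun ν => ?_)
  exact key (d + 1) (a θ) (ha θ) ν (by omega)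

theorem exact_relationDualMap {K : Type u} [AddCommGroup K] [Module Λ K] [Module k K]
    [IsScalarTower k Λ K] (hinj : Function.Injective μ) (hi₀ : lam i₀ = 1)
    {φ : M →ₗ[Λ] N} {χ : N →ₗ[Λ] K} (hφ : Function.Injective φ) (hχ : Function.Surjective χ)
    (hφχ : Function.Exact φ χ) :
    Function.Injective (relationDualMap φ : relationDual k d μ hμ lam M →ₗ[_] _) ∧
      Function.Surjective (relationDualMap χ : relationDual k d μ hμ lam N →ₗ[_]
        relationDual k d μ hμ lam K) ∧
      Function.Exact (relationDualMap φ : relationDual k d μ hμ lam M →ₗ[_] _)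
        (relationDualMap χ : relationDual k d μ hμ lam N →ₗ[_] relationDual k d μ hμ lam K) := by
  refine ⟨fun θ θ' h => Subtype.ext (ext_val fun ν => hφ ?_), fun θ => ?_, fun θ => ⟨fun h => ?_, ?_⟩⟩
  · exact congrArg (fun θ => θ.1.val ν) h
  -- The values are lifted by a section linear only over `k`. The correction restoring the relation
  -- dies under `χ`, since `θ` satisfies the relation already.
  · obtain ⟨s, hs⟩ := (χ.restrictScalars k).exists_rightInverse_of_surjective
      (LinearMap.range_eq_top.mpr hχ)
    have hs' : ∀ x, χ (s x) = x := fun x => LinearMap.congr_fun hs x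
    refine ⟨⟨_, sub_delta_mem (θ := postcomp s θ.1) hinj (fun ν hν => ?_) hi₀⟩,
      Subtype.ext (ext_val fun ν => ?_)⟩
    · rw [val_postcomp, val_eq_zero θ.2 hν, map_zero]
    · rw [val_relationDualMap]
      simp only [val_sub, val_delta, val_postcomp, map_sub, hs']
      rw [sub_eq_self, apply_ite χ, map_sum]
      simp only [map_smul, hs', θ.2.2, map_zero, ite_self]
  · have hr : ∀ ν, ∃ x, φ x = θ.1.val ν := fun ν =>
      (hφχ _).mp (congrArg (fun θ => θ.1.val ν) h)
    obtain ⟨r, hr'⟩ := (φ.restrictScalars k).exists_leftInverse_of_injective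
      (LinearMap.ker_eq_bot.mpr hφ)
    have hr'' : ∀ x, r (φ x) = x := fun x => LinearMap.congr_fun hr' x
    have hφr : ∀ ν, φ (r (θ.1.val ν)) = θ.1.val ν := fun ν => by
      obtain ⟨x, hx⟩ := hr ν
      rw [← hx, hr'']
    refine ⟨⟨postcomp r θ.1, fun ν hν => ?_, hφ ?_⟩, Subtype.ext (ext_val fun ν => hφr ν)⟩
    · rw [val_postcomp, val_eq_zero θ.2 hν, map_zero]
    · simp only [map_sum, map_smul, val_postcomp, hφr, θ.2.2, map_zero]
  · rintro ⟨θ', rfl⟩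
    refine Subtype.ext (ext_val fun ν => ?_)
    rw [val_relationDualMap, val_relationDualMap, hφχ.apply_apply_eq_zero]
    rfl

end

section

attribute [local instance] ModuleCat.moduleOfAlgebraModule
  ModuleCat.isScalarTower_of_algebra_moduleCat

variable {k : Type u} [Field k] {n : ℕ} {Λ : Type u} [Ring Λ] [Algebra k Λ] [Module.Finite k Λ]
  {ι : Type} [Fintype ι] {d : ℕ} {μ : ι → Fin n →₀ ℕ}
  (hμ : ∀ i, (μ i).degree = d) (lam : ι → Λ)

/-- The functor sending a module over a finite-dimensional algebra to the functionals on the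
polynomial ring which satisfy a linear relation with coefficients in the algebra. -/
def relationFunctor : (finGen.{u} Λ).FullSubcategory ⥤ (FL k n).FullSubcategory where
  obj M := ⟨ModuleCat.of _ (relationDual k d μ hμ lam M.obj), by
    have : Module.Finite Λ M.obj := M.property
    have : Module.Finite k M.obj := Module.Finite.trans Λ M.obj
    exact isFiniteLength_relationDual (k := k) (Λ := Λ)⟩
  map φ := ObjectProperty.homMk (ModuleCat.ofHom (relationDualMap φ.hom.hom))
  map_id _ := rfl
  map_comp _ _ := rfl

variable {hμ lam} {i₀ : ι}

/-- The map from homomorphisms of spaces of functionals to homomorphisms of modules. -/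
def relationRetraction (hd : 1 ≤ d) (hinj : Function.Injective μ) (hi₀ : lam i₀ = 1)
    (hspan : Submodule.span k (Set.range lam) = ⊤) :
    HomRetraction (relationFunctor (k := k) hμ lam) where
  map _ _ a := ObjectProperty.homMk (ModuleCat.ofHom (socleHom hd hinj hi₀ hspan a.hom.hom))
  map_id M := by
    refine ObjectProperty.hom_ext _ (ModuleCat.hom_ext (LinearMap.ext fun m => ?_))
    exact (val_constDual (k := k) (hμ := hμ) (lam := lam) hd m 0).trans (if_pos rfl)
  map_comp _ _ _ a b := by
    refine ObjectProperty.hom_ext _ (ModuleCat.hom_ext (LinearMap.ext fun m => ?_))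
    exact congrArg (fun θ => (b.hom.hom θ).1.val 0) (map_constDual hd a.hom.hom m)
  map_add _ _ _ _ := rfl
  eq_zero M a ha h0 := by
    refine ObjectProperty.hom_ext _ (ModuleCat.hom_ext ?_)
    refine eq_zero_of_socleMap_eq_zero hd (a := a.hom.hom)
      (fun θ => congrArg (fun a => a.hom.hom θ) ha) fun m => congrArg (fun a => a.hom.hom m) h0

theorem isRepresentationEmbedding_relationFunctor (hd : 1 ≤ d) (hinj : Function.Injective μ)
    (hi₀ : lam i₀ = 1) (hspan : Submodule.span k (Set.range lam) = ⊤) :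
    IsRepresentationEmbedding (relationFunctor (k := k) hμ lam) := by
  refine (relationRetraction hd hinj hi₀ hspan).isRepresentationEmbedding ⟨?_⟩ fun E hE => ?_
  · intro M N φ ψ
    refine ObjectProperty.hom_ext _ (ModuleCat.hom_ext (LinearMap.ext fun θ => ?_))
    exact Subtype.ext (ext_val fun ν => rfl)
  · obtain ⟨k1, k2, k3⟩ := exact_relationDualMap (k := k) (hμ := hμ) hinj hi₀
      hE.moduleCat_injective_f hE.moduleCat_surjective_g
      ((ShortComplex.ShortExact.moduleCat_exact_iff_function_exact _).mp hE.exact)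
    exact ModuleCat.shortComplex_shortExact _ k3 k1 k2

end

/-- Finite-length modules over a polynomial ring in at least two variables are wild. -/
theorem isWild_FL (k : Type u) [Field k] {n : ℕ} (hn : 2 ≤ n) : IsWild k (FL k n) := by
  intro Λ _ _ _
  let b := Module.finBasis k Λ
  let r := Module.finrank k Λ
  let j₀ : Fin n := ⟨0, by omega⟩
  let j₁ : Fin n := ⟨1, by omega⟩
  have hj : j₀ ≠ j₁ := by simp [j₀, j₁]
  -- Two variables supply enough monomials of equal degree, one for `1` and one for each basis
  -- element. Degree `r + 1` instead of `r` keeps it positive when `Λ = 0`.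
  let μ : Fin (r + 1) → Fin n →₀ ℕ := fun i =>
    Finsupp.single j₀ (r + 1 - i) + Finsupp.single j₁ (i : ℕ)
  have hμ : ∀ i, (μ i).degree = r + 1 := fun i => by
    simp only [μ, map_add, Finsupp.degree_single]
    omega
  have hinj : Function.Injective μ := fun i i' h => by
    have := DFunLike.congr_fun h j₁
    simp [μ, hj] at this
    exact Fin.ext this
  refine ⟨relationFunctor hμ (Fin.cons 1 b : Fin (r + 1) → Λ),
    isRepresentationEmbedding_relationFunctor (i₀ := 0) (by omega) hinj rfl ?_⟩
  rw [eq_top_iff, ← b.span_eq]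
  refine Submodule.span_mono ?_
  rintro _ ⟨i, rfl⟩
  exact ⟨i.succ, rfl⟩

end

end WildHypersurface

/-! ### Primes generated by variables and general coordinates -/

namespace MvPowerSeries

variable {σ : Type*} {A : Type*} [CommRing A]

theorem mem_ker_killCompl_iff (T : Finset σ) (p : MvPowerSeries σ A) :
    p ∈ RingHom.ker (killCompl (R := A) (Function.Embedding.subtype (· ∉ T))) ↔
      ∀ m : σ →₀ ℕ, (∀ j ∈ T, m j = 0) → coeff m p = 0 := by
  rw [RingHom.mem_ker]
  constructor
  · intro h m hm
    have hsupp : (m.support : Set σ) ⊆ Set.range (Function.Embedding.subtype (· ∉ T)) := by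
      intro j hj
      exact ⟨⟨j, fun hjT => Finsupp.mem_support_iff.mp hj (hm j hjT)⟩, rfl⟩
    rw [← Finsupp.embDomain_comapDomain hsupp, ← coeff_killCompl, h, map_zero]
  · intro h
    ext m
    rw [coeff_killCompl, map_zero]
    refine h _ fun j hj => Finsupp.embDomain_of_notMem_range _ _ _ ?_
    rintro ⟨⟨i, hi⟩, rfl⟩
    exact hi hj

/-- If setting the variables of `T` to zero kills a series, each of its monomials involves one of
them, and `eq_sum_X_mul_firstVarQuotient` applies. Primality follows because the target of the
substitution is a domain when `A` is. -/
theorem span_X_eq_ker [LinearOrder σ] (T : Finset σ) :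
    Ideal.span (X '' (T : Set σ)) =
      RingHom.ker (killCompl (R := A) (Function.Embedding.subtype (· ∉ T))) := by
  apply le_antisymm
  · rw [Ideal.span_le]
    rintro _ ⟨j, hj, rfl⟩
    refine killCompl_X_eq_zero ?_
    rintro ⟨⟨i, hi⟩, rfl⟩
    exact hi hj
  · intro p hp
    rw [eq_sum_X_mul_firstVarQuotient T p ((mem_ker_killCompl_iff T p).mp hp)]
    exact Ideal.sum_mem _ fun j hj => Ideal.mul_mem_right _ _
      (Ideal.subset_span (Set.mem_image_of_mem X hj))

theorem isPrime_span_X [LinearOrder σ] [IsDomain A] (T : Finset σ) :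
    (Ideal.span (X '' (T : Set σ)) : Ideal (MvPowerSeries σ A)).IsPrime := by
  rw [span_X_eq_ker]
  have : IsDomain (MvPowerSeries {x // x ∉ T} A) := NoZeroDivisors.to_isDomain _
  exact RingHom.ker_isPrime _

theorem mem_of_X_mem_span_X [LinearOrder σ] [Nontrivial A] {T : Finset σ} {s : σ}
    (h : X s ∈ (Ideal.span (X '' (T : Set σ)) : Ideal (MvPowerSeries σ A))) : s ∈ T := by
  classical
  by_contra hs
  rw [span_X_eq_ker, mem_ker_killCompl_iff] at h
  have := h (Finsupp.single s 1) fun j hj => by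
    rw [Finsupp.single_apply, if_neg]
    rintro rfl
    exact hs hj
  rw [coeff_X, if_pos rfl] at this
  exact one_ne_zero this

theorem ofList_map_X (L : List σ) [DecidableEq σ] :
    (Ideal.ofList (L.map X) : Ideal (MvPowerSeries σ A)) =
      Ideal.span (X '' (L.toFinset : Set σ)) := by
  rw [Ideal.ofList]
  congr 1
  ext p
  simp

section Shear

variable [Finite σ] (t : σ) (e : σ → A)

theorem hasSubst_shear : HasSubst (fun s => X s + C (e s) * X t : σ → MvPowerSeries σ A) :=
  hasSubst_of_constantCoeff_zero fun s => by simp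

/-- The substitution adding multiples of one variable to the others. -/
noncomputable def shear : MvPowerSeries σ A →ₐ[A] MvPowerSeries σ A :=
  substAlgHom (hasSubst_shear t e)

variable {t e}

theorem shear_X (s : σ) : shear t e (X s) = X s + C (e s) * X t :=
  substAlgHom_X (hasSubst_shear t e) s

theorem shear_C (a : A) : shear t e (C a) = C a :=
  (shear t e).commutes a

/-- Since `e t = 0` the variable `X t` stays fixed, so the added multiples of it cancel. -/
theorem shear_shear (he : e t = 0) (p : MvPowerSeries σ A) : shear t e (shear t (-e) p) = p := by
  have : (fun s => subst (fun s => X s + C (e s) * X t : σ → MvPowerSeries σ A)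
      (X s + C ((-e) s) * X t)) = X := by
    funext s
    have h := map_add (shear t e) (X s) (C ((-e) s) * X t)
    rw [map_mul, shear_X, shear_X, shear_C, he, map_zero, zero_mul, add_zero] at h
    have h' : X s + C (e s) * X t + C ((-e) s) * X t = (X s : MvPowerSeries σ A) := by
      rw [Pi.neg_apply, map_neg]
      ring
    rw [h', shear, coe_substAlgHom] at h
    exact h
  have h := subst_comp_subst_apply (R := A) (hasSubst_shear t (-e)) (hasSubst_shear t e) p
  rw [this, subst_self, id] at h
  rw [shear, shear, coe_substAlgHom, coe_substAlgHom, h]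

/-- The substitution adding multiples of one variable to the others, as an automorphism. -/
noncomputable def shearEquiv (he : e t = 0) : MvPowerSeries σ A ≃+* MvPowerSeries σ A :=
  RingEquiv.ofRingHom (shear t e : MvPowerSeries σ A →+* _) (shear t (-e))
    (RingHom.ext fun p => shear_shear he p)
    (RingHom.ext fun p => by
      have := shear_shear (e := -e) (t := t) (by simp [he]) p
      rwa [neg_neg] at this)

end Shear

theorem isPrime_ofList_map [LinearOrder σ] [IsDomain A]
    (τ : MvPowerSeries σ A ≃+* MvPowerSeries σ A) (L : List σ) :
    (Ideal.ofList (L.map fun s => τ (X s))).IsPrime := by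
  have h : Ideal.ofList (L.map fun s => τ (X s)) =
      (Ideal.ofList (L.map X)).map (τ : MvPowerSeries σ A →+* MvPowerSeries σ A) := by
    rw [Ideal.map_ofList, List.map_map]
    rfl
  have := isPrime_span_X (A := A) L.toFinset
  rw [h, ofList_map_X]
  exact Ideal.map_isPrime_of_equiv τ

theorem mem_of_apply_X_mem_ofList [LinearOrder σ] [Nontrivial A]
    (τ : MvPowerSeries σ A ≃+* MvPowerSeries σ A) {L : List σ} {s : σ}
    (hs : τ (X s) ∈ Ideal.ofList (L.map fun s => τ (X s))) : s ∈ L := by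
  have h : Ideal.ofList (L.map fun s => τ (X s)) =
      (Ideal.ofList (L.map X)).map (τ : MvPowerSeries σ A →+* MvPowerSeries σ A) := by
    rw [Ideal.map_ofList, List.map_map]
    rfl
  rw [h] at hs
  have h2 := (Ideal.mem_map_iff_of_surjective (τ : MvPowerSeries σ A →+* MvPowerSeries σ A)
    τ.surjective).mp hs
  obtain ⟨p, hp, hp'⟩ := h2
  rw [τ.injective hp', ofList_map_X] at hp
  exact List.mem_toFinset.mp (mem_of_X_mem_span_X hp)

/-- A nonzero power series over an infinite domain does not vanish on a general line. -/
theorem exists_subst_line_ne_zero [Finite σ] [Infinite A] [IsDomain A] (t : σ)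
    {f : MvPowerSeries σ A} (hf : f ≠ 0) :
    ∃ c : σ → A, c t ≠ 0 ∧
      subst (fun s => C (c s) * X t : σ → MvPowerSeries σ A) f ≠ 0 := by
  classical
  have := Fintype.ofFinite σ
  obtain ⟨m₀, hm₀⟩ : ∃ m, coeff m f ≠ 0 := by
    by_contra! h
    exact hf (MvPowerSeries.ext h)
  have hfin : {m : σ →₀ ℕ | m.degree = m₀.degree}.Finite :=
    (Finsupp.finite_of_degree_le m₀.degree).subset fun m hm => le_of_eq hm
  -- A nonzero homogeneous component of `f`: its value at `c` is the coefficient of the same degree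
  -- in the restriction of `f` to the line spanned by `c`.
  let P : MvPolynomial σ A := ∑ m ∈ hfin.toFinset, MvPolynomial.monomial m (coeff m f)
  have hP : P ≠ 0 := by
    intro h
    have h1 := congrArg (MvPolynomial.coeff m₀) h
    simp only [P, MvPolynomial.coeff_sum, MvPolynomial.coeff_monomial, MvPolynomial.coeff_zero] at h1
    rw [Finset.sum_ite_eq', if_pos (by simp)] at h1
    exact hm₀ h1
  -- The factor `X t` forces `c t ≠ 0` at the same time.
  obtain ⟨c, hc⟩ : ∃ c, MvPolynomial.eval c (P * MvPolynomial.X t) ≠ 0 := by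
    by_contra! h
    exact mul_ne_zero hP (MvPolynomial.X_ne_zero t)
      (MvPolynomial.funext fun c => (h c).trans (map_zero _).symm)
  rw [map_mul, MvPolynomial.eval_X] at hc
  refine ⟨c, right_ne_zero_of_mul hc, fun h0 => left_ne_zero_of_mul hc ?_⟩
  have ha : HasSubst (fun s => C (c s) * X t : σ → MvPowerSeries σ A) :=
    hasSubst_of_constantCoeff_zero fun s => by simp
  have h1 := congrArg (coeff (Finsupp.single t m₀.degree)) h0
  have h2 : ∀ m : σ →₀ ℕ, (m.prod fun s j => (C (c s) * X t : MvPowerSeries σ A) ^ j) =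
      monomial (Finsupp.single t m.degree) (m.prod fun s j => c s ^ j) := by
    intro m
    simp only [mul_pow, Finsupp.prod, Finset.prod_mul_distrib, Finset.prod_pow_eq_pow_sum]
    rw [X_pow_eq, ← Finsupp.degree_apply]
    have h3 : ∏ s ∈ m.support, (C (c s) : MvPowerSeries σ A) ^ m s =
        C (∏ s ∈ m.support, c s ^ m s) := by simp only [map_prod, map_pow]
    rw [h3]
    ext m'
    rw [coeff_C_mul, coeff_monomial, coeff_monomial, mul_ite, mul_one, mul_zero]
  rw [coeff_subst ha, map_zero] at h1
  rw [← h1, map_sum]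
  rw [finsum_eq_sum_of_support_subset (s := hfin.toFinset)]
  · refine Finset.sum_congr rfl fun m hm => ?_
    rw [MvPolynomial.eval_monomial, h2, coeff_monomial, if_pos, smul_eq_mul]
    rw [(by simpa using hm : m.degree = m₀.degree)]
  · intro m hm
    rw [Function.mem_support, h2, coeff_monomial] at hm
    by_contra hne
    refine hm ?_
    rw [if_neg, smul_zero]
    intro h
    exact hne (by simpa using (Finsupp.single_injective t h).symm)

end MvPowerSeries

/-! ### Depth, dimension and the MCM property -/

namespace WildHypersurface

universe u

open RingTheory.Sequence

section

variable {S : Type*} [CommRing S] {κ : Type*} [Fintype κ] [DecidableEq κ] {f : S}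
  {Φ Ψ : Matrix κ κ S}

theorem mem_ideal_smul_top_pi (I : Ideal S) (v : κ → S) :
    v ∈ I • (⊤ : Submodule S (κ → S)) ↔ ∀ j, v j ∈ I := by
  constructor
  · intro h
    induction h using Submodule.smul_induction_on' with
    | smul r hr v _ => exact fun j => Ideal.mul_mem_right _ _ hr
    | add x _ y _ hx hy => exact fun j => I.add_mem (hx j) (hy j)
  · intro h
    rw [← Finset.univ_sum_single v]
    refine Submodule.sum_mem _ fun j _ => ?_
    have : (Pi.single j (v j) : κ → S) = v j • Pi.single j 1 := by
      rw [← Pi.single_smul, smul_eq_mul, mul_one]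
    rw [this]
    exact Submodule.smul_mem_smul (h j) Submodule.mem_top

omit [DecidableEq κ] in
theorem mulVec_mem {I : Ideal S} (Θ : Matrix κ κ S) {v : κ → S} (hv : ∀ j, v j ∈ I) (j : κ) :
    Θ.mulVec v j ∈ I :=
  Ideal.sum_mem _ fun i _ => Ideal.mul_mem_left _ _ (hv i)

/-- Applying `Ψ` to `r v ≡ Φ w` gives `r Ψ v ≡ f w` modulo `I`, so the prime `I + (r)` contains `w`
and `w ≡ r w'`. Cancelling `r` leaves `Ψ v ≡ f w'`; applying `Φ` and cancelling `f` leaves `v ≡ Φ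
w'`. -/
theorem IsMatrixFactorization.exists_sub_mem (mf : IsMatrixFactorization f Φ Ψ) {I : Ideal S}
    {r : S} [I.IsPrime] (hIr : (I ⊔ Ideal.span {r}).IsPrime) (hr : r ∉ I)
    (hf : f ∉ I ⊔ Ideal.span {r}) {v w : κ → S} (h : ∀ j, (r • v - Φ.mulVec w) j ∈ I) :
    ∃ w', ∀ j, (v - Φ.mulVec w') j ∈ I := by
  have hI : I.IsPrime := inferInstance
  have hfI : f ∉ I := fun h => hf (Ideal.mem_sup_left h)
  have hΨΦ : ∀ u, Ψ.mulVec (Φ.mulVec u) = f • u := fun u => by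
    rw [Matrix.mulVec_mulVec, mf.2, Matrix.smul_mulVec, Matrix.one_mulVec]
  have hΦΨ : ∀ u, Φ.mulVec (Ψ.mulVec u) = f • u := fun u => by
    rw [Matrix.mulVec_mulVec, mf.1, Matrix.smul_mulVec, Matrix.one_mulVec]
  have h1 : ∀ j, r * Ψ.mulVec v j - f * w j ∈ I := fun j => by
    have := mulVec_mem Ψ h j
    rwa [Matrix.mulVec_sub, Matrix.mulVec_smul, hΨΦ] at this
  have h2 : ∀ j, ∃ a, w j - r * a ∈ I := fun j => by
    have h3 : f * w j ∈ I ⊔ Ideal.span {r} := by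
      rw [← sub_sub_cancel (r * Ψ.mulVec v j) (f * w j)]
      exact sub_mem (Ideal.mem_sup_right (Ideal.mul_mem_right _ _ (Ideal.mem_span_singleton_self r)))
        (Ideal.mem_sup_left (h1 j))
    obtain ⟨y, hy, z, hz, e⟩ := Submodule.mem_sup.mp ((hIr.mem_or_mem h3).resolve_left hf)
    obtain ⟨a, rfl⟩ := Ideal.mem_span_singleton.mp hz
    exact ⟨a, by rwa [← e, add_sub_cancel_right]⟩
  choose w' hw' using h2
  refine ⟨w', ?_⟩
  have h3 : ∀ j, (Ψ.mulVec v - f • w') j ∈ I := fun j => by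
    refine (hI.mem_or_mem ?_).resolve_left hr
    have := I.add_mem (h1 j) (I.mul_mem_left f (hw' j))
    convert this using 1
    simp only [Pi.sub_apply, Pi.smul_apply, smul_eq_mul]
    ring
  intro j
  refine (hI.mem_or_mem ?_).resolve_left hfI
  have := mulVec_mem Φ h3 j
  rwa [Matrix.mulVec_sub, hΦΨ, Matrix.mulVec_smul, ← smul_sub] at this

/-- A list whose initial segments generate prime ideals, avoiding the next element and `f`, is
weakly regular on the cokernel of a matrix factorization of `f`. -/
theorem IsMatrixFactorization.isWeaklyRegular (mf : IsMatrixFactorization f Φ Ψ) {M : Type*}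
    [AddCommGroup M] [Module S M] {π : (κ → S) →ₗ[S] M} (hπ : Function.Surjective π)
    (hker : ∀ v, π v = 0 ↔ ∃ w, v = Φ.mulVec w) {rs : List S}
    (hprime : ∀ i, (Ideal.ofList (rs.take i)).IsPrime)
    (hrs : ∀ i (hi : i < rs.length), rs[i] ∉ Ideal.ofList (rs.take i))
    (hf : f ∉ Ideal.ofList rs) : IsWeaklyRegular M rs := by
  have key : ∀ (I : Ideal S) (v : κ → S),
      π v ∈ I • (⊤ : Submodule S M) ↔ ∃ w, ∀ j, (v - Φ.mulVec w) j ∈ I := by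
    intro I v
    rw [← LinearMap.range_eq_top.mpr hπ, LinearMap.range_eq_map, ← Submodule.map_smul'']
    constructor
    · rintro ⟨u, hu, e⟩
      obtain ⟨w, hw⟩ := (hker (v - u)).mp (by rw [map_sub, e, sub_self])
      refine ⟨w, fun j => ?_⟩
      rw [← hw, sub_sub_cancel]
      exact (mem_ideal_smul_top_pi I u).mp hu j
    · rintro ⟨w, hw⟩
      refine ⟨v - Φ.mulVec w, (mem_ideal_smul_top_pi I _).mpr hw, ?_⟩
      rw [map_sub, (hker (Φ.mulVec w)).mpr ⟨w, rfl⟩, sub_zero]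
  refine ⟨fun i hi => (isSMulRegular_quotient_iff_mem_of_smul_mem _ _).mpr fun x hx => ?_⟩
  obtain ⟨v, rfl⟩ := hπ x
  rw [← map_smul, key] at hx
  obtain ⟨w, hw⟩ := hx
  have := hprime i
  have hsucc : Ideal.ofList (rs.take i) ⊔ Ideal.span {rs[i]} = Ideal.ofList (rs.take (i + 1)) := by
    rw [List.take_succ_eq_append_getElem hi, Ideal.ofList_append, Ideal.ofList_singleton]
  refine (key _ _).mpr (mf.exists_sub_mem (hsucc ▸ hprime (i + 1)) (hrs i hi) ?_ hw)
  rw [hsucc]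
  exact fun h => hf (Ideal.span_mono (fun x hx => List.mem_of_mem_take hx) h)

end

/-- Each term of a regular sequence lowers the dimension of the support by one, and the support has
dimension at most that of `R`. -/
theorem depth_le_ringKrullDim (R : Type u) [CommRing R] [IsLocalRing R] [IsNoetherianRing R]
    (M : Type*) [AddCommGroup M] [Module R M] [Module.Finite R M] :
    Nontrivial M → ((depth R M : ℕ∞) : WithBot ℕ∞) ≤ ringKrullDim R := by
  intro hM
  obtain ⟨d, hd⟩ := WithBot.ne_bot_iff_exists.mp (ringKrullDim_ne_bot (R := R))
  rw [← hd, WithBot.coe_le_coe]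
  refine iSup₂_le fun rs hrs => ?_
  rw [← WithBot.coe_le_coe, hd]
  refine le_trans ?_ (Module.supportDim_le_ringKrullDim R M)
  rw [← Module.supportDim_add_length_eq_supportDim_of_isRegular rs hrs.2]
  have := Submodule.Quotient.nontrivial_iff.mpr hrs.2.top_ne_smul.symm
  obtain ⟨e, he⟩ := WithBot.ne_bot_iff_exists.mp (Module.supportDim_ne_bot_of_nontrivial R
    (M ⧸ Ideal.ofList rs • (⊤ : Submodule R M)))
  rw [← he]
  change ((rs.length : ℕ∞) : WithBot ℕ∞) ≤ ((e + rs.length : ℕ∞) : WithBot ℕ∞)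
  exact WithBot.coe_le_coe.mpr le_add_self

/-- Two elements, the second outside a prime ideal which generates the maximal ideal together with
one further element, leave only the maximal ideal. -/
theorem eq_maximalIdeal_of_isPrime {S : Type*} [CommRing S] [IsLocalRing S] [IsNoetherianRing S]
    {I P : Ideal S} [P.IsPrime] {z f : S} (hz : z ∈ IsLocalRing.maximalIdeal S) (hI : IsLocalRing.maximalIdeal S ≤ I ⊔ Ideal.span {z})
    (hIP : I ≤ P) (hfP : f ∈ P) (hfI : f ∉ I) : P = IsLocalRing.maximalIdeal S := by
  have hP : P ≤ IsLocalRing.maximalIdeal S := IsLocalRing.le_maximalIdeal (Ideal.IsPrime.ne_top ‹_›)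
  by_cases hzP : z ∈ P
  · exact le_antisymm hP (hI.trans (sup_le hIP ((Ideal.span_singleton_le_iff_mem P).mpr hzP)))
  · exfalso
    -- If `z ∉ P`, then `p = y + z q` in `P` with `y ∈ I` forces `q ∈ P`. By Nakayama `P`, and with
    -- it `f`, would lie in `I`.
    have key : P ≤ I ⊔ IsLocalRing.maximalIdeal S • P := by
      intro p hp
      obtain ⟨y, hy, w, hw, e⟩ := Submodule.mem_sup.mp (hI (hP hp))
      obtain ⟨q, rfl⟩ := Ideal.mem_span_singleton.mp hw
      have hq : z * q ∈ P := by
        rw [← e] at hp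
        exact (Ideal.add_mem_iff_right P (hIP hy)).mp hp
      have hqP := (Ideal.IsPrime.mem_or_mem ‹_› hq).resolve_left hzP
      rw [← e]
      exact Submodule.add_mem_sup hy (Submodule.smul_mem_smul hz hqP)
    exact hfI (Submodule.le_of_le_smul_of_le_jacobson_bot (IsNoetherian.noetherian P)
      (IsLocalRing.maximalIdeal_le_jacobson _) key hfP)

section

variable {k : Type u} [Field k] [Infinite k] {n : ℕ} {f : PS k n}

omit [Infinite k] in
theorem mem_maximalIdeal_iff_constantCoeff (p : PS k n) :
    p ∈ IsLocalRing.maximalIdeal (PS k n) ↔ MvPowerSeries.constantCoeff p = 0 := by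
  rw [IsLocalRing.mem_maximalIdeal, mem_nonunits_iff, MvPowerSeries.isUnit_iff_constantCoeff,
    isUnit_iff_ne_zero, not_not]

/-- In general coordinates the variables but the last form a sequence as needed for computing
depths of cokernels. -/
theorem exists_parameters (hf : f ≠ 0) : ∃ rs : List (PS k n), rs.length = n ∧
    (∀ r ∈ rs, MvPowerSeries.constantCoeff r = 0) ∧
    (∀ i, (Ideal.ofList (rs.take i)).IsPrime) ∧
    (∀ i (hi : i < rs.length), rs[i] ∉ Ideal.ofList (rs.take i)) ∧
    f ∉ Ideal.ofList rs ∧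
    IsLocalRing.maximalIdeal (PS k n) ≤ Ideal.ofList rs ⊔ Ideal.span {zVar k n} := by
  obtain ⟨c, hc, hcf⟩ := MvPowerSeries.exists_subst_line_ne_zero (Fin.last n) hf
  -- The sheared variables, other than the last, vanish on the line spanned by `c`. As `f` does not,
  -- it is outside their ideal.
  let e : Fin (n + 1) → k := fun s => if s = Fin.last n then 0 else -(c s / c (Fin.last n))
  have he : e (Fin.last n) = 0 := if_pos rfl
  let τ := MvPowerSeries.shearEquiv he
  have hτ : ∀ s, τ (MvPowerSeries.X s) =
      MvPowerSeries.X s + MvPowerSeries.C (e s) * MvPowerSeries.X (Fin.last n) :=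
    MvPowerSeries.shear_X
  let L : List (Fin (n + 1)) := List.ofFn Fin.castSucc
  have hL : L.Nodup := List.nodup_ofFn.mpr (Fin.castSucc_injective n)
  refine ⟨L.map fun s => τ (MvPowerSeries.X s), by simp [L], ?_, ?_, ?_, ?_, ?_⟩
  · intro r hr
    obtain ⟨s, _, rfl⟩ := List.mem_map.mp hr
    simp [hτ]
  · intro i
    rw [← List.map_take]
    exact MvPowerSeries.isPrime_ofList_map τ _
  · intro i hi h
    rw [← List.map_take, List.getElem_map] at h
    have h1 := MvPowerSeries.mem_of_apply_X_mem_ofList τ h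
    obtain ⟨j, hj, e⟩ := List.mem_take_iff_getElem.mp h1
    have := (hL.getElem_inj_iff).mp e
    omega
  · intro h
    have ha : MvPowerSeries.HasSubst (fun s => MvPowerSeries.C (c s) *
        MvPowerSeries.X (Fin.last n) : Fin (n + 1) → PS k n) :=
      MvPowerSeries.hasSubst_of_constantCoeff_zero fun s => by simp
    have hle : Ideal.ofList (L.map fun s => τ (MvPowerSeries.X s)) ≤
        RingHom.ker (MvPowerSeries.substAlgHom (R := k) ha) := by
      refine Ideal.span_le.mpr fun r hr => ?_
      obtain ⟨s, hs, rfl⟩ := List.mem_map.mp hr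
      obtain ⟨i, rfl⟩ := (List.mem_ofFn' _ _).mp hs
      have hC : ∀ a : k, MvPowerSeries.substAlgHom (R := k) ha (MvPowerSeries.C a) =
        MvPowerSeries.C a := fun a => (MvPowerSeries.substAlgHom (R := k) ha).commutes a
      have h0 : c i.castSucc + e i.castSucc * c (Fin.last n) = 0 := by
        simp only [e, if_neg (Fin.castSucc_ne_last i)]
        field_simp
        ring
      rw [SetLike.mem_coe, RingHom.mem_ker, hτ, map_add, map_mul, hC,
        MvPowerSeries.substAlgHom_X, MvPowerSeries.substAlgHom_X, ← mul_assoc, ← map_mul, ← add_mul,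
        ← map_add, h0, map_zero, zero_mul]
    refine hcf ?_
    rw [← MvPowerSeries.coe_substAlgHom ha]
    exact hle h
  · intro p hp
    have hp0 := (mem_maximalIdeal_iff_constantCoeff p).mp hp
    rw [MvPowerSeries.eq_sum_X_mul_firstVarQuotient Finset.univ p fun m hm => by
      obtain rfl : m = 0 := Finsupp.ext fun j => hm j (Finset.mem_univ j)
      exact hp0]
    refine Ideal.sum_mem _ fun s _ => Ideal.mul_mem_right _ _ ?_
    have hz : zVar k n ∈ Ideal.ofList (L.map fun s => τ (MvPowerSeries.X s)) ⊔
      Ideal.span {zVar k n} := Ideal.mem_sup_right (Ideal.mem_span_singleton_self _)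
    induction s using Fin.lastCases with
    | last => exact hz
    | cast i =>
      rw [← Ideal.add_mem_iff_left _ (Ideal.mul_mem_left _ (MvPowerSeries.C (e i.castSucc)) hz)]
      refine Ideal.mem_sup_left (Ideal.subset_span (List.mem_map.mpr
        ⟨i.castSucc, (List.mem_ofFn' _ _).mpr ⟨i, rfl⟩, hτ _⟩))

theorem apply_mem_maximalIdeal {S S' : Type*} [CommRing S] [IsLocalRing S] [CommRing S']
    [IsLocalRing S'] {q : S →+* S'} (hq : Function.Surjective q) {x : S}
    (hx : x ∈ IsLocalRing.maximalIdeal S) : q x ∈ IsLocalRing.maximalIdeal S' := by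
  have : (Ideal.comap q (IsLocalRing.maximalIdeal S')).IsMaximal :=
    Ideal.comap_isMaximal_of_surjective q hq
  rw [← IsLocalRing.eq_maximalIdeal this] at hx
  exact hx

/-- Modulo `rs` every prime of `S / (f)` is maximal by `eq_maximalIdeal_of_isPrime`, and dividing
out one element of the maximal ideal lowers the dimension by at most one. -/
theorem ringKrullDim_quotient_le {S : Type*} [CommRing S] [IsLocalRing S] [IsNoetherianRing S]
    {f z : S} [IsLocalRing (S ⧸ Ideal.span {f})] {rs : List S}
    (hrs : ∀ r ∈ rs, r ∈ IsLocalRing.maximalIdeal S) (hz : z ∈ IsLocalRing.maximalIdeal S)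
    (hmax : IsLocalRing.maximalIdeal S ≤ Ideal.ofList rs ⊔ Ideal.span {z})
    (hf : f ∉ Ideal.ofList rs) : ringKrullDim (S ⧸ Ideal.span {f}) ≤ rs.length := by
  classical
  let q := Ideal.Quotient.mk (Ideal.span {f})
  let T : Finset (S ⧸ Ideal.span {f}) := (rs.map q).toFinset
  have hT : (↑T : Set (S ⧸ Ideal.span {f})) ⊆
      (Ring.jacobson (S ⧸ Ideal.span {f}) : Set (S ⧸ Ideal.span {f})) := by
    rw [IsLocalRing.ringJacobson_eq_maximalIdeal]
    intro x hx
    obtain ⟨r, hr, rfl⟩ := List.mem_map.mp (List.mem_toFinset.mp hx)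
    exact apply_mem_maximalIdeal Ideal.Quotient.mk_surjective (hrs r hr)
  refine (ringKrullDim_le_ringKrullDim_quotient_add_card T hT).trans ?_
  have h0 : ringKrullDim ((S ⧸ Ideal.span {f}) ⧸ Ideal.span (T : Set (S ⧸ Ideal.span {f}))) ≤ 0 := by
    refine Ring.krullDimLE_iff.mp (Ring.krullDimLE_zero_iff.mpr fun P hP => ?_)
    let p := (Ideal.Quotient.mk (Ideal.span (T : Set (S ⧸ Ideal.span {f})))).comp q
    have hp : Function.Surjective p :=
      Ideal.Quotient.mk_surjective.comp Ideal.Quotient.mk_surjective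
    have hfP : f ∈ P.comap p := by
      have : q f = 0 := Ideal.Quotient.eq_zero_iff_mem.mpr (Ideal.mem_span_singleton_self f)
      rw [Ideal.mem_comap, RingHom.comp_apply, this, map_zero]
      exact P.zero_mem
    have hrsP : Ideal.ofList rs ≤ P.comap p := by
      refine Ideal.span_le.mpr fun r hr => ?_
      have : q r ∈ Ideal.span (T : Set (S ⧸ Ideal.span {f})) :=
        Ideal.subset_span (List.mem_toFinset.mpr (List.mem_map_of_mem hr))
      rw [SetLike.mem_coe, Ideal.mem_comap, RingHom.comp_apply,
        Ideal.Quotient.eq_zero_iff_mem.mpr this]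
      exact P.zero_mem
    have hmaxP := eq_maximalIdeal_of_isPrime hz hmax hrsP hfP hf
    have := IsLocalRing.maximalIdeal.isMaximal S
    rw [← hmaxP] at this
    have h1 := Ideal.map_eq_top_or_isMaximal_of_surjective p hp this
    rw [Ideal.map_comap_of_surjective p hp] at h1
    exact h1.resolve_left hP.ne_top
  have hcard : T.card ≤ rs.length := (List.toFinset_card_le _).trans_eq (List.length_map _)
  calc _ ≤ (0 : WithBot ℕ∞) + (T.card : WithBot ℕ∞) := by gcongr
    _ ≤ rs.length := by
      rw [zero_add]
      exact_mod_cast hcard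

/-- For a nonzero cokernel, the parameters of `exists_parameters` give `dim R ≤ n ≤ depth`, and
depth never exceeds the dimension. -/
theorem isMCM_cok (hf : f ≠ 0) [IsLocalRing (Hypersurface f)] {κ : Type*} [Fintype κ]
    [DecidableEq κ] {Φ Ψ : Matrix κ κ (PS k n)} (mf : IsMatrixFactorization f Φ Ψ) :
    IsMCM (Hypersurface f) (Cok f Φ) := by
  refine ⟨inferInstance, ?_⟩
  rcases subsingleton_or_nontrivial (Cok f Φ) with h | h
  · exact Or.inl h
  right
  obtain ⟨rs, hlen, h0, hprime, hmem, hfrs, hmax⟩ := exists_parameters hf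
  have hrs : ∀ r ∈ rs, r ∈ IsLocalRing.maximalIdeal (PS k n) := fun r hr => by
    rw [mem_maximalIdeal_iff_constantCoeff, h0 r hr]
  have hreg := (isWeaklyRegular_map_algebraMap_iff (S := Hypersurface f) (M := Cok f Φ) rs).mpr
    (mf.isWeaklyRegular cokMk_surjective (cokMk_eq_zero_iff mf) hprime hmem hfrs)
  have hmem' : ∀ r ∈ rs.map (algebraMap (PS k n) (Hypersurface f)),
      r ∈ IsLocalRing.maximalIdeal (Hypersurface f) := by
    intro _ hr'
    obtain ⟨r, hr, rfl⟩ := List.mem_map.mp hr'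
    exact apply_mem_maximalIdeal Ideal.Quotient.mk_surjective (hrs r hr)
  refine le_antisymm (depth_le_ringKrullDim _ _ h) ?_
  refine (ringKrullDim_quotient_le hrs
    ((mem_maximalIdeal_iff_constantCoeff _).mpr (MvPowerSeries.constantCoeff_X _)) hmax hfrs).trans ?_
  refine WithBot.coe_le_coe.mpr (le_iSup₂_of_le (rs.map (algebraMap (PS k n) (Hypersurface f)))
    ⟨hmem', IsRegular.of_isWeaklyRegular_of_mem_maximalIdeal _ hmem' hreg⟩ ?_)
  rw [List.length_map]

end

end WildHypersurface

theorem theorem2p6 {k : Type*} [Field k] [Infinite k] (n : ℕ) (f : PS k n) (hf0 : f ≠ 0)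
    (hf : 4 ≤ f.order) :
    haveI : IsLocalRing (Hypersurface f) := isLocalRing_hypersurface hf
    (∃ h g, IsExpression f h g) ∧
    (∀ h g, IsExpression f h g →
      (∀ (m : ℕ) (A : Fin n → Matrix (Fin m) (Fin m) k), (∀ i j, A i * A j = A j * A i) →
        IsMatrixFactorization f (inflatedPhi h g A) (inflatedPsi h g A)) ∧
      ∀ b : BasisChoice k n,
        ∃ hMCM : ∀ M, mcm (Hypersurface f) ((inflationFunctor b f h g).obj M),
          IsRepresentationEmbedding ((mcm (Hypersurface f)).lift (inflationFunctor b f h g) hMCM)) ∧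
    (2 ≤ n → HasWildCMType k (Hypersurface f)) := by
  have hloc : IsLocalRing (Hypersurface f) := isLocalRing_hypersurface hf
  have hMCM : ∀ h g, IsExpression f h g → ∀ (b : BasisChoice k n) M,
      mcm (Hypersurface f) ((inflationFunctor b f h g).obj M) := fun h g e b M =>
    isMCM_cok hf0 (isMatrixFactorization_inflated e (actionMatrix_comm b M))
  refine ⟨exists_isExpression f hf, fun h g e =>
    ⟨fun m A hA => isMatrixFactorization_inflated e hA, fun b =>
      ⟨hMCM h g e b, isRepresentationEmbedding_inflation b e hf0 _⟩⟩, fun hn Λ _ _ _ => ?_⟩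
  obtain ⟨h, g, e⟩ := exists_isExpression f hf
  obtain ⟨b⟩ := nonempty_basisChoice k n
  obtain ⟨G, hG⟩ := isWild_FL k hn Λ
  exact ⟨_, hG.comp (isRepresentationEmbedding_inflation b e hf0 (hMCM h g e b))⟩
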